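/- For complex $\mu,\alpha$ and real $u>1$ let $P^\mu_\alpha(u)$ be the Legendre function of the first kind, $$P^\mu_\alpha(u)=\Big(\frac{u+1}{u-1}\Big)^{\mu/2}\,\mathbf F\Big(-\alpha,\alpha+1;1-\mu;\frac{1-u}{2}\Big) =\Big(\frac{u+1}{u-1}\Big)^{\mu/2}\Big(\frac{u+1}{2}\Big)^{\alpha}\,\mathbf F\Big(-\alpha,-\alpha-\mu;1-\mu;\frac{u-1}{u+1}\Big),$$ where $\mathbf F(a,b;c;x)=\sum_{n\ge0}\frac{(a)_n(b)_n}{\Gamma(c+n)\,n!}x^n$ for $|x|<1$ (continued analytically to $\operatorname{Re}x<\tfrac12$ in the first expression). For real $\kappa,\nu,\lambda$ and complex $d$ put $$h_d(\kappa,\nu,\lambda)=\int_1^\infty P^{-\frac{d-2}2}_{-\frac12+i\kappa}(u)\,P^{-\frac{d-2}2}_{-\frac12+i\nu}(u)\,P^{-\frac{d-2}2}_{-\frac12+i\lambda}(u)\,(u^2-1)^{-\frac{d-2}4}\,du,$$ $$g_d(\kappa,\nu,\lambda)=\frac{2^{d/2}}{(4\pi)^{3/2}\,\Gamma\left(\frac{d-1}2\right)}\;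 \frac{\prod_{\epsilon,\epsilon',\epsilon''=\pm1}\Gamma\left(\frac{d-1}4+\frac{i\epsilon\kappa+i\epsilon'\nu+i\epsilon''\lambda}2\right)} {\prod_{\epsilon=\pm1}\Gamma\left(\frac{d-1}2+i\epsilon\kappa\right)\,\prod_{\epsilon'=\pm1}\Gamma\left(\frac{d-1}2+i\epsilon'\nu\right)\,\prod_{\epsilon''=\pm1}\Gamma\left(\frac{d-1}2+i\epsilon''\lambda\right)}.$$ Then, for all real $\kappa,\nu,\lambda$: the integral converges absolutely for every complex $d$ with $\operatorname{Re}d>1$; and for every complex $d$ for which the integral converges absolutely (not only for integers $d\ge2$), $h_d(\kappa,\nu,\lambda)=g_d(\kappa,\nu,\lambda)$. -/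

import Mathlib

noncomputable section

/-- The Legendre function of the first kind `P^μ_α(u)` for real `u > 1` and arbitrary complex
degree `α` and order `μ`, i.e. `((u+1)/(u-1))^(μ/2) F(-α, α+1; 1-μ; (1-u)/2)` where `F` is the
analytic continuation (from the unit disk to the half-plane `re x < 1/2`) of the regularized
hypergeometric series `∑ (a)_n (b)_n x^n / (Γ(c+n) n!)`.
The continuation is written explicitly by the Pfaff transformation
`F(a, b; c; x) = (1-x)^(-a) F(a, c-b; c; x/(x-1))`: at `x = (1-u)/2` one has `1-x = (u+1)/2` and
`x/(x-1) = (u-1)/(u+1)`, which lies in `(0,1)`, so that the series converges for every `u > 1`. -/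
def legendreP (μ α : ℂ) (u : ℝ) : ℂ :=
  (((u + 1) / (u - 1) : ℝ) : ℂ) ^ (μ / 2) * (((u + 1) / 2 : ℝ) : ℂ) ^ α *
    Complex.regularizedGaussHGFun (-α) (-α - μ) (1 - μ) (((u - 1) / (u + 1) : ℝ) : ℂ)

/-- The product of three Legendre functions of order `-(d-2)/2` and degrees `-1/2 + iκ`,
`-1/2 + iν`, `-1/2 + iλ`, with the weight `(u²-1)^(-(d-2)/4)`. -/
def tripleIntegrand (d : ℂ) (κ ν lam : ℝ) (u : ℝ) : ℂ :=
  legendreP (-(d - 2) / 2) (-1 / 2 + Complex.I * κ) u *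
    legendreP (-(d - 2) / 2) (-1 / 2 + Complex.I * ν) u *
    legendreP (-(d - 2) / 2) (-1 / 2 + Complex.I * lam) u *
    ((u ^ 2 - 1 : ℝ) : ℂ) ^ (-(d - 2) / 4)

/-- `h_d(κ,ν,λ)`, the integral over `(1,∞)`. -/
def hInt (d : ℂ) (κ ν lam : ℝ) : ℂ :=
  ∫ u in Set.Ioi (1 : ℝ), tripleIntegrand d κ ν lam u

/-- The two signs `±1`. -/
def signs : Finset ℤ := {1, -1}

/-- `g_d(κ,ν,λ)`, the Gamma-product expression. -/
def gProd (d : ℂ) (κ ν lam : ℝ) : ℂ :=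
  (2 : ℂ) ^ (d / 2) / ((4 * (Real.pi : ℂ)) ^ (3 / 2 : ℂ) * Complex.Gamma ((d - 1) / 2)) *
    ((∏ ε ∈ signs, ∏ ε' ∈ signs, ∏ ε'' ∈ signs,
        Complex.Gamma ((d - 1) / 4 +
          (Complex.I * ε * κ + Complex.I * ε' * ν + Complex.I * ε'' * lam) / 2)) /
      ((∏ ε ∈ signs, Complex.Gamma ((d - 1) / 2 + Complex.I * ε * κ)) *
        (∏ ε' ∈ signs, Complex.Gamma ((d - 1) / 2 + Complex.I * ε' * ν)) *
        (∏ ε'' ∈ signs, Complex.Gamma ((d - 1) / 2 + Complex.I * ε'' * lam))))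

end

open MeasureTheory Set Filter Topology

/-! Put `ρ = (d - 1) / 2` and take `re ρ > 0`. Each Legendre function is an explicit constant times
`(u² - 1)^((ρ - 1/2)/2) C_κ(u)`, where `C_κ(u) = ∫ e^{iκt} (u + cosh t)^(-ρ) dt`
(`legendreP_eq_conicalIntegral`). The integrand of `h_d` is therefore a multiple of `(u² - 1)^(ρ -
1/2) C_κ C_ν C_λ`. The Mehler–Dirichlet formula (`mehlerIntegral_eq`) absorbs the power of `u² - 1`
into the first factor, turning it into `M_κ(u) = ∫ e^{iκt} (u - cosh t)_+^(ρ-1) dt`. The other two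
are Laplace–Mellin transforms of Bessel functions: `Γ(ρ) C_ν(u) = ∫ e^{ρs - u e^s} B_ν(s) ds` with
`B_ν(s) = 2 K_{iν}(e^s)`.

Insert these representations in `∫ M_κ C_ν C_λ du`. The `u`-integral is a Gamma integral, and what
remains is a threefold integral over `t, s, s'`. The same threefold integral comes from `∫∫ e^{iκt +
2ρy} B_ν(y + t/2) B_ν(y - t/2) B_λ(y + t/2) B_λ(y - t/2) dt dy` by applying Macdonald's product
formula (`integral_macdonald`) to the two `B_ν` and to the two `B_λ`, and integrating out `y`. In
the coordinates `y ± t/2`, however, this double integral is the product of the Mellin transforms of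
`B_ν B_λ` at `ρ + iκ` and `ρ - iκ`. Each of them is a product of four Gamma functions over one
(`integral_exp_mul_besselIntegral_mul`), which yields the eight Gamma factors of `g_d`. Absolute
convergence of the multiple integrals is proved alongside and gives the first claim.

For the second claim it remains to see that absolute convergence forces `re d > 1`. With `u = 2e^τ -
1` and `re d ≤ 1`, the integrand times the Jacobian dominates a product of three hypergeometric
functions at `1 - e^{-τ}`. Since `c - a - b = 2iκ` is imaginary, each is, as `τ → ∞`, close to some
`A + B e^{iωτ}` or grows like `τ`. A product of such terms has integrals over unit intervals bounded
away from zero (`not_integrableOn_of_prod_le`). -/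

/-! ### Complex powers of positive reals and monotone changes of variables. -/

theorem cpow_ofReal_eq_exp {x : ℝ} (hx : 0 < x) (s : ℂ) :
    (x : ℂ) ^ s = Complex.exp (Real.log x * s) := by
  rw [Complex.cpow_def_of_ne_zero (by exact_mod_cast hx.ne'), Complex.ofReal_log hx.le]

theorem norm_exp_I_mul_mul (κ t : ℝ) : ‖Complex.exp (Complex.I * κ * t)‖ = 1 := by
  have : Complex.I * κ * t = ((κ * t : ℝ) : ℂ) * Complex.I := by push_cast; ring
  rw [this, Complex.norm_exp_ofReal_mul_I]

/-- Change of variables along an increasing differentiable function on the whole line. -/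
theorem setIntegral_range_eq {E : Type*} [NormedAddCommGroup E] [NormedSpace ℝ E]
    {g g' : ℝ → ℝ} {s : Set ℝ} (hg : ∀ x, HasDerivAt g (g' x) x) (hmono : Monotone g)
    (hs : range g = s) (f : ℝ → E) : ∫ x in s, f x = ∫ x, g' x • f (g x) := by
  have := integral_image_eq_integral_deriv_smul_of_monotoneOn (s := univ) MeasurableSet.univ
    (fun x _ => (hg x).hasDerivWithinAt) (hmono.monotoneOn _) f
  rwa [image_univ, hs, setIntegral_univ] at this

theorem integrableOn_range_iff {E : Type*} [NormedAddCommGroup E] [NormedSpace ℝ E]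
    {g g' : ℝ → ℝ} {s : Set ℝ} (hg : ∀ x, HasDerivAt g (g' x) x) (hmono : Monotone g)
    (hs : range g = s) (f : ℝ → E) :
    IntegrableOn f s ↔ Integrable (fun x => g' x • f (g x)) := by
  have := integrableOn_image_iff_integrableOn_deriv_smul_of_monotoneOn (s := univ)
    MeasurableSet.univ (fun x _ => (hg x).hasDerivWithinAt) (hmono.monotoneOn _) f
  rwa [image_univ, hs, integrableOn_univ] at this

/-! ### Gamma and Beta integrals on the whole line. -/

section GammaIntegrals

theorem exp_smul_cpow_mul_exp (a : ℂ) (r s : ℝ) :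
    Real.exp s • (((Real.exp s : ℝ) : ℂ) ^ (a - 1) * Complex.exp (-(r * (Real.exp s : ℝ)))) =
      Complex.exp (a * s - (r * Real.exp s : ℝ)) := by
  rw [cpow_ofReal_eq_exp (Real.exp_pos s), Real.log_exp, Complex.real_smul, Complex.ofReal_exp s,
    ← Complex.exp_add, ← Complex.exp_add]
  push_cast
  ring_nf

theorem integral_exp_mul_sub_mul_exp {a : ℂ} {r : ℝ} (ha : 0 < a.re) (hr : 0 < r) :
    ∫ s : ℝ, Complex.exp (a * s - (r * Real.exp s : ℝ)) = (r : ℂ) ^ (-a) * Complex.Gamma a := by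
  have h := setIntegral_range_eq Real.hasDerivAt_exp Real.exp_monotone Real.range_exp
    (fun t : ℝ => (t : ℂ) ^ (a - 1) * Complex.exp (-(r * t)))
  rw [Complex.integral_cpow_mul_exp_neg_mul_Ioi ha hr] at h
  simp_rw [exp_smul_cpow_mul_exp] at h
  rw [← h, one_div, Complex.inv_cpow, Complex.cpow_neg]
  rw [Complex.arg_ofReal_of_nonneg hr.le]
  exact Real.pi_pos.ne

/-- The integral formula holds without assuming integrability, and its value is nonzero; a
non-integrable function would have integral `0` by convention. -/
theorem integrable_exp_mul_sub_mul_exp {a : ℂ} {r : ℝ} (ha : 0 < a.re) (hr : 0 < r) :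
    Integrable fun s : ℝ => Complex.exp (a * s - (r * Real.exp s : ℝ)) := by
  by_contra h
  have := integral_exp_mul_sub_mul_exp ha hr
  rw [integral_undef h, eq_comm, mul_eq_zero] at this
  rcases this with h | h
  · rw [cpow_ofReal_eq_exp hr] at h
    exact Complex.exp_ne_zero _ h
  · exact Complex.Gamma_ne_zero_of_re_pos ha h

theorem sigmoid_mul_smul_cpow (u v : ℂ) (t : ℝ) :
    (Real.sigmoid t * (1 - Real.sigmoid t)) • (((Real.sigmoid t : ℝ) : ℂ) ^ (u - 1) *
      (1 - ((Real.sigmoid t : ℝ) : ℂ)) ^ (v - 1)) =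
      ((Real.sigmoid t : ℝ) : ℂ) ^ u * ((Real.sigmoid (-t) : ℝ) : ℂ) ^ v := by
  have h0 := Real.sigmoid_pos t
  have h1 := Real.sigmoid_pos (-t)
  rw [Real.sigmoid_neg] at h1 ⊢
  have h0' : ((Real.sigmoid t : ℝ) : ℂ) ≠ 0 := by exact_mod_cast h0.ne'
  have h1' : 1 - ((Real.sigmoid t : ℝ) : ℂ) ≠ 0 := by exact_mod_cast h1.ne'
  rw [Complex.real_smul]
  push_cast
  rw [Complex.cpow_sub _ _ h0', Complex.cpow_sub _ _ h1', Complex.cpow_one, Complex.cpow_one]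
  field_simp

theorem integrableOn_Ioo_cpow_mul_cpow {u v : ℂ} (hu : 0 < u.re) (hv : 0 < v.re) :
    IntegrableOn (fun x : ℝ => (x : ℂ) ^ (u - 1) * (1 - (x : ℂ)) ^ (v - 1)) (Ioo 0 1) := by
  have := Complex.betaIntegral_convergent hu hv
  rwa [intervalIntegrable_iff_integrableOn_Ioo_of_le zero_le_one] at this

theorem setIntegral_Ioo_cpow_mul_cpow {u v : ℂ} (hu : 0 < u.re) (hv : 0 < v.re) :
    ∫ x in Ioo (0 : ℝ) 1, (x : ℂ) ^ (u - 1) * (1 - (x : ℂ)) ^ (v - 1) =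
      Complex.Gamma u * Complex.Gamma v / Complex.Gamma (u + v) := by
  rw [Complex.Gamma_mul_Gamma_eq_betaIntegral hu hv, mul_div_cancel_left₀ _
    (Complex.Gamma_ne_zero_of_re_pos (by simpa using add_pos hu hv)), Complex.betaIntegral,
    intervalIntegral.integral_of_le zero_le_one, integral_Ioc_eq_integral_Ioo]

/-- Euler's Beta integral after `x = sigmoid t`, whose Jacobian is `x (1 - x)`. -/
theorem integral_sigmoid_cpow_mul_cpow {u v : ℂ} (hu : 0 < u.re) (hv : 0 < v.re) :
    ∫ t, ((Real.sigmoid t : ℝ) : ℂ) ^ u * ((Real.sigmoid (-t) : ℝ) : ℂ) ^ v =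
      Complex.Gamma u * Complex.Gamma v / Complex.Gamma (u + v) := by
  have h := setIntegral_range_eq Real.hasDerivAt_sigmoid Real.sigmoid_monotone Real.range_sigmoid
    (fun x : ℝ => (x : ℂ) ^ (u - 1) * (1 - (x : ℂ)) ^ (v - 1))
  rw [setIntegral_Ioo_cpow_mul_cpow hu hv] at h
  simp_rw [h, sigmoid_mul_smul_cpow]

theorem integrable_sigmoid_cpow_mul_cpow {u v : ℂ} (hu : 0 < u.re) (hv : 0 < v.re) :
    Integrable fun t => ((Real.sigmoid t : ℝ) : ℂ) ^ u * ((Real.sigmoid (-t) : ℝ) : ℂ) ^ v := by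
  have h := (integrableOn_range_iff Real.hasDerivAt_sigmoid Real.sigmoid_monotone
    Real.range_sigmoid (fun x : ℝ => (x : ℂ) ^ (u - 1) * (1 - (x : ℂ)) ^ (v - 1))).1
    (integrableOn_Ioo_cpow_mul_cpow hu hv)
  simpa only [sigmoid_mul_smul_cpow] using h

theorem log_two_mul_one_add_cosh (t : ℝ) :
    Real.log (2 * (1 + Real.cosh t)) =
      -(Real.log (Real.sigmoid t) + Real.log (Real.sigmoid (-t))) := by
  rw [← Real.log_mul (Real.sigmoid_pos _).ne' (Real.sigmoid_pos _).ne', ← Real.log_inv]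
  congr 1
  rw [Real.sigmoid_def, Real.sigmoid_def, neg_neg, Real.cosh_eq, Real.exp_neg]
  field_simp
  ring

theorem log_sigmoid_sub_log_sigmoid_neg (t : ℝ) :
    Real.log (Real.sigmoid t) - Real.log (Real.sigmoid (-t)) = t := by
  rw [← Real.sigmoid_mul_rexp_neg, Real.log_mul (Real.sigmoid_pos _).ne' (Real.exp_pos _).ne',
    Real.log_exp]
  ring

/-- Since `sigmoid t * sigmoid (-t) = 1 / (2 (1 + cosh t))` and `sigmoid t / sigmoid (-t) = e^t`,
the Beta integral with exponents `ρ ± iκ` is a Fourier transform of a power of `1 + cosh t`. -/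
theorem sigmoid_cpow_mul_cpow_eq (ρ : ℂ) (κ t : ℝ) :
    ((Real.sigmoid t : ℝ) : ℂ) ^ (ρ + Complex.I * κ) *
      ((Real.sigmoid (-t) : ℝ) : ℂ) ^ (ρ - Complex.I * κ) =
    Complex.exp (Complex.I * κ * t) * ((2 * (1 + Real.cosh t) : ℝ) : ℂ) ^ (-ρ) := by
  have hc : 0 < 2 * (1 + Real.cosh t) := by have := Real.cosh_pos t; positivity
  rw [cpow_ofReal_eq_exp (Real.sigmoid_pos _), cpow_ofReal_eq_exp (Real.sigmoid_pos _),
    cpow_ofReal_eq_exp hc, ← Complex.exp_add, ← Complex.exp_add, log_two_mul_one_add_cosh]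
  conv_rhs => rw [← log_sigmoid_sub_log_sigmoid_neg t]
  rw [log_sigmoid_sub_log_sigmoid_neg t]
  congr 1
  conv_rhs => rw [show (t : ℂ) = ((Real.log (Real.sigmoid t) - Real.log (Real.sigmoid (-t)) : ℝ) : ℂ)
    by rw [log_sigmoid_sub_log_sigmoid_neg t]]
  push_cast
  ring

theorem integral_exp_mul_cosh_cpow {ρ : ℂ} (hρ : 0 < ρ.re) (κ : ℝ) :
    ∫ t : ℝ, Complex.exp (Complex.I * κ * t) * ((2 * (1 + Real.cosh t) : ℝ) : ℂ) ^ (-ρ) =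
      Complex.Gamma (ρ + Complex.I * κ) * Complex.Gamma (ρ - Complex.I * κ) /
        Complex.Gamma (2 * ρ) := by
  simp_rw [← sigmoid_cpow_mul_cpow_eq]
  rw [integral_sigmoid_cpow_mul_cpow (by simpa) (by simpa)]
  ring_nf

theorem integrable_exp_mul_cosh_cpow {ρ : ℂ} (hρ : 0 < ρ.re) (κ : ℝ) :
    Integrable fun t : ℝ =>
      Complex.exp (Complex.I * κ * t) * ((2 * (1 + Real.cosh t) : ℝ) : ℂ) ^ (-ρ) := by
  simp_rw [← sigmoid_cpow_mul_cpow_eq]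
  exact integrable_sigmoid_cpow_mul_cpow (by simpa) (by simpa)

end GammaIntegrals

/-! ### Binomial and hypergeometric series, and termwise integration. -/

section PowerSeries

theorem HasSum.of_forall_eq {f g : ℕ → ℂ} {a : ℂ} (h : HasSum f a) (hfg : ∀ n, f n = g n) :
    HasSum g a := by
  rwa [← funext hfg]

theorem enorm_lt_one_iff_norm_lt_one {x : ℂ} : ‖x‖ₑ < 1 ↔ ‖x‖ < 1 := by
  rw [enorm_eq_nnnorm, ← ENNReal.coe_one, ENNReal.coe_lt_coe, ← NNReal.coe_lt_coe, coe_nnnorm,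
    NNReal.coe_one]

theorem hasFPowerSeriesOnBall_ofScalars_of_hasSum {f : ℂ → ℂ} {c : ℕ → ℂ}
    (h : ∀ x : ℂ, ‖x‖ < 1 → HasSum (fun n => c n * x ^ n) (f x)) :
    HasFPowerSeriesOnBall f (FormalMultilinearSeries.ofScalars ℂ c) 0 1 where
  r_le := by
    refine ENNReal.le_of_forall_nnreal_lt fun r hr => ?_
    refine FormalMultilinearSeries.le_radius_of_summable_norm _ ?_
    have hr' : ‖((r : ℝ) : ℂ)‖ < 1 := by
      simpa using (by exact_mod_cast hr : (r : ℝ) < 1)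
    refine (h _ hr').summable.norm.congr fun n => ?_
    simp
  r_pos := one_pos
  hasSum := by
    intro y hy
    have hy' : ‖y‖ < 1 := by simpa [enorm_lt_one_iff_norm_lt_one] using hy
    simpa [FormalMultilinearSeries.ofScalars_apply_eq, zero_add, mul_comm] using h y hy'

theorem hasSum_one_sub_cpow_neg (a : ℂ) {x : ℂ} (hx : ‖x‖ < 1) :
    HasSum (fun n => (ascPochhammer ℂ n).eval a / (n.factorial : ℂ) * x ^ n) ((1 - x) ^ (-a)) := by
  have h := (Complex.one_div_one_sub_cpow_hasFPowerSeriesOnBall_zero a).hasSum (y := x)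
    (by simpa [enorm_lt_one_iff_norm_lt_one] using hx)
  rw [zero_add, one_div, ← Complex.cpow_neg] at h
  refine h.of_forall_eq fun n => ?_
  rw [FormalMultilinearSeries.ofScalars_apply_eq, smul_eq_mul]
  congr 1
  have h1 : Ring.choose (a + n - 1) n = Ring.multichoose a n := by
    rw [Ring.choose]
    congr 1
    ring
  rw [h1, eq_div_iff (by exact_mod_cast n.factorial_ne_zero), mul_comm]
  have := Ring.factorial_nsmul_multichoose_eq_ascPochhammer a n
  rw [nsmul_eq_mul] at this
  rw [this, Polynomial.ascPochhammer_smeval_eq_eval]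

theorem hasSum_regularizedGaussHGFun (a b c : ℂ) {x : ℂ} (hx : ‖x‖ < 1) :
    HasSum (fun n => (ascPochhammer ℂ n).eval a * (ascPochhammer ℂ n).eval b /
      ((n.factorial : ℂ) * Complex.Gamma (c + n)) * x ^ n)
      (Complex.regularizedGaussHGFun a b c x) := by
  have h := (Complex.regularizedGaussHGFunSeries a b c).hasSum (x := x) (by
    rw [Metric.mem_eball, edist_zero_right]
    refine lt_of_lt_of_le ?_ (Complex.radius_regularizedGaussHGFunSeries_ge_one a b c)
    exact enorm_lt_one_iff_norm_lt_one.2 hx)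
  refine h.of_forall_eq fun n => ?_
  rw [FormalMultilinearSeries.apply_eq_pow_smul_coeff,
    Complex.coeff_regularizedGaussHGFunSeries, smul_eq_mul, mul_comm]

theorem analyticOnNhd_regularizedGaussHGFun (a b c : ℂ) :
    AnalyticOnNhd ℂ (Complex.regularizedGaussHGFun a b c) (Metric.ball 0 1) := by
  have := (hasFPowerSeriesOnBall_ofScalars_of_hasSum
    fun x hx => hasSum_regularizedGaussHGFun a b c hx).analyticOnNhd
  rwa [← Metric.eball_ofReal, ENNReal.ofReal_one]

/-- Termwise integration of the binomial series `(1 - x T)^(-a)` against an integrable weight. -/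
theorem hasSum_integral_mul_one_sub_cpow {α : Type*} [MeasurableSpace α] {μ : Measure α}
    {w : α → ℂ} {T : α → ℝ} (hw : Integrable w μ) (hT : AEStronglyMeasurable T μ)
    (hT0 : ∀ᵐ t ∂μ, 0 ≤ T t) (hT1 : ∀ᵐ t ∂μ, T t ≤ 1) (a : ℂ) {x : ℂ} (hx : ‖x‖ < 1) :
    HasSum (fun n => (ascPochhammer ℂ n).eval a / (n.factorial : ℂ) * x ^ n *
      ∫ t, w t * ((T t ^ n : ℝ) : ℂ) ∂μ) (∫ t, w t * (1 - x * (T t : ℂ)) ^ (-a) ∂μ) := by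
  set k : ℕ → ℂ := fun n => (ascPochhammer ℂ n).eval a / (n.factorial : ℂ) * x ^ n with hk
  have hTn : ∀ n : ℕ, ∀ᵐ t ∂μ, ‖((T t ^ n : ℝ) : ℂ)‖ ≤ 1 := fun n => by
    filter_upwards [hT0, hT1] with t h0 h1
    rw [Complex.norm_real, Real.norm_of_nonneg (pow_nonneg h0 n)]
    exact pow_le_one₀ h0 h1
  have hint : ∀ n : ℕ, Integrable (fun t => w t * ((T t ^ n : ℝ) : ℂ)) μ := fun n => by
    refine hw.mul_bdd (c := 1) ?_ (hTn n)
    exact Complex.continuous_ofReal.comp_aestronglyMeasurable (hT.pow n)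
  have h := hasSum_integral_of_summable_integral_norm
    (F := fun n t => k n * (w t * ((T t ^ n : ℝ) : ℂ))) (μ := μ) (fun n => (hint n).const_mul _) (by
      refine Summable.of_nonneg_of_le (fun n => integral_nonneg fun t => norm_nonneg _)
        (fun n => ?_) ((hasSum_one_sub_cpow_neg a hx).summable.norm.mul_right (∫ t, ‖w t‖ ∂μ))
      rw [← integral_const_mul]
      refine integral_mono_ae ((hint n).const_mul _).norm (hw.norm.const_mul _) ?_
      filter_upwards [hTn n] with t ht
      change ‖k n * (w t * _)‖ ≤ ‖k n‖ * ‖w t‖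
      rw [norm_mul (k n), norm_mul (w t)]
      exact mul_le_mul_of_nonneg_left (mul_le_of_le_one_right (norm_nonneg _) ht) (norm_nonneg _))
  simp_rw [integral_const_mul] at h
  have hfin : ∫ t, w t * (1 - x * (T t : ℂ)) ^ (-a) ∂μ =
      ∫ t, ∑' n, k n * (w t * ((T t ^ n : ℝ) : ℂ)) ∂μ := by
    refine integral_congr_ae ?_
    filter_upwards [hT0, hT1] with t h0 h1
    have hxt : ‖x * (T t : ℂ)‖ < 1 := by
      rw [norm_mul, Complex.norm_real, Real.norm_of_nonneg h0]
      exact lt_of_le_of_lt (mul_le_of_le_one_right (norm_nonneg _) h1) hx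
    rw [← (hasSum_one_sub_cpow_neg a hxt).tsum_eq, ← tsum_mul_left]
    refine tsum_congr fun n => ?_
    rw [hk]
    push_cast
    ring
  rwa [hfin]

end PowerSeries

/-! ### Euler's integral and Pfaff's transformation. -/

section Euler

theorem ascPochhammer_eval_mul_Gamma {b : ℂ} (hb : 0 < b.re) (n : ℕ) :
    (ascPochhammer ℂ n).eval b * Complex.Gamma b = Complex.Gamma (b + n) := by
  have hb' : ∀ k : ℕ, b ≠ -k := fun k h => by
    rw [h] at hb
    simp at hb
    have : (0 : ℝ) ≤ k := k.cast_nonneg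
    linarith
  rw [← Complex.Gamma_add_nat_div_Gamma_eq b hb',
    div_mul_cancel₀ _ (Complex.Gamma_ne_zero_of_re_pos hb)]

/-- Expand `(1 - x t)^(-a)` in the binomial series; every term is a Beta integral. -/
theorem setIntegral_euler_eq {a b c x : ℂ} (hb : 0 < b.re) (hc : 0 < (c - b).re) (hx : ‖x‖ < 1) :
    ∫ t in Ioo (0 : ℝ) 1, ((t : ℂ) ^ (b - 1) * (1 - (t : ℂ)) ^ (c - b - 1)) *
      (1 - x * (t : ℂ)) ^ (-a) =
    Complex.Gamma b * Complex.Gamma (c - b) * Complex.regularizedGaussHGFun a b c x := by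
  have h := hasSum_integral_mul_one_sub_cpow (μ := volume.restrict (Ioo (0 : ℝ) 1)) (T := fun t => t)
    (integrableOn_Ioo_cpow_mul_cpow hb hc) (by fun_prop)
    ((ae_restrict_mem measurableSet_Ioo).mono fun t ht => ht.1.le)
    ((ae_restrict_mem measurableSet_Ioo).mono fun t ht => ht.2.le) a hx
  refine h.unique ?_
  have h2 := (hasSum_regularizedGaussHGFun a b c hx).mul_left
    (Complex.Gamma b * Complex.Gamma (c - b))
  refine h2.of_forall_eq fun n => ?_
  have h3 : ∫ t in Ioo (0 : ℝ) 1, ((t : ℂ) ^ (b - 1) * (1 - (t : ℂ)) ^ (c - b - 1)) *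
      ((t ^ n : ℝ) : ℂ) = Complex.Gamma (b + n) * Complex.Gamma (c - b) / Complex.Gamma (c + n) := by
    have := setIntegral_Ioo_cpow_mul_cpow (u := b + n) (v := c - b) (by
      simp only [Complex.add_re, Complex.natCast_re]; positivity) hc
    rw [show b + n + (c - b) = c + n by ring] at this
    rw [← this]
    refine setIntegral_congr_fun measurableSet_Ioo fun t ht => ?_
    have ht' : (t : ℂ) ≠ 0 := by exact_mod_cast ht.1.ne'
    rw [show b + n - 1 = (b - 1) + n by ring, Complex.cpow_add _ _ ht', Complex.cpow_natCast]
    push_cast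
    ring
  rw [h3, ← ascPochhammer_eval_mul_Gamma hb]
  field_simp

/-- Pfaff's transformation at a negative real argument. -/
theorem regularizedGaussHGFun_pfaff {a b c : ℂ} {y : ℝ} (hb : 0 < b.re) (hc : 0 < (c - b).re)
    (hy : 0 ≤ y) (hy1 : y < 1) :
    Complex.regularizedGaussHGFun a b c (-(y : ℂ)) = ((1 + y : ℝ) : ℂ) ^ (-a) *
      Complex.regularizedGaussHGFun a (c - b) c ((y / (1 + y) : ℝ) : ℂ) := by
  have h1 := setIntegral_euler_eq (a := a) hb hc (x := -(y : ℂ)) (by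
    rwa [norm_neg, Complex.norm_real, Real.norm_of_nonneg hy])
  have hyy : 0 < 1 + y := by linarith
  have h2 := setIntegral_euler_eq (a := a) (b := c - b) (c := c) (x := ((y / (1 + y) : ℝ) : ℂ)) hc
    (by simpa using hb) (by
      rw [Complex.norm_real, Real.norm_of_nonneg (by positivity), div_lt_one hyy]; linarith)
  rw [show c - (c - b) = b by ring] at h2
  have hG : Complex.Gamma b * Complex.Gamma (c - b) ≠ 0 :=
    mul_ne_zero (Complex.Gamma_ne_zero_of_re_pos hb) (Complex.Gamma_ne_zero_of_re_pos hc)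
  refine mul_left_cancel₀ hG ?_
  rw [← h1, mul_left_comm, mul_comm (Complex.Gamma b), ← h2, ← integral_const_mul,
    ← integral_Ioc_eq_integral_Ioo, ← integral_Ioc_eq_integral_Ioo,
    ← intervalIntegral.integral_of_le zero_le_one, ← intervalIntegral.integral_of_le zero_le_one]
  -- Under `t ↦ 1 - t` the factor `1 - y/(1+y) * (1 - t)` becomes `(1 + y t)/(1 + y)`, so the two
  -- Euler integrands agree up to `(1 + y)^(-a)`.
  have hsub := fun f : ℝ → ℂ => intervalIntegral.integral_comp_sub_left (a := 0) (b := 1) f 1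
  simp only [sub_self, sub_zero] at hsub
  conv_rhs => rw [← hsub]
  rw [intervalIntegral.integral_of_le zero_le_one,
    intervalIntegral.integral_of_le zero_le_one, integral_Ioc_eq_integral_Ioo,
    integral_Ioc_eq_integral_Ioo]
  refine setIntegral_congr_fun measurableSet_Ioo fun t ht => ?_
  have ht0 : 0 < t := ht.1
  have e1 : (1 - -(y : ℂ) * t) = ((1 + y * t : ℝ) : ℂ) := by push_cast; ring
  have e2 : 1 - ((y / (1 + y) : ℝ) : ℂ) * ((1 - t : ℝ) : ℂ) =
      (((1 + y * t) / (1 + y) : ℝ) : ℂ) := by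
    have : ((1 : ℂ) + y) ≠ 0 := by exact_mod_cast hyy.ne'
    push_cast
    field_simp
    ring
  have e3 : ((1 + y * t : ℝ) : ℂ) ^ (-a) =
      ((1 + y : ℝ) : ℂ) ^ (-a) * (((1 + y * t) / (1 + y) : ℝ) : ℂ) ^ (-a) := by
    rw [← Complex.mul_cpow_ofReal_nonneg hyy.le (by positivity), ← Complex.ofReal_mul,
      mul_div_cancel₀ _ hyy.ne']
  rw [e1, e2, e3]
  push_cast
  rw [sub_sub_cancel]
  ring

end Euler

/-! ### The conical function as an integral over the line. -/

noncomputable section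

/-- The integral `∫ e^{iκt} (u + cosh t)^(-ρ) dt`, which is a multiple of
`(u² - 1)^((1/2-ρ)/2) P^{1/2-ρ}_{-1/2+iκ}(u)`. -/
def conicalIntegral (ρ : ℂ) (κ u : ℝ) : ℂ :=
  ∫ t : ℝ, Complex.exp (Complex.I * κ * t) * ((u + Real.cosh t : ℝ) : ℂ) ^ (-ρ)

/-- The product `Γ(ρ + iκ) Γ(ρ - iκ)`. -/
def gammaPair (ρ : ℂ) (κ : ℝ) : ℂ :=
  Complex.Gamma (ρ + Complex.I * κ) * Complex.Gamma (ρ - Complex.I * κ)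

end

theorem gammaPair_ne_zero {ρ : ℂ} (hρ : 0 < ρ.re) (κ : ℝ) : gammaPair ρ κ ≠ 0 :=
  mul_ne_zero (Complex.Gamma_ne_zero_of_re_pos (by simpa))
    (Complex.Gamma_ne_zero_of_re_pos (by simpa))

theorem one_add_cosh_pos (t : ℝ) : 0 < 1 + Real.cosh t := by
  have := Real.cosh_pos t
  positivity

section Legendre

variable {ρ : ℂ}

/-- The factor is `4^n (2 (1 + cosh t))^(-n)`, so it only shifts `ρ` to `ρ + n` in the Fourier–Beta
integral. -/
theorem integral_cosh_weight_mul_pow (hρ : 0 < ρ.re) (κ : ℝ) (n : ℕ) :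
    ∫ t : ℝ, (Complex.exp (Complex.I * κ * t) * ((2 * (1 + Real.cosh t) : ℝ) : ℂ) ^ (-ρ)) *
      (((2 / (1 + Real.cosh t)) ^ n : ℝ) : ℂ) =
    4 ^ n * (gammaPair (ρ + n) κ / Complex.Gamma (2 * (ρ + n))) := by
  rw [gammaPair, ← integral_exp_mul_cosh_cpow (ρ := ρ + n) (by
    simp only [Complex.add_re, Complex.natCast_re]; positivity) κ, ← integral_const_mul]
  refine integral_congr_ae (ae_of_all _ fun t => ?_)
  have h1 := one_add_cosh_pos t
  have h2 : (((2 * (1 + Real.cosh t) : ℝ)) : ℂ) ≠ 0 := by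
    exact_mod_cast (by positivity : 2 * (1 + Real.cosh t) ≠ 0)
  have h3 : (1 + (Real.cosh t : ℂ)) ≠ 0 := by exact_mod_cast h1.ne'
  simp only
  rw [neg_add, Complex.cpow_add _ _ h2, Complex.cpow_neg _ (n : ℂ), Complex.cpow_natCast]
  have h4 : (((2 / (1 + Real.cosh t)) ^ n : ℝ) : ℂ) =
      4 ^ n * (((2 * (1 + Real.cosh t) : ℝ) : ℂ) ^ n)⁻¹ := by
    rw [← inv_pow, ← mul_pow]
    push_cast
    congr 1
    field_simp
    norm_num
  rw [h4]
  ring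

/-- The duplication formula splits `Γ(2(ρ + n))` into `Γ(ρ + n) Γ(ρ + n + 1/2)`: the first factor
cancels `(ρ)_n` up to `Γ(ρ)`, the second supplies the parameter `c = ρ + 1/2`. -/
theorem hgf_coeff_eq (hρ : 0 < ρ.re) (κ : ℝ) (n : ℕ) (x : ℂ) :
    (ascPochhammer ℂ n).eval ρ / (n.factorial : ℂ) * x ^ n *
      (4 ^ n * (gammaPair (ρ + n) κ / Complex.Gamma (2 * (ρ + n)))) =
    (2 : ℂ) ^ (1 - 2 * ρ) * (√Real.pi : ℝ) * gammaPair ρ κ / Complex.Gamma ρ *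
      ((ascPochhammer ℂ n).eval (ρ - Complex.I * κ) * (ascPochhammer ℂ n).eval (ρ + Complex.I * κ) /
        ((n.factorial : ℂ) * Complex.Gamma (ρ + 1 / 2 + n)) * x ^ n) := by
  have hp : 0 < (ρ + n).re := by
    simp only [Complex.add_re, Complex.natCast_re]; positivity
  have h1 : (ascPochhammer ℂ n).eval (ρ - Complex.I * κ) *
      (ascPochhammer ℂ n).eval (ρ + Complex.I * κ) * gammaPair ρ κ = gammaPair (ρ + n) κ := by
    have e1 := ascPochhammer_eval_mul_Gamma (b := ρ + Complex.I * κ) (by simpa) n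
    have e2 := ascPochhammer_eval_mul_Gamma (b := ρ - Complex.I * κ) (by simpa) n
    rw [gammaPair, gammaPair, show ρ + n + Complex.I * κ = ρ + Complex.I * κ + n by ring,
      show ρ + n - Complex.I * κ = ρ - Complex.I * κ + n by ring, ← e1, ← e2]
    ring
  have h2 := Complex.Gamma_mul_Gamma_add_half (ρ + n)
  have h3 := ascPochhammer_eval_mul_Gamma hρ n
  have h4 : (2 : ℂ) ^ (1 - 2 * (ρ + n)) * 4 ^ n = (2 : ℂ) ^ (1 - 2 * ρ) := by
    rw [show (1 : ℂ) - 2 * ρ = 1 - 2 * (ρ + n) + ((2 * n : ℕ) : ℂ) by push_cast; ring,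
      Complex.cpow_add _ _ two_ne_zero, Complex.cpow_natCast, pow_mul]
    norm_num
  have g0 := Complex.Gamma_ne_zero_of_re_pos hρ
  have g1 : Complex.Gamma (ρ + 1 / 2 + n) ≠ 0 := Complex.Gamma_ne_zero_of_re_pos (by
    simp only [Complex.add_re, Complex.natCast_re]
    norm_num
    positivity)
  have g2 : Complex.Gamma (2 * (ρ + n)) ≠ 0 := Complex.Gamma_ne_zero_of_re_pos (by
    simpa using hp)
  have hf : (n.factorial : ℂ) ≠ 0 := by exact_mod_cast n.factorial_ne_zero
  rw [← h1, ← h4]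
  rw [← h3, show ρ + n + 1 / 2 = ρ + 1 / 2 + n by ring] at h2
  generalize Complex.Gamma (ρ + 1 / 2 + n) = g at *
  field_simp
  linear_combination (x ^ n * (ascPochhammer ℂ n).eval (ρ - Complex.I * κ) *
      (ascPochhammer ℂ n).eval (ρ + Complex.I * κ) * gammaPair ρ κ) * h2

theorem ofReal_cpow_mul_of_pos {x y : ℝ} (hx : 0 < x) (hy : 0 < y) (s : ℂ) :
    ((x * y : ℝ) : ℂ) ^ s = (x : ℂ) ^ s * (y : ℂ) ^ s := by
  rw [Complex.ofReal_mul, Complex.mul_cpow_ofReal_nonneg hx.le hy.le]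

/-- With `u = 1 + 2y` one has `u + cosh t = (1 + cosh t)(1 + y * 2/(1 + cosh t))`, and the last
factor is expanded in powers of `y`. This works only for `y < 1`, that is `u < 3`; larger `u` are
reached by analytic continuation in `x = (u - 1)/(u + 1)`. -/
theorem conicalIntegral_eq_of_lt_three (hρ : 0 < ρ.re) (κ : ℝ) {y : ℝ} (hy : 0 ≤ y) (hy1 : y < 1) :
    conicalIntegral ρ κ (1 + 2 * y) = (2 : ℂ) ^ ρ *
      ((2 : ℂ) ^ (1 - 2 * ρ) * (√Real.pi : ℝ) * gammaPair ρ κ / Complex.Gamma ρ *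
      Complex.regularizedGaussHGFun (ρ - Complex.I * κ) (ρ + Complex.I * κ) (ρ + 1 / 2)
        (-(y : ℂ))) := by
  have hyn : ‖-(y : ℂ)‖ < 1 := by rwa [norm_neg, Complex.norm_real, Real.norm_of_nonneg hy]
  have h := hasSum_integral_mul_one_sub_cpow (T := fun t : ℝ => 2 / (1 + Real.cosh t))
    (integrable_exp_mul_cosh_cpow hρ κ)
    ((continuous_const.div (by fun_prop) fun t =>
      (one_add_cosh_pos t).ne').aestronglyMeasurable)
    (ae_of_all _ fun t => by have := one_add_cosh_pos t; positivity)
    (ae_of_all _ fun t => by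
      rw [div_le_one (one_add_cosh_pos t)]
      have := Real.one_le_cosh t
      linarith) ρ hyn
  simp_rw [integral_cosh_weight_mul_pow hρ κ, hgf_coeff_eq hρ] at h
  rw [((hasSum_regularizedGaussHGFun _ _ _ hyn).mul_left _).unique h, ← integral_const_mul,
    conicalIntegral]
  refine integral_congr_ae (ae_of_all _ fun t => ?_)
  have h1 := one_add_cosh_pos t
  have e1 : 1 + 2 * y + Real.cosh t =
      2⁻¹ * ((2 * (1 + Real.cosh t)) * (1 + y * (2 / (1 + Real.cosh t)))) := by
    field_simp
    ring
  have e2 : (2 : ℂ) ^ ρ = ((2⁻¹ : ℝ) : ℂ) ^ (-ρ) := by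
    rw [cpow_ofReal_eq_exp (by norm_num), show (2 : ℂ) = ((2 : ℝ) : ℂ) by norm_num,
      cpow_ofReal_eq_exp (by norm_num), Real.log_inv]
    push_cast
    ring_nf
  simp only
  rw [e1, ofReal_cpow_mul_of_pos (by norm_num) (by positivity),
    ofReal_cpow_mul_of_pos (by positivity) (by positivity), e2]
  push_cast
  ring_nf

theorem conicalIntegral_eq_integral_tanh (κ : ℝ) {x : ℝ} (hx : 0 ≤ x) (hx1 : x < 1) :
    conicalIntegral ρ κ ((1 + x) / (1 - x)) = ((2 * (1 - x) : ℝ) : ℂ) ^ ρ *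
      ∫ t : ℝ, (Complex.exp (Complex.I * κ * t) * ((2 * (1 + Real.cosh t) : ℝ) : ℂ) ^ (-ρ)) *
        (1 - (x : ℂ) * (((Real.cosh t - 1) / (1 + Real.cosh t) : ℝ) : ℂ)) ^ (-ρ) := by
  rw [← integral_const_mul, conicalIntegral]
  refine integral_congr_ae (ae_of_all _ fun t => ?_)
  have h1 := one_add_cosh_pos t
  have h2 := Real.one_le_cosh t
  have h3 : 0 < 1 - x := by linarith
  have h4 : 0 < 1 - x * ((Real.cosh t - 1) / (1 + Real.cosh t)) := by
    have e : 1 - x * ((Real.cosh t - 1) / (1 + Real.cosh t)) =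
      ((1 + x) + (1 - x) * Real.cosh t) / (1 + Real.cosh t) := by field_simp; ring
    rw [e]
    positivity
  have e1 : (1 + x) / (1 - x) + Real.cosh t = (2 * (1 - x))⁻¹ *
      ((2 * (1 + Real.cosh t)) * (1 - x * ((Real.cosh t - 1) / (1 + Real.cosh t)))) := by
    field_simp
    ring
  have e2 : ((2 * (1 - x) : ℝ) : ℂ) ^ ρ = (((2 * (1 - x))⁻¹ : ℝ) : ℂ) ^ (-ρ) := by
    rw [cpow_ofReal_eq_exp (by positivity), cpow_ofReal_eq_exp (by positivity), Real.log_inv]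
    push_cast
    ring_nf
  simp only
  rw [e1, ofReal_cpow_mul_of_pos (by positivity) (by positivity),
    ofReal_cpow_mul_of_pos (by positivity) h4, e2]
  push_cast
  ring

/-- Here the ratio `(cosh t - 1)/(1 + cosh t)` lies in `[0, 1)`, so the expansion in `x` converges
on the whole unit disk. Its coefficients are never evaluated; only analyticity is extracted. -/
theorem analyticOnNhd_integral_tanh (hρ : 0 < ρ.re) (κ : ℝ) :
    AnalyticOnNhd ℂ (fun x : ℂ => ∫ t : ℝ,
      (Complex.exp (Complex.I * κ * t) * ((2 * (1 + Real.cosh t) : ℝ) : ℂ) ^ (-ρ)) *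
        (1 - x * (((Real.cosh t - 1) / (1 + Real.cosh t) : ℝ) : ℂ)) ^ (-ρ))
      (Metric.ball 0 1) := by
  have h := fun (x : ℂ) (hx : ‖x‖ < 1) =>
    hasSum_integral_mul_one_sub_cpow (T := fun t : ℝ => (Real.cosh t - 1) / (1 + Real.cosh t))
      (integrable_exp_mul_cosh_cpow hρ κ)
      ((Continuous.div (by fun_prop) (by fun_prop) fun t =>
        (one_add_cosh_pos t).ne').aestronglyMeasurable)
      (ae_of_all _ fun t => div_nonneg (by linarith [Real.one_le_cosh t]) (one_add_cosh_pos t).le)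
      (ae_of_all _ fun t => by
        rw [div_le_one (one_add_cosh_pos t)]
        linarith) ρ hx
  have h2 := (hasFPowerSeriesOnBall_ofScalars_of_hasSum fun x hx =>
    (h x hx).of_forall_eq fun n => mul_right_comm _ _ _).analyticOnNhd
  rwa [← Metric.eball_ofReal, ENNReal.ofReal_one]

/-- The hypergeometric series in the variable `(u-1)/(u+1)` as an integral. -/
theorem integral_tanh_eq (hρ : 0 < ρ.re) (κ : ℝ) {x : ℝ} (hx : 0 ≤ x) (hx1 : x < 1) :
    ∫ t : ℝ, (Complex.exp (Complex.I * κ * t) * ((2 * (1 + Real.cosh t) : ℝ) : ℂ) ^ (-ρ)) *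
        (1 - (x : ℂ) * (((Real.cosh t - 1) / (1 + Real.cosh t) : ℝ) : ℂ)) ^ (-ρ) =
      (2 : ℂ) ^ (1 - 2 * ρ) * (√Real.pi : ℝ) * gammaPair ρ κ / Complex.Gamma ρ *
        ((1 - (x : ℂ)) ^ (-(Complex.I * κ)) *
        Complex.regularizedGaussHGFun (ρ - Complex.I * κ) (1 / 2 - Complex.I * κ) (ρ + 1 / 2) x) := by
  have hR : AnalyticOnNhd ℂ (fun x : ℂ =>
      (2 : ℂ) ^ (1 - 2 * ρ) * (√Real.pi : ℝ) * gammaPair ρ κ / Complex.Gamma ρ *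
        ((1 - x) ^ (-(Complex.I * κ)) * Complex.regularizedGaussHGFun (ρ - Complex.I * κ)
          (1 / 2 - Complex.I * κ) (ρ + 1 / 2) x)) (Metric.ball 0 1) := by
    refine analyticOnNhd_const.mul (AnalyticOnNhd.mul ?_ (analyticOnNhd_regularizedGaussHGFun _ _ _))
    intro z hz
    refine AnalyticAt.cpow (by fun_prop) analyticAt_const (Or.inl ?_)
    have : z.re < 1 := lt_of_le_of_lt (Complex.re_le_norm z) (by simpa using hz)
    simpa using this
  -- For `x < 1/2` one has `y = x/(1 - x) < 1`, so the expansion in `y` followed by Pfaff's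
  -- transformation applies.
  have hsmall : ∀ x : ℝ, 0 ≤ x → x < 1 / 2 →
      ∫ t : ℝ, (Complex.exp (Complex.I * κ * t) * ((2 * (1 + Real.cosh t) : ℝ) : ℂ) ^ (-ρ)) *
        (1 - (x : ℂ) * (((Real.cosh t - 1) / (1 + Real.cosh t) : ℝ) : ℂ)) ^ (-ρ) =
      (2 : ℂ) ^ (1 - 2 * ρ) * (√Real.pi : ℝ) * gammaPair ρ κ / Complex.Gamma ρ *
        ((1 - (x : ℂ)) ^ (-(Complex.I * κ)) * Complex.regularizedGaussHGFun (ρ - Complex.I * κ)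
          (1 / 2 - Complex.I * κ) (ρ + 1 / 2) x) := by
    intro x hx hx2
    have h3 : 0 < 1 - x := by linarith
    have h := conicalIntegral_eq_integral_tanh (ρ := ρ) κ hx (by linarith)
    rw [show (1 + x) / (1 - x) = 1 + 2 * (x / (1 - x)) by field_simp; ring,
      conicalIntegral_eq_of_lt_three hρ κ (by positivity) (by rw [div_lt_one h3]; linarith),
      regularizedGaussHGFun_pfaff (by simpa) (by
        rw [show ρ + 1 / 2 - (ρ + Complex.I * κ) = 1 / 2 - Complex.I * κ by ring]; simp)
        (by positivity) (by rw [div_lt_one h3]; linarith),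
      show ρ + 1 / 2 - (ρ + Complex.I * κ) = 1 / 2 - Complex.I * κ by ring,
      show x / (1 - x) / (1 + x / (1 - x)) = x by field_simp; ring,
      show 1 + x / (1 - x) = (1 - x)⁻¹ by field_simp; ring,
      ofReal_cpow_mul_of_pos (by norm_num) h3] at h
    have e0 : ((1 - x : ℝ) : ℂ) ≠ 0 := by exact_mod_cast h3.ne'
    have e1 : (((1 - x)⁻¹ : ℝ) : ℂ) ^ (-(ρ - Complex.I * κ)) =
        ((1 - x : ℝ) : ℂ) ^ ρ * ((1 - x : ℝ) : ℂ) ^ (-(Complex.I * κ)) := by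
      rw [← Complex.cpow_add _ _ e0, cpow_ofReal_eq_exp (by positivity), cpow_ofReal_eq_exp h3,
        Real.log_inv]
      push_cast
      ring_nf
    have e2 : ((1 - x : ℝ) : ℂ) ^ ρ ≠ 0 :=
      fun h0 => e0 ((Complex.cpow_eq_zero_iff _ _).1 h0).1
    have e3 : (((2 : ℝ) : ℂ)) ^ ρ ≠ 0 := by simp [Complex.cpow_eq_zero_iff]
    rw [e1, ← Complex.ofReal_ofNat] at h
    refine mul_left_cancel₀ e3 (mul_left_cancel₀ e2 ?_)
    rw [← mul_assoc, mul_comm (((1 - x : ℝ) : ℂ) ^ ρ), ← h]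
    push_cast
    ring
  -- Identity theorem on the unit disk: both sides agree at the points `1/(n + 3)`, which lie below
  -- `1/2` and accumulate at `0`.
  have hfreq := (analyticOnNhd_integral_tanh hρ κ).eqOn_of_preconnected_of_frequently_eq hR
    (convex_ball 0 1).isPreconnected (z₀ := 0) (by simp) (by
      have hlim : Tendsto (fun n : ℕ => (((1 : ℝ) / ((n : ℝ) + 3) : ℝ) : ℂ)) atTop (𝓝[≠] 0) := by
        refine tendsto_nhdsWithin_iff.2 ⟨?_, Eventually.of_forall fun n => ?_⟩
        · rw [← Complex.ofReal_zero]
          refine (Complex.continuous_ofReal.tendsto 0).comp ?_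
          exact tendsto_const_nhds.div_atTop
            (tendsto_atTop_add_const_right _ _ tendsto_natCast_atTop_atTop)
        · have : (0 : ℝ) < 1 / ((n : ℝ) + 3) := by positivity
          simp only [mem_compl_iff, mem_singleton_iff]
          exact_mod_cast this.ne'
      refine hlim.frequently (Frequently.of_forall fun n => ?_)
      refine hsmall _ (by positivity) ?_
      rw [div_lt_div_iff₀ (by positivity) (by positivity)]
      have : (0 : ℝ) ≤ n := n.cast_nonneg
      linarith)
  refine hfreq ?_
  rw [mem_ball_zero_iff, Complex.norm_real, Real.norm_of_nonneg hx]
  exact hx1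

/-- The conical function as an integral over the whole line. -/
theorem legendreP_eq_conicalIntegral (hρ : 0 < ρ.re) (κ : ℝ) {u : ℝ} (hu : 1 < u) :
    legendreP (1 / 2 - ρ) (-1 / 2 + Complex.I * κ) u =
      ((u ^ 2 - 1 : ℝ) : ℂ) ^ ((ρ - 1 / 2) / 2) *
        (Complex.Gamma ρ / ((√(2 * Real.pi) : ℝ) * gammaPair ρ κ) * conicalIntegral ρ κ u) := by
  obtain ⟨x, hx, hx1, rfl⟩ : ∃ x : ℝ, 0 < x ∧ x < 1 ∧ u = (1 + x) / (1 - x) := by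
    refine ⟨(u - 1) / (u + 1), div_pos (by linarith) (by linarith), ?_, ?_⟩
    · rw [div_lt_one (by linarith)]; linarith
    · have h1 : u + 1 ≠ 0 := by linarith
      field_simp
      ring
  have h3 : 0 < 1 - x := by linarith
  rw [conicalIntegral_eq_integral_tanh κ hx.le hx1, integral_tanh_eq hρ κ hx.le hx1, legendreP]
  rw [show ((1 + x) / (1 - x) - 1) / ((1 + x) / (1 - x) + 1) = x by field_simp; ring,
    show ((1 + x) / (1 - x) + 1) / ((1 + x) / (1 - x) - 1) = x⁻¹ by
      rw [show (1 + x) / (1 - x) - 1 = 2 * x / (1 - x) by field_simp; ring]; field_simp; ring,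
    show ((1 + x) / (1 - x) + 1) / 2 = (1 - x)⁻¹ by field_simp; ring,
    show ((1 + x) / (1 - x)) ^ 2 - 1 = 4 * x * ((1 - x) ^ 2)⁻¹ by field_simp; ring,
    show -(-1 / 2 + Complex.I * κ) - (1 / 2 - ρ) = ρ - Complex.I * κ by ring,
    show -(-1 / 2 + Complex.I * κ) = 1 / 2 - Complex.I * κ by ring,
    show 1 - (1 / 2 - ρ) = ρ + 1 / 2 by ring, Complex.regularizedGaussHGFun_symm]
  set F := Complex.regularizedGaussHGFun (ρ - Complex.I * κ) (1 / 2 - Complex.I * κ) (ρ + 1 / 2) x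
  have hG := gammaPair_ne_zero hρ κ
  have hG0 := Complex.Gamma_ne_zero_of_re_pos hρ
  have hpi : ((√Real.pi : ℝ) : ℂ) ≠ 0 := by
    exact_mod_cast (Real.sqrt_pos.2 Real.pi_pos).ne'
  have hs2 : ((√2 : ℝ) : ℂ) = Complex.exp (Real.log 2 / 2) := by
    rw [Real.sqrt_eq_rpow, Complex.ofReal_cpow (by norm_num), cpow_ofReal_eq_exp (by norm_num)]
    push_cast
    ring_nf
  have key : ((x⁻¹ : ℝ) : ℂ) ^ ((1 / 2 - ρ) / 2) * (((1 - x)⁻¹ : ℝ) : ℂ) ^ (-1 / 2 + Complex.I * κ) *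
      ((√2 : ℝ) : ℂ) =
      ((4 * x * ((1 - x) ^ 2)⁻¹ : ℝ) : ℂ) ^ ((ρ - 1 / 2) / 2) * (((2 * (1 - x) : ℝ) : ℂ) ^ ρ *
        ((2 : ℂ) ^ (1 - 2 * ρ) * (1 - (x : ℂ)) ^ (-(Complex.I * κ)))) := by
    rw [show (1 : ℂ) - x = ((1 - x : ℝ) : ℂ) by push_cast; ring, ← Complex.ofReal_ofNat, hs2]
    simp only [cpow_ofReal_eq_exp (inv_pos.2 hx), cpow_ofReal_eq_exp (inv_pos.2 h3),
      cpow_ofReal_eq_exp h3, cpow_ofReal_eq_exp (two_pos : (0 : ℝ) < 2),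
      cpow_ofReal_eq_exp (by positivity : 0 < 4 * x * ((1 - x) ^ 2)⁻¹),
      cpow_ofReal_eq_exp (by positivity : 0 < 2 * (1 - x)), ← Complex.exp_add]
    rw [Real.log_mul (by positivity) (by positivity), Real.log_mul (by positivity) (by positivity),
      Real.log_inv, Real.log_inv, Real.log_inv, Real.log_pow, Real.log_mul two_ne_zero h3.ne',
      show (4 : ℝ) = 2 ^ 2 by norm_num, Real.log_pow]
    congr 1
    push_cast
    ring
  rw [Real.sqrt_mul (by norm_num)]
  have hs0 : ((√2 : ℝ) : ℂ) ≠ 0 := by rw [hs2]; exact Complex.exp_ne_zero _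
  refine mul_right_cancel₀ hs0 ?_
  rw [mul_right_comm, key]
  push_cast
  field_simp

end Legendre

/-! ### The Mehler–Dirichlet formula. -/

noncomputable section

/-- The kernel `(z - cosh t)^(ρ-1)` cut off to `cosh t < z`. -/
def mehlerKernel (ρ : ℂ) (z t : ℝ) : ℂ :=
  if Real.cosh t < z then ((z - Real.cosh t : ℝ) : ℂ) ^ (ρ - 1) else 0

/-- The Mehler–Dirichlet integral of the conical function. -/
def mehlerIntegral (ρ : ℂ) (κ z : ℝ) : ℂ :=
  ∫ t : ℝ, Complex.exp (Complex.I * κ * t) * mehlerKernel ρ z t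

/-- The increasing map of the line onto `(-r, r)` given by `tanh (t/2) = tanh (y/2) tanh (r/2)`. -/
def coshMap (r y : ℝ) : ℝ :=
  Real.log ((Real.exp y * Real.exp r + 1) / (Real.exp y + Real.exp r))

end

theorem exp_coshMap (r y : ℝ) :
    Real.exp (coshMap r y) = (Real.exp y * Real.exp r + 1) / (Real.exp y + Real.exp r) :=
  Real.exp_log (by positivity)

theorem cosh_add_cosh_eq (r y : ℝ) :
    Real.cosh y + Real.cosh r = (Real.exp y * Real.exp r + 1) * (Real.exp y + Real.exp r) /
      (2 * Real.exp y * Real.exp r) := by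
  rw [Real.cosh_eq, Real.cosh_eq, Real.exp_neg, Real.exp_neg]
  field_simp
  ring

theorem hasDerivAt_coshMap (r y : ℝ) :
    HasDerivAt (coshMap r) (Real.sinh r / (Real.cosh y + Real.cosh r)) y := by
  have h1 : 0 < Real.exp y := Real.exp_pos y
  have h2 : 0 < Real.exp r := Real.exp_pos r
  have hn : HasDerivAt (fun y => Real.exp y * Real.exp r + 1) (Real.exp y * Real.exp r) y :=
    ((Real.hasDerivAt_exp y).mul_const _).add_const _
  have hd : HasDerivAt (fun y => Real.exp y + Real.exp r) (Real.exp y) y :=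
    (Real.hasDerivAt_exp y).add_const _
  have := (hn.div hd (by positivity)).log (by
    simp only [Pi.div_apply]
    positivity)
  refine this.congr_deriv ?_
  rw [cosh_add_cosh_eq, Real.sinh_eq, Real.exp_neg]
  simp only [Pi.div_apply]
  field_simp
  ring

theorem monotone_coshMap {r : ℝ} (hr : 0 < r) : Monotone (coshMap r) := by
  refine monotone_of_deriv_nonneg (fun y => (hasDerivAt_coshMap r y).differentiableAt) fun y => ?_
  rw [(hasDerivAt_coshMap r y).deriv]
  have := Real.sinh_pos_iff.2 hr
  have := Real.cosh_pos y
  have := Real.cosh_pos r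
  positivity

theorem range_coshMap {r : ℝ} (hr : 0 < r) : range (coshMap r) = Ioo (-r) r := by
  have hR : 1 < Real.exp r := Real.one_lt_exp_iff.2 hr
  ext t
  constructor
  · rintro ⟨y, rfl⟩
    have hy := Real.exp_pos y
    constructor <;> rw [← Real.exp_lt_exp, exp_coshMap]
    · rw [Real.exp_neg, inv_eq_one_div, div_lt_div_iff₀ (by positivity) (by positivity)]
      nlinarith [mul_pos hy (sub_pos.2 hR), mul_pos (mul_pos hy (sub_pos.2 hR)) (Real.exp_pos r)]
    · rw [div_lt_iff₀ (by positivity)]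
      nlinarith
  · rintro ⟨h1, h2⟩
    have e1 : 0 < Real.exp r - Real.exp t := sub_pos.2 (Real.exp_lt_exp.2 h2)
    have e2 : 0 < Real.exp t * Real.exp r - 1 := by
      rw [← Real.exp_add, sub_pos, Real.one_lt_exp_iff]
      linarith
    refine ⟨Real.log ((Real.exp t * Real.exp r - 1) / (Real.exp r - Real.exp t)), ?_⟩
    rw [coshMap, Real.exp_log (by positivity)]
    conv_rhs => rw [← Real.log_exp t]
    congr 1
    have e3 : (Real.exp t * Real.exp r - 1) / (Real.exp r - Real.exp t) + Real.exp r =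
      (Real.exp r ^ 2 - 1) / (Real.exp r - Real.exp t) := by field_simp; ring
    have e4 : 0 < Real.exp r ^ 2 - 1 := by nlinarith
    rw [e3]
    field_simp
    ring

theorem cosh_sub_cosh_coshMap (r y : ℝ) :
    Real.cosh r - Real.cosh (coshMap r y) = Real.sinh r ^ 2 / (Real.cosh y + Real.cosh r) := by
  rw [cosh_add_cosh_eq, Real.cosh_eq (coshMap r y), Real.exp_neg, exp_coshMap, Real.sinh_eq,
    Real.cosh_eq, Real.exp_neg]
  field_simp
  ring

/-- The shift by `coshMap r p` is chosen so that, after the substitution, `1 + cosh (p - t)`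
separates into a function of `p` and a function of `y`. -/
theorem one_add_cosh_sub_coshMap_mul (r p y : ℝ) :
    (1 + Real.cosh (p - coshMap r (y + coshMap r p))) *
      (Real.cosh (y + coshMap r p) + Real.cosh r) =
      (Real.cosh r + Real.cosh p) * (1 + Real.cosh y) := by
  rw [cosh_add_cosh_eq, add_comm (Real.cosh r), cosh_add_cosh_eq, Real.cosh_eq (p - _), Real.exp_neg,
    Real.exp_sub, exp_coshMap, Real.exp_add, exp_coshMap, Real.cosh_eq y, Real.exp_neg]
  have hy := Real.exp_pos y
  have hp := Real.exp_pos p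
  have hr := Real.exp_pos r
  field_simp
  ring

section Mehler

variable {ρ : ℂ}

theorem integrable_exp_mul_cosh_add_cpow (hρ : 0 < ρ.re) (κ : ℝ) {u : ℝ} (hu : 1 ≤ u) :
    Integrable fun t : ℝ =>
      Complex.exp (Complex.I * κ * t) * ((u + Real.cosh t : ℝ) : ℂ) ^ (-ρ) := by
  have hpos : ∀ t : ℝ, 0 < u + Real.cosh t := fun t => by have := Real.cosh_pos t; positivity
  refine ((integrable_exp_mul_cosh_cpow hρ κ).norm.const_mul ((2 : ℝ) ^ ρ.re)).mono' ?_
    (ae_of_all _ fun t => ?_)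
  · refine Continuous.aestronglyMeasurable (Continuous.mul (by fun_prop) ?_)
    refine Continuous.cpow (by fun_prop) continuous_const fun t => ?_
    exact Complex.ofReal_mem_slitPlane.2 (hpos t)
  · have h1 := one_add_cosh_pos t
    rw [norm_mul, norm_mul, norm_exp_I_mul_mul, one_mul, one_mul,
      Complex.norm_cpow_eq_rpow_re_of_pos (hpos t),
      Complex.norm_cpow_eq_rpow_re_of_pos (by positivity), Complex.neg_re,
      Real.mul_rpow zero_le_two h1.le, ← mul_assoc, ← Real.rpow_add two_pos, add_neg_cancel,
      Real.rpow_zero, one_mul]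
    exact Real.rpow_le_rpow_of_nonpos h1 (by linarith) (by linarith)

theorem ofReal_pow_two_cpow {x : ℝ} (hx : 0 < x) (s : ℂ) :
    ((x ^ 2 : ℝ) : ℂ) ^ s = (x : ℂ) ^ (2 * s) := by
  rw [cpow_ofReal_eq_exp (by positivity), cpow_ofReal_eq_exp hx, Real.log_pow]
  push_cast
  ring_nf

/-- The substitution `coshMap` carries the singular kernel with its Jacobian to a multiple of `(cosh
y + cosh r)^(-ρ)`, the integrand of the conical function. -/
theorem sinh_div_smul_coshMap (r y : ℝ) (hr : 0 < r) :
    (Real.sinh r / (Real.cosh y + Real.cosh r)) •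
      ((Real.cosh r - Real.cosh (coshMap r y) : ℝ) : ℂ) ^ (ρ - 1) =
    (Real.sinh r : ℂ) ^ (2 * ρ - 1) * ((Real.cosh y + Real.cosh r : ℝ) : ℂ) ^ (-ρ) := by
  have h1 := Real.sinh_pos_iff.2 hr
  have h2 : 0 < Real.cosh y + Real.cosh r := add_pos (Real.cosh_pos _) (Real.cosh_pos _)
  have h3 : ((Real.sinh r / (Real.cosh y + Real.cosh r) : ℝ) : ℂ) =
      ((Real.sinh r / (Real.cosh y + Real.cosh r) : ℝ) : ℂ) ^ (1 : ℂ) := (Complex.cpow_one _).symm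
  rw [cosh_sub_cosh_coshMap, Complex.real_smul, h3, cpow_ofReal_eq_exp (by positivity),
    cpow_ofReal_eq_exp (by positivity), cpow_ofReal_eq_exp h1, cpow_ofReal_eq_exp h2,
    Real.log_div (by positivity) (by positivity), Real.log_div (by positivity) (by positivity),
    Real.log_pow, ← Complex.exp_add, ← Complex.exp_add]
  congr 1
  push_cast
  ring

theorem cosh_lt_cosh_iff_mem_Ioo {r t : ℝ} (hr : 0 < r) :
    Real.cosh t < Real.cosh r ↔ t ∈ Ioo (-r) r := by
  rw [Real.cosh_lt_cosh, abs_of_pos hr, abs_lt, mem_Ioo]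

theorem mehlerKernel_cosh {r : ℝ} (hr : 0 < r) :
    mehlerKernel ρ (Real.cosh r) = (Ioo (-r) r).indicator
      fun t => ((Real.cosh r - Real.cosh t : ℝ) : ℂ) ^ (ρ - 1) := by
  classical
  funext t
  rw [mehlerKernel, indicator_apply]
  simp only [cosh_lt_cosh_iff_mem_Ioo hr]

theorem integrable_mehlerKernel (hρ : 0 < ρ.re) {r : ℝ} (hr : 0 < r) :
    Integrable (mehlerKernel ρ (Real.cosh r)) := by
  rw [mehlerKernel_cosh hr, integrable_indicator_iff measurableSet_Ioo,
    integrableOn_range_iff (hasDerivAt_coshMap r) (monotone_coshMap hr) (range_coshMap hr)]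
  simp_rw [sinh_div_smul_coshMap _ _ hr]
  have := integrable_exp_mul_cosh_add_cpow hρ 0 (Real.one_le_cosh r)
  simp only [Complex.ofReal_zero, mul_zero, zero_mul, Complex.exp_zero, one_mul] at this
  simpa only [add_comm (Real.cosh r)] using this.const_mul _

/-- Convolving the cut-off kernel with `(1 + cosh)^(-ρ)` reproduces the integrand of the conical
function at `cosh r`. Integrating this identity against `e^{iκp}` proves the Mehler–Dirichlet
formula. -/
theorem integral_mehlerKernel_mul_cosh {r : ℝ} (hr : 0 < r) (p : ℝ) :
    ∫ t, mehlerKernel ρ (Real.cosh r) t * ((1 + Real.cosh (p - t) : ℝ) : ℂ) ^ (-ρ) =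
      (Real.sinh r : ℂ) ^ (2 * ρ - 1) * ((Real.cosh r + Real.cosh p : ℝ) : ℂ) ^ (-ρ) *
        ∫ y : ℝ, ((1 + Real.cosh y : ℝ) : ℂ) ^ (-ρ) := by
  have h1 : ∀ t, mehlerKernel ρ (Real.cosh r) t * ((1 + Real.cosh (p - t) : ℝ) : ℂ) ^ (-ρ) =
      (Ioo (-r) r).indicator (fun t => ((Real.cosh r - Real.cosh t : ℝ) : ℂ) ^ (ρ - 1) *
        ((1 + Real.cosh (p - t) : ℝ) : ℂ) ^ (-ρ)) t := fun t => by
    rw [mehlerKernel_cosh hr, indicator_mul_left]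
  simp_rw [h1]
  rw [integral_indicator measurableSet_Ioo,
    setIntegral_range_eq (hasDerivAt_coshMap r) (monotone_coshMap hr) (range_coshMap hr)]
  simp_rw [← smul_mul_assoc, sinh_div_smul_coshMap _ _ hr]
  rw [← integral_add_right_eq_self _ (coshMap r p), ← integral_const_mul]
  refine integral_congr_ae (ae_of_all _ fun y => ?_)
  have h2 : 0 < Real.cosh (y + coshMap r p) + Real.cosh r :=
    add_pos (Real.cosh_pos _) (Real.cosh_pos _)
  have h3 : 0 < Real.cosh r + Real.cosh p := add_pos (Real.cosh_pos _) (Real.cosh_pos _)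
  simp only
  rw [mul_assoc, mul_assoc, ← ofReal_cpow_mul_of_pos h3 (one_add_cosh_pos y),
    ← one_add_cosh_sub_coshMap_mul, mul_comm (1 + Real.cosh _),
    ofReal_cpow_mul_of_pos h2 (one_add_cosh_pos _)]

theorem integral_exp_mul_one_add_cosh_cpow (hρ : 0 < ρ.re) (κ : ℝ) :
    ∫ t : ℝ, Complex.exp (Complex.I * κ * t) * ((1 + Real.cosh t : ℝ) : ℂ) ^ (-ρ) =
      (2 : ℂ) ^ ρ * (gammaPair ρ κ / Complex.Gamma (2 * ρ)) := by
  rw [gammaPair, ← integral_exp_mul_cosh_cpow hρ, ← integral_const_mul]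
  refine integral_congr_ae (ae_of_all _ fun t => ?_)
  simp only
  rw [ofReal_cpow_mul_of_pos two_pos (one_add_cosh_pos t), Complex.ofReal_ofNat,
    Complex.cpow_neg 2]
  have : (2 : ℂ) ^ ρ ≠ 0 := by simp [Complex.cpow_eq_zero_iff]
  field_simp

/-- The Mehler–Dirichlet formula. -/
theorem mehlerIntegral_eq (hρ : 0 < ρ.re) (κ : ℝ) {z : ℝ} (hz : 1 < z) :
    gammaPair ρ κ * mehlerIntegral ρ κ z =
      Complex.Gamma ρ ^ 2 * (((z ^ 2 - 1 : ℝ) : ℂ) ^ (ρ - 1 / 2) * conicalIntegral ρ κ z) := by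
  obtain ⟨r, hr, rfl⟩ : ∃ r : ℝ, 0 < r ∧ Real.cosh r = z :=
    ⟨Real.arcosh z, Real.arcosh_pos hz, Real.cosh_arcosh hz.le⟩
  have hK := integral_exp_mul_one_add_cosh_cpow hρ 0
  simp only [Complex.ofReal_zero, mul_zero, zero_mul, Complex.exp_zero, one_mul] at hK
  have hf : Integrable fun t : ℝ =>
      Complex.exp (Complex.I * κ * t) * mehlerKernel ρ (Real.cosh r) t :=
    (integrable_mehlerKernel hρ hr).bdd_mul (c := 1)
      (Continuous.aestronglyMeasurable (by fun_prop))
      (ae_of_all _ fun t => (norm_exp_I_mul_mul κ t).le)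
  -- The integral of a convolution is the product of the integrals; the character `e^{iκp}` is
  -- multiplicative, so it can be distributed over both factors.
  have hconv := integral_convolution (μ := volume) (ν := volume) (ContinuousLinearMap.mul ℝ ℂ) hf
    (integrable_exp_mul_cosh_add_cpow hρ κ le_rfl)
  rw [ContinuousLinearMap.mul_apply', integral_exp_mul_one_add_cosh_cpow hρ] at hconv
  have hcv : ∀ p : ℝ, convolution (fun t : ℝ =>
      Complex.exp (Complex.I * κ * t) * mehlerKernel ρ (Real.cosh r) t)
      (fun t : ℝ => Complex.exp (Complex.I * κ * t) * ((1 + Real.cosh t : ℝ) : ℂ) ^ (-ρ))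
      (ContinuousLinearMap.mul ℝ ℂ) volume p =
      ((Real.sinh r : ℂ) ^ (2 * ρ - 1) * ((2 : ℂ) ^ ρ * (gammaPair ρ 0 / Complex.Gamma (2 * ρ)))) *
      (Complex.exp (Complex.I * κ * p) * ((Real.cosh r + Real.cosh p : ℝ) : ℂ) ^ (-ρ)) := by
    intro p
    have := integral_mehlerKernel_mul_cosh (ρ := ρ) hr p
    rw [hK] at this
    rw [mul_left_comm _ (Complex.exp _), mul_right_comm _ (_ * _) (_ ^ (-ρ)), ← this, convolution_def, ← integral_const_mul]
    refine integral_congr_ae (ae_of_all _ fun t => ?_)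
    have he : Complex.exp (Complex.I * κ * p) =
        Complex.exp (Complex.I * κ * t) * Complex.exp (Complex.I * κ * ((p - t : ℝ) : ℂ)) := by
      rw [← Complex.exp_add]
      push_cast
      ring_nf
    simp only [ContinuousLinearMap.mul_apply']
    rw [he]
    ring
  simp_rw [hcv] at hconv
  rw [integral_const_mul] at hconv
  change _ * conicalIntegral ρ κ (Real.cosh r) = mehlerIntegral ρ κ (Real.cosh r) * _ at hconv
  have h2 : (2 : ℂ) ^ ρ ≠ 0 := by simp [Complex.cpow_eq_zero_iff]
  have hG2 : Complex.Gamma (2 * ρ) ≠ 0 := Complex.Gamma_ne_zero_of_re_pos (by simpa)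
  have hg0 : gammaPair ρ 0 = Complex.Gamma ρ ^ 2 := by simp [gammaPair, sq]
  have hs : ((Real.cosh r ^ 2 - 1 : ℝ) : ℂ) ^ (ρ - 1 / 2) = (Real.sinh r : ℂ) ^ (2 * ρ - 1) := by
    rw [Real.cosh_sq, add_sub_cancel_right, ofReal_pow_two_cpow (Real.sinh_pos_iff.2 hr)]
    ring_nf
  rw [hs, ← hg0]
  field_simp at hconv
  linear_combination -hconv

end Mehler

/-! ### The coordinates `y ± t/2` on the plane. -/

section MeasurePreservingMaps

theorem MeasurePreserving.integral_eq_integral_comp {α β E : Type*} [MeasurableSpace α]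
    [MeasurableSpace β] [NormedAddCommGroup E] [NormedSpace ℝ E] {μ : Measure α} {ν : Measure β}
    {f : α → β} (hf : MeasurePreserving f μ ν) {g : β → E} (hg : AEStronglyMeasurable g ν) :
    ∫ y, g y ∂ν = ∫ x, g (f x) ∂μ := by
  rw [← hf.map_eq] at hg ⊢
  exact integral_map hf.aemeasurable hg

/-- The map is a composite of a shear, the coordinate swap, and a fibrewise reflection `t ↦ s - t`.
-/
theorem measurePreserving_half_add_half_sub :
    MeasurePreserving (fun x : ℝ × ℝ => (x.2 + x.1 / 2, x.2 - x.1 / 2))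
      (volume.prod volume) (volume.prod volume) := by
  have h1 : MeasurePreserving (fun x : ℝ × ℝ => (x.1, x.2 + x.1 / 2))
      (volume.prod volume) (volume.prod volume) :=
    (MeasurePreserving.id volume).skew_product (g := fun t y => y + t / 2)
      (by simp only [Function.uncurry_def]; fun_prop)
      (ae_of_all _ fun t => (measurePreserving_add_right volume (t / 2)).map_eq)
  have h2 : MeasurePreserving (fun x : ℝ × ℝ => (x.1, x.1 - x.2))
      (volume.prod volume) (volume.prod volume) :=
    (MeasurePreserving.id volume).skew_product (g := fun s t => s - t)
      (by simp only [Function.uncurry_def]; fun_prop)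
      (ae_of_all _ fun t => (volume.measurePreserving_sub_left t).map_eq)
  have h3 := (h2.comp Measure.measurePreserving_swap).comp h1
  convert h3 using 1
  funext x
  simp only [Function.comp_apply, Prod.swap_prod_mk, Prod.mk.injEq, true_and]
  ring

end MeasurePreservingMaps

/-! ### Bessel functions of imaginary order and their Mellin transforms. -/

noncomputable section

/-- The integral `∫ e^{iνp - e^s cosh p} dp`, that is, `2 K_{iν}(e^s)`. -/
def besselIntegral (ν s : ℝ) : ℂ :=
  ∫ p : ℝ, Complex.exp (Complex.I * ν * p - ((Real.exp s * Real.cosh p : ℝ) : ℂ))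

/-- The integral `∫ e^{- e^s cosh p} dp`, that is, `2 K_0(e^s)`. -/
def besselIntegralReal (s : ℝ) : ℝ :=
  ∫ p : ℝ, Real.exp (-(Real.exp s * Real.cosh p))

end

section Bessel

theorem norm_exp_sub_ofReal (z : ℂ) (r : ℝ) :
    ‖Complex.exp (z - (r : ℂ))‖ = Real.exp (z.re - r) := by
  rw [Complex.norm_exp, Complex.sub_re, Complex.ofReal_re]

theorem norm_exp_I_sub_ofReal (ν p r : ℝ) :
    ‖Complex.exp (Complex.I * ν * p - (r : ℂ))‖ = Real.exp (-r) := by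
  rw [norm_exp_sub_ofReal]
  simp

theorem integrable_rexp_neg_mul_cosh {c : ℝ} (hc : 0 < c) :
    Integrable fun p : ℝ => Real.exp (-(c * Real.cosh p)) := by
  have h := (integrable_exp_mul_cosh_add_cpow (ρ := 1) (by simp) 0 le_rfl).norm
  -- The constant `2 / c` comes from `(c/2)(1 + cosh p) ≤ c cosh p ≤ e^{c cosh p}`.
  refine (h.const_mul (2 / c)).mono' (by fun_prop) (ae_of_all _ fun p => ?_)
  have h1 := one_add_cosh_pos p
  have h2 := Real.one_le_cosh p
  rw [norm_mul, norm_exp_I_mul_mul, one_mul, Complex.norm_cpow_eq_rpow_re_of_pos h1,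
    Real.norm_of_nonneg (Real.exp_pos _).le, Complex.neg_re, Complex.one_re, Real.rpow_neg_one,
    Real.exp_neg, ← div_eq_mul_inv, div_div, le_div_iff₀ (by positivity), inv_mul_le_iff₀ (by positivity)]
  have h3 := Real.add_one_le_exp (c * Real.cosh p)
  nlinarith

theorem integrable_bessel_kernel (ν s : ℝ) : Integrable fun p : ℝ =>
    Complex.exp (Complex.I * ν * p - ((Real.exp s * Real.cosh p : ℝ) : ℂ)) := by
  refine (integrable_rexp_neg_mul_cosh (Real.exp_pos s)).mono' ?_ (ae_of_all _ fun p => ?_)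
  · exact Continuous.aestronglyMeasurable (by fun_prop)
  · rw [norm_exp_I_sub_ofReal]

theorem norm_besselIntegral_le (ν s : ℝ) : ‖besselIntegral ν s‖ ≤ besselIntegralReal s := by
  refine (norm_integral_le_integral_norm _).trans_eq ?_
  simp_rw [norm_exp_I_sub_ofReal]
  rfl

theorem besselIntegralReal_nonneg (s : ℝ) : 0 ≤ besselIntegralReal s :=
  integral_nonneg fun _ => (Real.exp_pos _).le

theorem besselIntegral_zero (s : ℝ) : besselIntegral 0 s = besselIntegralReal s := by
  rw [besselIntegral, besselIntegralReal, ← integral_complex_ofReal]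
  simp

theorem besselIntegral_neg (ν s : ℝ) : besselIntegral (-ν) s = besselIntegral ν s := by
  rw [besselIntegral, besselIntegral, ← integral_neg_eq_self]
  simp

theorem stronglyMeasurable_besselIntegral (ν : ℝ) : StronglyMeasurable (besselIntegral ν) := by
  unfold besselIntegral
  refine StronglyMeasurable.integral_prod_right (f := fun s p : ℝ =>
    Complex.exp (Complex.I * ν * p - ((Real.exp s * Real.cosh p : ℝ) : ℂ))) ?_
  exact Continuous.stronglyMeasurable (by simp only [Function.uncurry_def]; fun_prop)

/-- Absolute convergence of a Schwinger integral with weights: Fubini for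
`∫∫ w(p) e^{ρ s - r(p) e^s} ds dp`. -/
theorem integrable_prod_exp_mul_sub {α : Type*} [MeasurableSpace α] {μ : Measure α} [SFinite μ]
    {ρ : ℂ} (hρ : 0 < ρ.re) {w : α → ℂ} {r : α → ℝ} (hr : ∀ p, 0 < r p) (hrm : Measurable r)
    (hwm : Measurable w) (hw : Integrable (fun p => w p * (r p : ℂ) ^ (-ρ)) μ) :
    Integrable (fun x : ℝ × α => w x.2 *
      Complex.exp (ρ * x.1 - ((r x.2 * Real.exp x.1 : ℝ) : ℂ))) (volume.prod μ) := by
  have hm : Measurable (fun x : ℝ × α => w x.2 *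
      Complex.exp (ρ * x.1 - ((r x.2 * Real.exp x.1 : ℝ) : ℂ))) := by fun_prop
  rw [integrable_prod_iff' hm.aestronglyMeasurable]
  refine ⟨ae_of_all _ fun p => (integrable_exp_mul_sub_mul_exp hρ (hr p)).const_mul (w p), ?_⟩
  refine (hw.norm.const_mul (Real.Gamma ρ.re)).congr (ae_of_all _ fun p => ?_)
  have h1 : ∀ s : ℝ, ‖w p * Complex.exp (ρ * s - ((r p * Real.exp s : ℝ) : ℂ))‖ =
      ‖w p‖ * Real.exp (ρ.re * s - r p * Real.exp s) := fun s => by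
    rw [norm_mul, norm_exp_sub_ofReal]
    simp
  -- The norm of the integrand is again an integrand of the same type, with `ρ` replaced by its real
  -- part.
  have h2 : ∫ s : ℝ, Real.exp (ρ.re * s - r p * Real.exp s) =
      (r p) ^ (-ρ.re) * Real.Gamma ρ.re := by
    have := integral_exp_mul_sub_mul_exp (a := (ρ.re : ℂ)) (by simpa) (hr p)
    rw [Complex.Gamma_ofReal, ← Complex.ofReal_neg, ← Complex.ofReal_cpow (hr p).le,
      ← Complex.ofReal_mul] at this
    rw [← Complex.ofReal_inj, ← this, ← integral_complex_ofReal]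
    push_cast
    rfl
  simp only
  simp_rw [h1]
  rw [integral_const_mul, h2, norm_mul, Complex.norm_cpow_eq_rpow_re_of_pos (hr p), Complex.neg_re]
  ring

theorem integral_prod_exp_mul_sub {α : Type*} [MeasurableSpace α] {μ : Measure α} [SFinite μ]
    {ρ : ℂ} (hρ : 0 < ρ.re) {w : α → ℂ} {r : α → ℝ} (hr : ∀ p, 0 < r p) (hrm : Measurable r)
    (hwm : Measurable w) (hw : Integrable (fun p => w p * (r p : ℂ) ^ (-ρ)) μ) :
    ∫ s : ℝ, ∫ p, w p * Complex.exp (ρ * s - ((r p * Real.exp s : ℝ) : ℂ)) ∂μ =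
      Complex.Gamma ρ * ∫ p, w p * (r p : ℂ) ^ (-ρ) ∂μ := by
  rw [integral_integral_swap (integrable_prod_exp_mul_sub hρ hr hrm hwm hw), ← integral_const_mul]
  refine integral_congr_ae (ae_of_all _ fun p => ?_)
  simp only
  rw [integral_const_mul, integral_exp_mul_sub_mul_exp hρ (hr p)]
  ring

/-- The conical function as a Laplace–Mellin transform of the Bessel function. -/
theorem integral_exp_mul_besselIntegral {ρ : ℂ} (hρ : 0 < ρ.re) (ν : ℝ) {z : ℝ} (hz : 1 ≤ z) :
    ∫ s : ℝ, Complex.exp (ρ * s - ((z * Real.exp s : ℝ) : ℂ)) * besselIntegral ν s =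
      Complex.Gamma ρ * conicalIntegral ρ ν z := by
  have hpos : ∀ t : ℝ, 0 < z + Real.cosh t := fun t => by have := Real.cosh_pos t; positivity
  rw [conicalIntegral, ← integral_prod_exp_mul_sub hρ hpos (by fun_prop) (by fun_prop)
    (integrable_exp_mul_cosh_add_cpow hρ ν hz)]
  refine integral_congr_ae (ae_of_all _ fun s => ?_)
  simp only
  rw [besselIntegral, ← integral_const_mul]
  refine integral_congr_ae (ae_of_all _ fun p => ?_)
  simp only
  rw [← Complex.exp_add, ← Complex.exp_add]
  push_cast
  ring_nf

theorem cosh_half_cpow_eq (ρ : ℂ) (t : ℝ) : ((Real.cosh (t / 2) : ℝ) : ℂ) ^ (-ρ) =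
    (2 : ℂ) ^ ρ * ((2 * (1 + Real.cosh t) : ℝ) : ℂ) ^ (-(ρ / 2)) := by
  have h1 : 2 * (1 + Real.cosh t) = (2 * Real.cosh (t / 2)) ^ 2 := by
    conv_lhs => rw [show t = 2 * (t / 2) by ring, Real.cosh_two_mul]
    nlinarith [Real.cosh_sq (t / 2)]
  have h2 := Real.cosh_pos (t / 2)
  rw [h1, ofReal_pow_two_cpow (by positivity), show 2 * -(ρ / 2) = -ρ by ring,
    ofReal_cpow_mul_of_pos two_pos h2, Complex.ofReal_ofNat, ← mul_assoc,
    ← Complex.cpow_add _ _ two_ne_zero]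
  simp

theorem integrable_exp_mul_cosh_half_cpow {ρ : ℂ} (hρ : 0 < ρ.re) (ω : ℝ) : Integrable fun t : ℝ =>
    Complex.exp (Complex.I * ω * (t / 2 : ℝ)) * ((Real.cosh (t / 2) : ℝ) : ℂ) ^ (-ρ) := by
  have := (integrable_exp_mul_cosh_cpow (ρ := ρ / 2) (by simpa) (ω / 2)).const_mul ((2 : ℂ) ^ ρ)
  refine this.congr (ae_of_all _ fun t => ?_)
  simp only
  rw [cosh_half_cpow_eq]
  push_cast
  ring_nf

theorem integral_exp_mul_cosh_half_cpow {ρ : ℂ} (hρ : 0 < ρ.re) (ω : ℝ) : ∫ t : ℝ,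
    Complex.exp (Complex.I * ω * (t / 2 : ℝ)) * ((Real.cosh (t / 2) : ℝ) : ℂ) ^ (-ρ) =
      (2 : ℂ) ^ ρ * (gammaPair (ρ / 2) (ω / 2) / Complex.Gamma ρ) := by
  have := integral_exp_mul_cosh_cpow (ρ := ρ / 2) (by simpa) (ω / 2)
  rw [show 2 * (ρ / 2) = ρ by ring] at this
  rw [gammaPair, ← this, ← integral_const_mul]
  refine integral_congr_ae (ae_of_all _ fun t => ?_)
  simp only
  rw [cosh_half_cpow_eq]
  push_cast
  ring_nf

/-- By `cosh (a + b) + cosh (a - b) = 2 cosh a cosh b`, the integrand separates in the coordinates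
`y ± t/2`, with frequencies `ν - l` and `ν + l`. -/
theorem exp_mul_cosh_add_cosh_comp (ρ : ℂ) (ν l : ℝ) (x : ℝ × ℝ) :
    Complex.exp (Complex.I * ν * (x.2 + x.1 / 2 : ℝ) + Complex.I * l * (x.2 - x.1 / 2 : ℝ)) *
      ((Real.cosh (x.2 + x.1 / 2) + Real.cosh (x.2 - x.1 / 2) : ℝ) : ℂ) ^ (-ρ) =
    (2 : ℂ) ^ (-ρ) * ((Complex.exp (Complex.I * (ν - l : ℝ) * (x.1 / 2 : ℝ)) *
      ((Real.cosh (x.1 / 2) : ℝ) : ℂ) ^ (-ρ)) * (Complex.exp (Complex.I * (ν + l : ℝ) * x.2) *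
      ((Real.cosh x.2 : ℝ) : ℂ) ^ (-ρ))) := by
  have h : Real.cosh (x.2 + x.1 / 2) + Real.cosh (x.2 - x.1 / 2) =
      2 * (Real.cosh (x.1 / 2) * Real.cosh x.2) := by
    rw [Real.cosh_add, Real.cosh_sub]
    ring
  have he : Complex.exp (Complex.I * ν * (x.2 + x.1 / 2 : ℝ) + Complex.I * l * (x.2 - x.1 / 2 : ℝ)) =
      Complex.exp (Complex.I * (ν - l : ℝ) * (x.1 / 2 : ℝ)) *
        Complex.exp (Complex.I * (ν + l : ℝ) * x.2) := by
    rw [← Complex.exp_add]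
    push_cast
    ring_nf
  rw [h, he, ofReal_cpow_mul_of_pos two_pos (mul_pos (Real.cosh_pos _) (Real.cosh_pos _)),
    ofReal_cpow_mul_of_pos (Real.cosh_pos _) (Real.cosh_pos _), Complex.ofReal_ofNat]
  ring

theorem measurable_exp_mul_cosh_add_cosh (ρ : ℂ) (ν l : ℝ) : Measurable (fun x : ℝ × ℝ =>
    Complex.exp (Complex.I * ν * x.1 + Complex.I * l * x.2) *
      ((Real.cosh x.1 + Real.cosh x.2 : ℝ) : ℂ) ^ (-ρ)) := by
  fun_prop

theorem integrable_exp_mul_cosh_add_cosh {ρ : ℂ} (hρ : 0 < ρ.re) (ν l : ℝ) :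
    Integrable (fun x : ℝ × ℝ => Complex.exp (Complex.I * ν * x.1 + Complex.I * l * x.2) *
      ((Real.cosh x.1 + Real.cosh x.2 : ℝ) : ℂ) ^ (-ρ)) (volume.prod volume) := by
  rw [← measurePreserving_half_add_half_sub.integrable_comp
    (measurable_exp_mul_cosh_add_cosh ρ ν l).aestronglyMeasurable]
  refine (Integrable.congr ((Integrable.mul_prod (μ := volume) (ν := volume)
    (integrable_exp_mul_cosh_half_cpow hρ (ν - l)) ((integrable_comp_div_iff (fun y : ℝ =>
      Complex.exp (Complex.I * (ν + l : ℝ) * y) * ((Real.cosh y : ℝ) : ℂ) ^ (-ρ))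
      two_ne_zero).1 (integrable_exp_mul_cosh_half_cpow hρ (ν + l)))).const_mul ((2 : ℂ) ^ (-ρ)))
    (ae_of_all _ fun x => ?_))
  exact (exp_mul_cosh_add_cosh_comp ρ ν l x).symm

theorem integral_exp_mul_cosh_add_cosh {ρ : ℂ} (hρ : 0 < ρ.re) (ν l : ℝ) :
    ∫ x : ℝ × ℝ, Complex.exp (Complex.I * ν * x.1 + Complex.I * l * x.2) *
      ((Real.cosh x.1 + Real.cosh x.2 : ℝ) : ℂ) ^ (-ρ) =
    (2 : ℂ) ^ (ρ - 1) * (gammaPair (ρ / 2) ((ν - l) / 2) * gammaPair (ρ / 2) ((ν + l) / 2)) /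
      Complex.Gamma ρ ^ 2 := by
  rw [Measure.volume_eq_prod,
    MeasurePreserving.integral_eq_integral_comp measurePreserving_half_add_half_sub
    (measurable_exp_mul_cosh_add_cosh ρ ν l).aestronglyMeasurable]
  simp_rw [exp_mul_cosh_add_cosh_comp]
  have h := integral_exp_mul_cosh_half_cpow hρ (ν + l)
  rw [Measure.integral_comp_div (fun y : ℝ =>
      Complex.exp (Complex.I * (ν + l : ℝ) * y) * ((Real.cosh y : ℝ) : ℂ) ^ (-ρ)) 2] at h
  rw [integral_const_mul, integral_prod_mul (fun y : ℝ =>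
    Complex.exp (Complex.I * (ν - l : ℝ) * (y / 2 : ℝ)) * ((Real.cosh (y / 2) : ℝ) : ℂ) ^ (-ρ))
    (fun y : ℝ => Complex.exp (Complex.I * (ν + l : ℝ) * y) * ((Real.cosh y : ℝ) : ℂ) ^ (-ρ)),
    integral_exp_mul_cosh_half_cpow hρ]
  rw [abs_two, Complex.real_smul, Complex.ofReal_ofNat, mul_comm, ← eq_div_iff two_ne_zero] at h
  rw [h, Complex.cpow_neg, Complex.cpow_sub _ _ two_ne_zero, Complex.cpow_one]
  have h2 : (2 : ℂ) ^ ρ ≠ 0 := by simp [Complex.cpow_eq_zero_iff]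
  have hG := Complex.Gamma_ne_zero_of_re_pos hρ
  field_simp

/-- As a double integral, the product of Bessel functions depends on `s` only through `e^{-r e^s}`
with `r = cosh p + cosh q`; its Mellin transform then follows from the Fubini lemma
`integral_prod_exp_mul_sub`. -/
theorem besselIntegral_mul_eq (ρ : ℂ) (ν l s : ℝ) :
    Complex.exp (ρ * s) * (besselIntegral ν s * besselIntegral l s) =
      ∫ x : ℝ × ℝ, Complex.exp (Complex.I * ν * x.1 + Complex.I * l * x.2) *
        Complex.exp (ρ * s - (((Real.cosh x.1 + Real.cosh x.2) * Real.exp s : ℝ) : ℂ)) := by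
  rw [besselIntegral, besselIntegral, ← integral_prod_mul, ← integral_const_mul]
  refine integral_congr_ae (ae_of_all _ fun x => ?_)
  simp only
  rw [← Complex.exp_add, ← Complex.exp_add, ← Complex.exp_add]
  push_cast
  ring_nf

theorem integrable_exp_mul_besselIntegral_mul {ρ : ℂ} (hρ : 0 < ρ.re) (ν l : ℝ) :
    Integrable fun s : ℝ => Complex.exp (ρ * s) * (besselIntegral ν s * besselIntegral l s) := by
  simp_rw [besselIntegral_mul_eq]
  exact (integrable_prod_exp_mul_sub hρ (fun x : ℝ × ℝ =>
    add_pos (Real.cosh_pos x.1) (Real.cosh_pos x.2)) (by fun_prop) (by fun_prop)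
    (integrable_exp_mul_cosh_add_cosh hρ ν l)).integral_prod_left

/-- The Mellin transform of a product of two Bessel functions. -/
theorem integral_exp_mul_besselIntegral_mul {ρ : ℂ} (hρ : 0 < ρ.re) (ν l : ℝ) :
    ∫ s : ℝ, Complex.exp (ρ * s) * (besselIntegral ν s * besselIntegral l s) =
      (2 : ℂ) ^ (ρ - 1) * (gammaPair (ρ / 2) ((ν - l) / 2) * gammaPair (ρ / 2) ((ν + l) / 2)) /
        Complex.Gamma ρ := by
  simp_rw [besselIntegral_mul_eq]
  have h := integral_prod_exp_mul_sub hρ (fun x : ℝ × ℝ =>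
    add_pos (Real.cosh_pos x.1) (Real.cosh_pos x.2)) (by fun_prop) (by fun_prop)
    (integrable_exp_mul_cosh_add_cosh hρ ν l)
  have h2 := integral_exp_mul_cosh_add_cosh hρ ν l
  rw [Measure.volume_eq_prod] at h2 ⊢
  rw [h, h2]
  have hG := Complex.Gamma_ne_zero_of_re_pos hρ
  field_simp

end Bessel

/-! ### Macdonald's product formula for two Bessel functions. -/

section Macdonald

/-- With `v` the argument before `± P/2`, the left side is `(U e^v + U' e^{-v})/2`, where `U' =
e^{y+t/2-P/2} + e^{y-t/2+P/2}` and `U U' = 2 e^{2y} (cosh t + cosh P)`. Choosing `v` so that `U e^v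
= e^{2y-s}` makes the second term `e^s (cosh t + cosh P)`. -/
theorem macdonald_exponent (t y P s : ℝ) :
    Real.exp (y + t / 2) * Real.cosh ((2 * y - Real.log (Real.exp (y + t / 2 + P / 2) +
      Real.exp (y - t / 2 - P / 2)) - s) + P / 2) +
    Real.exp (y - t / 2) * Real.cosh ((2 * y - Real.log (Real.exp (y + t / 2 + P / 2) +
      Real.exp (y - t / 2 - P / 2)) - s) - P / 2) =
    Real.exp s * Real.cosh P + (Real.exp s * Real.cosh t + Real.exp (2 * y - s) / 2) := by
  set U := Real.exp (y + t / 2 + P / 2) + Real.exp (y - t / 2 - P / 2) with hU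
  have hU0 : 0 < U := by positivity
  have hv : Real.exp (2 * y - Real.log U - s) = Real.exp (2 * y - s) / U := by
    rw [show 2 * y - Real.log U - s = 2 * y - s - Real.log U by ring, Real.exp_sub,
      Real.exp_log hU0]
  have hvn : Real.exp (-(2 * y - Real.log U - s)) = Real.exp (s - 2 * y) * U := by
    rw [show -(2 * y - Real.log U - s) = s - 2 * y + Real.log U by ring, Real.exp_add,
      Real.exp_log hU0]
  have h1 : Real.exp (y + t / 2) * Real.cosh ((2 * y - Real.log U - s) + P / 2) +
      Real.exp (y - t / 2) * Real.cosh ((2 * y - Real.log U - s) - P / 2) =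
      (Real.exp (2 * y - Real.log U - s) * U + Real.exp (-(2 * y - Real.log U - s)) *
        (Real.exp (y + t / 2 - P / 2) + Real.exp (y - t / 2 + P / 2))) / 2 := by
    rw [hU, Real.cosh_eq, Real.cosh_eq]
    simp only [sub_eq_add_neg, neg_add, Real.exp_add, neg_neg]
    ring
  rw [h1, hv, hvn, div_mul_cancel₀ _ hU0.ne', hU, mul_assoc, add_mul,
    mul_add (Real.exp (y + t / 2 + P / 2)), mul_add (Real.exp (y - t / 2 - P / 2)),
    ← Real.exp_add, ← Real.exp_add, ← Real.exp_add, ← Real.exp_add, Real.cosh_eq, Real.cosh_eq]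
  rw [show y + t / 2 + P / 2 + (y + t / 2 - P / 2) = 2 * y + t by ring,
    show y + t / 2 + P / 2 + (y - t / 2 + P / 2) = 2 * y + P by ring,
    show y - t / 2 - P / 2 + (y + t / 2 - P / 2) = 2 * y + -P by ring,
    show y - t / 2 - P / 2 + (y - t / 2 + P / 2) = 2 * y + -t by ring]
  rw [Real.exp_add (2 * y), Real.exp_add (2 * y), Real.exp_add (2 * y), Real.exp_add (2 * y),
    Real.exp_sub s]
  field_simp
  ring

theorem measurePreserving_macdonald (t y : ℝ) :
    MeasurePreserving (fun x : ℝ × ℝ => (x.1, 2 * y - Real.log (Real.exp (y + t / 2 + x.1 / 2) +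
      Real.exp (y - t / 2 - x.1 / 2)) - x.2)) (volume.prod volume) (volume.prod volume) :=
  (MeasurePreserving.id volume).skew_product
    (g := fun P s => 2 * y - Real.log (Real.exp (y + t / 2 + P / 2) +
      Real.exp (y - t / 2 - P / 2)) - s)
    (by simp only [Function.uncurry_def]; fun_prop)
    (ae_of_all _ fun _ => (volume.measurePreserving_sub_left _).map_eq)

theorem integrable_bessel_kernel_mul (ν y₁ y₂ : ℝ) : Integrable (fun x : ℝ × ℝ =>
    Complex.exp (Complex.I * ν * x.1 - ((Real.exp y₁ * Real.cosh (x.2 + x.1 / 2) +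
      Real.exp y₂ * Real.cosh (x.2 - x.1 / 2) : ℝ) : ℂ))) (volume.prod volume) := by
  have h := measurePreserving_half_add_half_sub.integrable_comp_of_integrable
    ((integrable_bessel_kernel ν y₁).mul_prod (integrable_bessel_kernel (-ν) y₂))
  refine h.congr (ae_of_all _ fun x => ?_)
  simp only [Function.comp_apply]
  rw [← Complex.exp_add]
  push_cast
  ring_nf

theorem besselIntegral_mul_besselIntegral (ν y₁ y₂ : ℝ) :
    besselIntegral ν y₁ * besselIntegral ν y₂ = ∫ x : ℝ × ℝ,
      Complex.exp (Complex.I * ν * x.1 - ((Real.exp y₁ * Real.cosh (x.2 + x.1 / 2) +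
        Real.exp y₂ * Real.cosh (x.2 - x.1 / 2) : ℝ) : ℂ)) ∂volume.prod volume := by
  have h := ((integrable_bessel_kernel ν y₁).mul_prod (integrable_bessel_kernel (-ν) y₂))
  -- The second factor is written with frequency `-ν`, so that the combined phase depends only on
  -- the difference of the two integration variables.
  rw [← besselIntegral_neg ν y₂, besselIntegral, besselIntegral, ← integral_prod_mul,
    MeasurePreserving.integral_eq_integral_comp measurePreserving_half_add_half_sub
      h.aestronglyMeasurable]
  refine integral_congr_ae (ae_of_all _ fun x => ?_)
  simp only
  rw [← Complex.exp_add]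
  push_cast
  ring_nf

theorem integrable_macdonald_prod (ν t y : ℝ) : Integrable (fun x : ℝ × ℝ =>
    Complex.exp (Complex.I * ν * x.1 - ((Real.exp x.2 * Real.cosh x.1 +
      (Real.exp x.2 * Real.cosh t + Real.exp (2 * y - x.2) / 2) : ℝ) : ℂ)))
      (volume.prod volume) := by
  have h := (measurePreserving_macdonald t y).integrable_comp_of_integrable
    (integrable_bessel_kernel_mul ν (y + t / 2) (y - t / 2))
  refine h.congr (ae_of_all _ fun x => ?_)
  simp only [Function.comp_apply]
  rw [macdonald_exponent]

theorem integral_macdonald_section (ν t y s : ℝ) :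
    ∫ P : ℝ, Complex.exp (Complex.I * ν * P - ((Real.exp s * Real.cosh P +
      (Real.exp s * Real.cosh t + Real.exp (2 * y - s) / 2) : ℝ) : ℂ)) =
    Complex.exp (-((Real.exp s * Real.cosh t + Real.exp (2 * y - s) / 2 : ℝ) : ℂ)) *
      besselIntegral ν s := by
  rw [besselIntegral, ← integral_const_mul]
  refine integral_congr_ae (ae_of_all _ fun P => ?_)
  simp only
  rw [← Complex.exp_add]
  push_cast
  ring_nf

theorem integrable_macdonald (ν t y : ℝ) : Integrable fun s : ℝ =>
    Complex.exp (-((Real.exp s * Real.cosh t + Real.exp (2 * y - s) / 2 : ℝ) : ℂ)) *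
      besselIntegral ν s := by
  simp_rw [← integral_macdonald_section]
  exact (integrable_macdonald_prod ν t y).integral_prod_right

/-- Macdonald's product formula. -/
theorem integral_macdonald (ν t y : ℝ) : ∫ s : ℝ,
    Complex.exp (-((Real.exp s * Real.cosh t + Real.exp (2 * y - s) / 2 : ℝ) : ℂ)) *
      besselIntegral ν s = besselIntegral ν (y + t / 2) * besselIntegral ν (y - t / 2) := by
  simp_rw [← integral_macdonald_section]
  have h1 := integral_prod_symm _ (integrable_macdonald_prod ν t y)
  simp only at h1
  rw [← h1, besselIntegral_mul_besselIntegral,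
    MeasurePreserving.integral_eq_integral_comp (measurePreserving_macdonald t y)
      (integrable_bessel_kernel_mul ν (y + t / 2) (y - t / 2)).aestronglyMeasurable]
  refine integral_congr_ae (ae_of_all _ fun x => ?_)
  simp only
  rw [macdonald_exponent]

theorem integrable_macdonald_real (t y : ℝ) : Integrable fun s : ℝ =>
    Real.exp (-(Real.exp s * Real.cosh t + Real.exp (2 * y - s) / 2)) * besselIntegralReal s := by
  refine (integrable_macdonald 0 t y).norm.congr (ae_of_all _ fun s => ?_)
  simp only
  rw [norm_mul, besselIntegral_zero, Complex.norm_real,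
    Real.norm_of_nonneg (besselIntegralReal_nonneg s), ← zero_sub, norm_exp_sub_ofReal]
  simp

/-- The case `ν = 0`, where everything is positive, evaluates the majorants needed for Fubini. -/
theorem integral_macdonald_real (t y : ℝ) : ∫ s : ℝ,
    Real.exp (-(Real.exp s * Real.cosh t + Real.exp (2 * y - s) / 2)) * besselIntegralReal s =
      besselIntegralReal (y + t / 2) * besselIntegralReal (y - t / 2) := by
  have h := integral_macdonald 0 t y
  simp_rw [besselIntegral_zero] at h
  rw [← Complex.ofReal_inj, ← integral_complex_ofReal]
  push_cast at h ⊢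
  exact h

end Macdonald

/-! ### The threefold integral as a product of two Mellin transforms. -/

section FourfoldIntegral

variable {ρ : ℂ}

theorem measurePreserving_prod_right_comm {α β γ : Type*} [MeasurableSpace α] [MeasurableSpace β]
    [MeasurableSpace γ] (μ : Measure α) (ν : Measure β) (τ : Measure γ) [SFinite μ] [SFinite ν]
    [SFinite τ] : MeasurePreserving (fun x : (α × β) × γ => ((x.1.1, x.2), x.1.2))
      ((μ.prod ν).prod τ) ((μ.prod τ).prod ν) :=
  (measurePreserving_prodAssoc μ τ ν).symm.comp
    (((MeasurePreserving.id μ).prod Measure.measurePreserving_swap).comp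
      (measurePreserving_prodAssoc μ ν τ))

theorem integrable_mellin_prod (hρ : 0 < ρ.re) (κ ν l : ℝ) : Integrable (fun x : ℝ × ℝ =>
    Complex.exp (Complex.I * κ * x.1 + 2 * ρ * x.2) *
      ((besselIntegral ν (x.2 + x.1 / 2) * besselIntegral ν (x.2 - x.1 / 2)) *
      (besselIntegral l (x.2 + x.1 / 2) * besselIntegral l (x.2 - x.1 / 2))))
      (volume.prod volume) := by
  have h := measurePreserving_half_add_half_sub.integrable_comp_of_integrable
    ((integrable_exp_mul_besselIntegral_mul (ρ := ρ + Complex.I * κ) (by simpa) ν l).mul_prod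
    (integrable_exp_mul_besselIntegral_mul (ρ := ρ - Complex.I * κ) (by simpa) ν l))
  refine h.congr (ae_of_all _ fun x => ?_)
  simp only [Function.comp_apply]
  have he : Complex.exp (Complex.I * κ * x.1 + 2 * ρ * x.2) =
      Complex.exp ((ρ + Complex.I * κ) * (x.2 + x.1 / 2 : ℝ)) *
        Complex.exp ((ρ - Complex.I * κ) * (x.2 - x.1 / 2 : ℝ)) := by
    rw [← Complex.exp_add]
    push_cast
    ring_nf
  rw [he]
  ring

/-- The exponent splits as `iκt + 2ρy = (ρ + iκ)(y + t/2) + (ρ - iκ)(y - t/2)`, so the integral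
factors in the coordinates `y ± t/2`. -/
theorem integral_mellin_prod (hρ : 0 < ρ.re) (κ ν l : ℝ) : ∫ x : ℝ × ℝ,
    Complex.exp (Complex.I * κ * x.1 + 2 * ρ * x.2) *
      ((besselIntegral ν (x.2 + x.1 / 2) * besselIntegral ν (x.2 - x.1 / 2)) *
      (besselIntegral l (x.2 + x.1 / 2) * besselIntegral l (x.2 - x.1 / 2)))
      ∂volume.prod volume =
    (∫ s : ℝ, Complex.exp ((ρ + Complex.I * κ) * s) * (besselIntegral ν s * besselIntegral l s)) *
    ∫ s : ℝ, Complex.exp ((ρ - Complex.I * κ) * s) *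
      (besselIntegral ν s * besselIntegral l s) := by
  have h := ((integrable_exp_mul_besselIntegral_mul (ρ := ρ + Complex.I * κ) (by simpa) ν l).mul_prod
    (integrable_exp_mul_besselIntegral_mul (ρ := ρ - Complex.I * κ) (by simpa) ν l))
  rw [← integral_prod_mul, MeasurePreserving.integral_eq_integral_comp
    measurePreserving_half_add_half_sub h.aestronglyMeasurable]
  refine integral_congr_ae (ae_of_all _ fun x => ?_)
  simp only
  have he : Complex.exp (Complex.I * κ * x.1 + 2 * ρ * x.2) =
      Complex.exp ((ρ + Complex.I * κ) * (x.2 + x.1 / 2 : ℝ)) *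
        Complex.exp ((ρ - Complex.I * κ) * (x.2 - x.1 / 2 : ℝ)) := by
    rw [← Complex.exp_add]
    push_cast
    ring_nf
  rw [he]
  ring

/-- Tonelli: replacing Bessel functions by their majorants at frequency `0`, the inner integral is
given exactly by Macdonald's formula. This leaves the norm of the factored integrand with `ρ.re` in
place of `ρ` and all frequencies zero. -/
theorem integrable_fourfold (hρ : 0 < ρ.re) (κ ν l : ℝ) :
    Integrable (fun x : (ℝ × ℝ) × (ℝ × ℝ) => Complex.exp (Complex.I * κ * x.1.1 + 2 * ρ * x.1.2) *
      ((Complex.exp (-((Real.exp x.2.1 * Real.cosh x.1.1 +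
        Real.exp (2 * x.1.2 - x.2.1) / 2 : ℝ) : ℂ)) * besselIntegral ν x.2.1) *
      (Complex.exp (-((Real.exp x.2.2 * Real.cosh x.1.1 +
        Real.exp (2 * x.1.2 - x.2.2) / 2 : ℝ) : ℂ)) * besselIntegral l x.2.2)))
      ((volume.prod volume).prod (volume.prod volume)) := by
  have hν := (stronglyMeasurable_besselIntegral ν).measurable
  have hl := (stronglyMeasurable_besselIntegral l).measurable
  have hm : Measurable (fun x : (ℝ × ℝ) × (ℝ × ℝ) =>
      Complex.exp (Complex.I * κ * x.1.1 + 2 * ρ * x.1.2) *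
      ((Complex.exp (-((Real.exp x.2.1 * Real.cosh x.1.1 +
        Real.exp (2 * x.1.2 - x.2.1) / 2 : ℝ) : ℂ)) * besselIntegral ν x.2.1) *
      (Complex.exp (-((Real.exp x.2.2 * Real.cosh x.1.1 +
        Real.exp (2 * x.1.2 - x.2.2) / 2 : ℝ) : ℂ)) * besselIntegral l x.2.2))) := by
    fun_prop
  rw [integrable_prod_iff hm.aestronglyMeasurable]
  refine ⟨ae_of_all _ fun x => ((integrable_macdonald ν x.1 x.2).mul_prod
    (integrable_macdonald l x.1 x.2)).const_mul
      (Complex.exp (Complex.I * κ * x.1 + 2 * ρ * x.2)), ?_⟩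
  refine (integrable_mellin_prod (ρ := (ρ.re : ℂ)) (by simpa) 0 0 0).norm.mono'
    hm.aestronglyMeasurable.norm.integral_prod_right' (ae_of_all _ fun x => ?_)
  have hN : ∀ (μ : ℝ) (s : ℝ), ‖Complex.exp (-((Real.exp s * Real.cosh x.1 +
      Real.exp (2 * x.2 - s) / 2 : ℝ) : ℂ)) * besselIntegral μ s‖ ≤
      Real.exp (-(Real.exp s * Real.cosh x.1 + Real.exp (2 * x.2 - s) / 2)) *
        besselIntegralReal s := fun μ s => by
    rw [norm_mul, ← zero_sub, norm_exp_sub_ofReal, Complex.zero_re, zero_sub]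
    exact mul_le_mul_of_nonneg_left (norm_besselIntegral_le μ s) (Real.exp_pos _).le
  rw [Real.norm_of_nonneg (integral_nonneg fun _ => norm_nonneg _)]
  have hbound := integral_mono_of_nonneg (μ := volume.prod volume)
    (f := fun w : ℝ × ℝ => ‖Complex.exp (Complex.I * κ * x.1 + 2 * ρ * x.2) *
      ((Complex.exp (-((Real.exp w.1 * Real.cosh x.1 +
        Real.exp (2 * x.2 - w.1) / 2 : ℝ) : ℂ)) * besselIntegral ν w.1) *
      (Complex.exp (-((Real.exp w.2 * Real.cosh x.1 +
        Real.exp (2 * x.2 - w.2) / 2 : ℝ) : ℂ)) * besselIntegral l w.2))‖)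
    (g := fun w : ℝ × ℝ => ‖Complex.exp (Complex.I * κ * x.1 + 2 * ρ * x.2)‖ *
      ((Real.exp (-(Real.exp w.1 * Real.cosh x.1 + Real.exp (2 * x.2 - w.1) / 2)) *
        besselIntegralReal w.1) * (Real.exp (-(Real.exp w.2 * Real.cosh x.1 +
        Real.exp (2 * x.2 - w.2) / 2)) * besselIntegralReal w.2)))
    (ae_of_all _ fun _ => norm_nonneg _)
    (((integrable_macdonald_real x.1 x.2).mul_prod (integrable_macdonald_real x.1 x.2)).const_mul _)
    (ae_of_all _ fun w => by
      simp only [norm_mul _ (_ * _ * (_ * _))]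
      refine mul_le_mul_of_nonneg_left ?_ (norm_nonneg _)
      rw [norm_mul]
      exact mul_le_mul (hN ν w.1) (hN l w.2) (norm_nonneg _)
        (mul_nonneg (Real.exp_pos _).le (besselIntegralReal_nonneg _)))
  refine hbound.trans_eq ?_
  rw [integral_const_mul, integral_prod_mul
    (fun s => Real.exp (-(Real.exp s * Real.cosh x.1 + Real.exp (2 * x.2 - s) / 2)) *
      besselIntegralReal s) (fun s => Real.exp (-(Real.exp s * Real.cosh x.1 +
      Real.exp (2 * x.2 - s) / 2)) * besselIntegralReal s), integral_macdonald_real]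
  simp only [besselIntegral_zero, norm_mul, Complex.norm_real, Complex.norm_exp,
    Real.norm_of_nonneg (besselIntegralReal_nonneg _)]
  congr 2
  simp

theorem integral_fourfold (κ ν l t y : ℝ) :
    ∫ w : ℝ × ℝ, Complex.exp (Complex.I * κ * t + 2 * ρ * y) *
      ((Complex.exp (-((Real.exp w.1 * Real.cosh t +
        Real.exp (2 * y - w.1) / 2 : ℝ) : ℂ)) * besselIntegral ν w.1) *
      (Complex.exp (-((Real.exp w.2 * Real.cosh t +
        Real.exp (2 * y - w.2) / 2 : ℝ) : ℂ)) * besselIntegral l w.2)) ∂volume.prod volume =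
    Complex.exp (Complex.I * κ * t + 2 * ρ * y) *
      ((besselIntegral ν (y + t / 2) * besselIntegral ν (y - t / 2)) *
      (besselIntegral l (y + t / 2) * besselIntegral l (y - t / 2))) := by
  rw [integral_const_mul, integral_prod_mul
    (fun s => Complex.exp (-((Real.exp s * Real.cosh t +
        Real.exp (2 * y - s) / 2 : ℝ) : ℂ)) * besselIntegral ν s)
    (fun s => Complex.exp (-((Real.exp s * Real.cosh t +
        Real.exp (2 * y - s) / 2 : ℝ) : ℂ)) * besselIntegral l s), integral_macdonald,
    integral_macdonald]

theorem integral_exp_two_mul_sub (hρ : 0 < ρ.re) {r : ℝ} (hr : 0 < r) :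
    ∫ y : ℝ, Complex.exp (2 * ρ * y - ((r * Real.exp (2 * y) : ℝ) : ℂ)) =
      (r : ℂ) ^ (-ρ) * Complex.Gamma ρ / 2 := by
  have h := Measure.integral_comp_mul_left
    (fun s : ℝ => Complex.exp (ρ * s - ((r * Real.exp s : ℝ) : ℂ))) 2
  rw [integral_exp_mul_sub_mul_exp hρ hr, abs_of_pos (by norm_num), Complex.real_smul] at h
  rw [div_eq_inv_mul]
  convert h using 2
  · funext y
    push_cast
    ring_nf
  · norm_num

/-- The threefold integrand, which is common to both sides of the computation. -/
theorem integral_fourfold_section (hρ : 0 < ρ.re) (κ ν l t s s' : ℝ) :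
    ∫ y : ℝ, Complex.exp (Complex.I * κ * t + 2 * ρ * y) *
      ((Complex.exp (-((Real.exp s * Real.cosh t +
        Real.exp (2 * y - s) / 2 : ℝ) : ℂ)) * besselIntegral ν s) *
      (Complex.exp (-((Real.exp s' * Real.cosh t +
        Real.exp (2 * y - s') / 2 : ℝ) : ℂ)) * besselIntegral l s')) =
    ((2 : ℂ) ^ (ρ - 1) * Complex.Gamma ρ) * (Complex.exp (Complex.I * κ * t) *
      (Complex.exp (ρ * (s + s') - (((Real.exp s + Real.exp s') * Real.cosh t : ℝ) : ℂ)) *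
      ((Real.exp s + Real.exp s' : ℝ) : ℂ) ^ (-ρ)) * (besselIntegral ν s * besselIntegral l s')) := by
  -- This is the coefficient of `e^{2y}` in the sum of the two Macdonald exponents.
  have hr : 0 < (Real.exp (-s) + Real.exp (-s')) / 2 := by positivity
  have h := integral_exp_two_mul_sub hρ hr
  have h1 : (((Real.exp (-s) + Real.exp (-s')) / 2 : ℝ) : ℂ) ^ (-ρ) =
      (2 : ℂ) ^ ρ * (Complex.exp (ρ * (s + s')) * ((Real.exp s + Real.exp s' : ℝ) : ℂ) ^ (-ρ)) := by
    have e : (Real.exp (-s) + Real.exp (-s')) / 2 =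
        2⁻¹ * (Real.exp (-(s + s')) * (Real.exp s + Real.exp s')) := by
      rw [neg_add, Real.exp_add, Real.exp_neg, Real.exp_neg]
      field_simp
      ring
    rw [e, ofReal_cpow_mul_of_pos (by norm_num) (by positivity),
      ofReal_cpow_mul_of_pos (Real.exp_pos _) (by positivity),
      cpow_ofReal_eq_exp (Real.exp_pos _), Real.log_exp, cpow_ofReal_eq_exp (by norm_num : (0 : ℝ) < 2⁻¹),
      Real.log_inv, ← Complex.ofReal_ofNat, cpow_ofReal_eq_exp two_pos]
    push_cast
    ring_nf
  rw [h1] at h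
  have h2 : ∀ y : ℝ, Complex.exp (Complex.I * κ * t + 2 * ρ * y) *
      ((Complex.exp (-((Real.exp s * Real.cosh t +
        Real.exp (2 * y - s) / 2 : ℝ) : ℂ)) * besselIntegral ν s) *
      (Complex.exp (-((Real.exp s' * Real.cosh t +
        Real.exp (2 * y - s') / 2 : ℝ) : ℂ)) * besselIntegral l s')) =
      (Complex.exp (Complex.I * κ * t - (((Real.exp s + Real.exp s') * Real.cosh t : ℝ) : ℂ)) *
        (besselIntegral ν s * besselIntegral l s')) *
      Complex.exp (2 * ρ * y - (((Real.exp (-s) + Real.exp (-s')) / 2 * Real.exp (2 * y) : ℝ) : ℂ)) := by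
    intro y
    have e : Complex.exp (Complex.I * κ * t + 2 * ρ * y) * Complex.exp (-((Real.exp s * Real.cosh t +
        Real.exp (2 * y - s) / 2 : ℝ) : ℂ)) * Complex.exp (-((Real.exp s' * Real.cosh t +
        Real.exp (2 * y - s') / 2 : ℝ) : ℂ)) =
        Complex.exp (Complex.I * κ * t - (((Real.exp s + Real.exp s') * Real.cosh t : ℝ) : ℂ)) *
        Complex.exp (2 * ρ * y -
          (((Real.exp (-s) + Real.exp (-s')) / 2 * Real.exp (2 * y) : ℝ) : ℂ)) := by
      rw [← Complex.exp_add, ← Complex.exp_add, ← Complex.exp_add, sub_eq_add_neg (2 * y),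
        sub_eq_add_neg (2 * y), Real.exp_add, Real.exp_add]
      congr 1
      push_cast
      ring
    linear_combination (besselIntegral ν s * besselIntegral l s') * e
  simp_rw [h2]
  rw [integral_const_mul, h, sub_eq_add_neg, Complex.exp_add, sub_eq_add_neg (ρ * _),
    Complex.exp_add (ρ * _), Complex.cpow_sub _ _ two_ne_zero, Complex.cpow_one]
  ring

/-- Integrability and value of the threefold integral. -/
theorem integrable_threefold_and_integral (hρ : 0 < ρ.re) (κ ν l : ℝ) :
    Integrable (fun x : ℝ × (ℝ × ℝ) => Complex.exp (Complex.I * κ * x.1) *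
      (Complex.exp (ρ * (x.2.1 + x.2.2) -
        (((Real.exp x.2.1 + Real.exp x.2.2) * Real.cosh x.1 : ℝ) : ℂ)) *
      ((Real.exp x.2.1 + Real.exp x.2.2 : ℝ) : ℂ) ^ (-ρ)) *
      (besselIntegral ν x.2.1 * besselIntegral l x.2.2)) (volume.prod (volume.prod volume)) ∧
    ((2 : ℂ) ^ (ρ - 1) * Complex.Gamma ρ) *
      ∫ x : ℝ × (ℝ × ℝ), Complex.exp (Complex.I * κ * x.1) *
      (Complex.exp (ρ * (x.2.1 + x.2.2) -
        (((Real.exp x.2.1 + Real.exp x.2.2) * Real.cosh x.1 : ℝ) : ℂ)) *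
      ((Real.exp x.2.1 + Real.exp x.2.2 : ℝ) : ℂ) ^ (-ρ)) *
      (besselIntegral ν x.2.1 * besselIntegral l x.2.2) ∂volume.prod (volume.prod volume) =
    (∫ s : ℝ, Complex.exp ((ρ + Complex.I * κ) * s) * (besselIntegral ν s * besselIntegral l s)) *
    ∫ s : ℝ, Complex.exp ((ρ - Complex.I * κ) * s) *
      (besselIntegral ν s * besselIntegral l s) := by
  have hF := integrable_fourfold hρ κ ν l
  have hS := measurePreserving_prod_right_comm (volume : Measure ℝ)
    ((volume : Measure ℝ).prod (volume : Measure ℝ)) (volume : Measure ℝ)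
  have hF' := hS.integrable_comp_of_integrable hF
  have hC : (2 : ℂ) ^ (ρ - 1) * Complex.Gamma ρ ≠ 0 :=
    mul_ne_zero (by simp [Complex.cpow_eq_zero_iff]) (Complex.Gamma_ne_zero_of_re_pos hρ)
  have hint := hF'.integral_prod_left
  simp only [Function.comp_apply, integral_fourfold_section hρ] at hint
  refine ⟨(integrable_const_mul_iff (IsUnit.mk0 _ hC) _).1 hint, ?_⟩
  -- The fourfold integral is evaluated in two orders: integrating out `y` gives the threefold
  -- integrand, while integrating out `s, s'` gives back the four Bessel functions by Macdonald's
  -- formula.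
  rw [← integral_mellin_prod hρ, ← integral_const_mul]
  simp_rw [← integral_fourfold_section hρ, ← integral_fourfold]
  have h1 := integral_prod _ hF
  have h2 := integral_prod _ hF'
  have h3 := MeasurePreserving.integral_eq_integral_comp hS hF.aestronglyMeasurable
  simp only [Function.comp_apply] at h1 h2 h3
  rw [← h1, h3, h2]

end FourfoldIntegral

/-! ### The integral of a Mehler factor and two conical functions. -/

section MehlerLaplace

variable {ρ : ℂ}

theorem mehlerKernel_eq_zero {z t : ℝ} (h : z ≤ Real.cosh t) : mehlerKernel ρ z t = 0 := by
  rw [mehlerKernel, if_neg (not_lt.2 h)]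

theorem measurable_mehlerKernel : Measurable (Function.uncurry (mehlerKernel ρ)) := by
  refine Measurable.ite (measurableSet_lt ?_ ?_) ?_ measurable_const <;> fun_prop

theorem ofReal_norm_mehlerKernel (z t : ℝ) :
    ((‖mehlerKernel ρ z t‖ : ℝ) : ℂ) = mehlerKernel (ρ.re : ℂ) z t := by
  rw [mehlerKernel, mehlerKernel]
  split_ifs with h
  · rw [Complex.norm_cpow_eq_rpow_re_of_pos (sub_pos.2 h), Complex.ofReal_cpow (sub_pos.2 h).le]
    simp
  · simp

/-- The shift `z ↦ z + cosh t` reduces this to Euler's Gamma integral. -/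
theorem integral_mehlerKernel_mul_exp (hρ : 0 < ρ.re) (t : ℝ) {c : ℝ} (hc : 0 < c) :
    ∫ z : ℝ, mehlerKernel ρ z t * Complex.exp (-((c * z : ℝ) : ℂ)) =
      Complex.exp (-((c * Real.cosh t : ℝ) : ℂ)) * (c : ℂ) ^ (-ρ) * Complex.Gamma ρ := by
  have h := Complex.integral_cpow_mul_exp_neg_mul_Ioi hρ hc
  rw [one_div, Complex.inv_cpow _ _ (by
    rw [Complex.arg_ofReal_of_nonneg hc.le]; exact Real.pi_pos.ne), ← Complex.cpow_neg] at h
  rw [mul_assoc, ← h, ← integral_const_mul, ← integral_add_right_eq_self _ (Real.cosh t),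
    ← integral_indicator measurableSet_Ioi]
  refine integral_congr_ae (ae_of_all _ fun x => ?_)
  simp only [mehlerKernel, indicator_apply, mem_Ioi, lt_add_iff_pos_left, add_sub_cancel_right]
  split_ifs with hx
  · rw [mul_left_comm, ← Complex.exp_add]
    push_cast
    ring_nf
  · simp

theorem integrable_mehlerKernel_mul_exp (hρ : 0 < ρ.re) (t : ℝ) {c : ℝ} (hc : 0 < c) :
    Integrable fun z : ℝ => mehlerKernel ρ z t * Complex.exp (-((c * z : ℝ) : ℂ)) := by
  by_contra h
  have := integral_mehlerKernel_mul_exp hρ t hc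
  rw [integral_undef h, eq_comm, cpow_ofReal_eq_exp hc] at this
  exact mul_ne_zero (mul_ne_zero (Complex.exp_ne_zero _) (Complex.exp_ne_zero _))
    (Complex.Gamma_ne_zero_of_re_pos hρ) this

theorem integral_norm_mehlerKernel_mul_exp (hρ : 0 < ρ.re) (t : ℝ) {c : ℝ} (hc : 0 < c) :
    ∫ z : ℝ, ‖mehlerKernel ρ z t * Complex.exp (-((c * z : ℝ) : ℂ))‖ =
      Real.Gamma ρ.re * ‖Complex.exp (-((c * Real.cosh t : ℝ) : ℂ)) * (c : ℂ) ^ (-ρ)‖ := by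
  have h := integral_mehlerKernel_mul_exp (ρ := (ρ.re : ℂ)) (by simpa) t hc
  simp_rw [← ofReal_norm_mehlerKernel] at h
  rw [Complex.Gamma_ofReal, ← Complex.ofReal_neg, ← Complex.ofReal_neg, ← Complex.ofReal_cpow hc.le,
    ← Complex.ofReal_exp, ← Complex.ofReal_mul, ← Complex.ofReal_mul] at h
  rw [norm_mul, Complex.norm_cpow_eq_rpow_re_of_pos hc, mul_comm (Real.Gamma _), Complex.neg_re,
    ← Complex.ofReal_neg, ← Complex.ofReal_exp, Complex.norm_real,
    Real.norm_of_nonneg (Real.exp_pos _).le, ← Complex.ofReal_inj, ← h, ← integral_complex_ofReal]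
  refine integral_congr_ae (ae_of_all _ fun z => ?_)
  simp only
  rw [norm_mul, ← Complex.ofReal_neg, ← Complex.ofReal_exp, Complex.norm_real,
    Real.norm_of_nonneg (Real.exp_pos _).le]
  push_cast
  rfl

theorem mehler_fourfold_eq (κ ν l z t s s' : ℝ) :
    Complex.exp (Complex.I * κ * t) * mehlerKernel ρ z t *
      ((Complex.exp (ρ * s - ((z * Real.exp s : ℝ) : ℂ)) * besselIntegral ν s) *
      (Complex.exp (ρ * s' - ((z * Real.exp s' : ℝ) : ℂ)) * besselIntegral l s')) =
    (Complex.exp (Complex.I * κ * t) * Complex.exp (ρ * (s + s')) *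
      (besselIntegral ν s * besselIntegral l s')) *
      (mehlerKernel ρ z t * Complex.exp (-(((Real.exp s + Real.exp s') * z : ℝ) : ℂ))) := by
  have h : Complex.exp (ρ * s - ((z * Real.exp s : ℝ) : ℂ)) *
      Complex.exp (ρ * s' - ((z * Real.exp s' : ℝ) : ℂ)) =
      Complex.exp (ρ * (s + s')) * Complex.exp (-(((Real.exp s + Real.exp s') * z : ℝ) : ℂ)) := by
    rw [← Complex.exp_add, ← Complex.exp_add]
    push_cast
    ring_nf
  linear_combination (Complex.exp (Complex.I * κ * t) * mehlerKernel ρ z t *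
    (besselIntegral ν s * besselIntegral l s')) * h

theorem mehler_fourfold_section (hρ : 0 < ρ.re) (κ ν l t s s' : ℝ) :
    ∫ z : ℝ, Complex.exp (Complex.I * κ * t) * mehlerKernel ρ z t *
      ((Complex.exp (ρ * s - ((z * Real.exp s : ℝ) : ℂ)) * besselIntegral ν s) *
      (Complex.exp (ρ * s' - ((z * Real.exp s' : ℝ) : ℂ)) * besselIntegral l s')) =
    Complex.Gamma ρ * (Complex.exp (Complex.I * κ * t) *
      (Complex.exp (ρ * (s + s') - (((Real.exp s + Real.exp s') * Real.cosh t : ℝ) : ℂ)) *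
      ((Real.exp s + Real.exp s' : ℝ) : ℂ) ^ (-ρ)) *
      (besselIntegral ν s * besselIntegral l s')) := by
  simp_rw [mehler_fourfold_eq]
  rw [integral_const_mul, integral_mehlerKernel_mul_exp hρ t (by positivity), sub_eq_add_neg,
    Complex.exp_add (ρ * _)]
  ring

theorem mehler_fourfold_norm_section (hρ : 0 < ρ.re) (κ ν l t s s' : ℝ) :
    ∫ z : ℝ, ‖Complex.exp (Complex.I * κ * t) * mehlerKernel ρ z t *
      ((Complex.exp (ρ * s - ((z * Real.exp s : ℝ) : ℂ)) * besselIntegral ν s) *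
      (Complex.exp (ρ * s' - ((z * Real.exp s' : ℝ) : ℂ)) * besselIntegral l s'))‖ =
    Real.Gamma ρ.re * ‖Complex.exp (Complex.I * κ * t) *
      (Complex.exp (ρ * (s + s') - (((Real.exp s + Real.exp s') * Real.cosh t : ℝ) : ℂ)) *
      ((Real.exp s + Real.exp s' : ℝ) : ℂ) ^ (-ρ)) *
      (besselIntegral ν s * besselIntegral l s')‖ := by
  simp_rw [mehler_fourfold_eq, norm_mul (_ * _ * (_ * _)) (mehlerKernel _ _ _ * _)]
  rw [integral_const_mul, integral_norm_mehlerKernel_mul_exp hρ t (by positivity), sub_eq_add_neg,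
    Complex.exp_add (ρ * _)]
  simp only [norm_mul]
  ring

/-- Tonelli: the `z`-integral of the norm is exactly `Γ(re ρ)` times the norm of the threefold
integrand, already known to be integrable. -/
theorem integrable_mehler_fourfold (hρ : 0 < ρ.re) (κ ν l : ℝ) :
    Integrable (fun x : (ℝ × (ℝ × ℝ)) × ℝ => Complex.exp (Complex.I * κ * x.1.1) *
      mehlerKernel ρ x.2 x.1.1 * ((Complex.exp (ρ * x.1.2.1 - ((x.2 * Real.exp x.1.2.1 : ℝ) : ℂ)) *
        besselIntegral ν x.1.2.1) * (Complex.exp (ρ * x.1.2.2 -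
        ((x.2 * Real.exp x.1.2.2 : ℝ) : ℂ)) * besselIntegral l x.1.2.2)))
      ((volume.prod (volume.prod volume)).prod volume) := by
  have hν := (stronglyMeasurable_besselIntegral ν).measurable
  have hl := (stronglyMeasurable_besselIntegral l).measurable
  have hk : Measurable (fun x : (ℝ × (ℝ × ℝ)) × ℝ => mehlerKernel ρ x.2 x.1.1) :=
    (measurable_mehlerKernel (ρ := ρ)).comp
      (by fun_prop : Measurable fun x : (ℝ × (ℝ × ℝ)) × ℝ => (x.2, x.1.1))
  rw [integrable_prod_iff (Measurable.aestronglyMeasurable (by fun_prop))]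
  constructor
  · refine ae_of_all _ fun x => ?_
    simp_rw [mehler_fourfold_eq]
    exact (integrable_mehlerKernel_mul_exp hρ _ (by positivity)).const_mul
      (Complex.exp (Complex.I * κ * x.1) * Complex.exp (ρ * (x.2.1 + x.2.2)) *
        (besselIntegral ν x.2.1 * besselIntegral l x.2.2))
  · simp_rw [mehler_fourfold_norm_section hρ]
    exact (integrable_threefold_and_integral hρ κ ν l).1.norm.const_mul _

theorem mehler_fourfold_integral (hρ : 0 < ρ.re) (κ ν l : ℝ) {z : ℝ} (hz : 1 < z) :
    ∫ x : ℝ × (ℝ × ℝ), Complex.exp (Complex.I * κ * x.1) *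
      mehlerKernel ρ z x.1 * ((Complex.exp (ρ * x.2.1 - ((z * Real.exp x.2.1 : ℝ) : ℂ)) *
        besselIntegral ν x.2.1) * (Complex.exp (ρ * x.2.2 -
        ((z * Real.exp x.2.2 : ℝ) : ℂ)) * besselIntegral l x.2.2)) ∂volume.prod (volume.prod volume) =
    Complex.Gamma ρ ^ 2 *
      (mehlerIntegral ρ κ z * (conicalIntegral ρ ν z * conicalIntegral ρ l z)) := by
  rw [integral_prod_mul (fun t : ℝ => Complex.exp (Complex.I * κ * t) * mehlerKernel ρ z t)
    (fun w : ℝ × ℝ => (Complex.exp (ρ * w.1 - ((z * Real.exp w.1 : ℝ) : ℂ)) *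
        besselIntegral ν w.1) * (Complex.exp (ρ * w.2 -
        ((z * Real.exp w.2 : ℝ) : ℂ)) * besselIntegral l w.2)),
    integral_prod_mul (fun s : ℝ => Complex.exp (ρ * s - ((z * Real.exp s : ℝ) : ℂ)) *
        besselIntegral ν s) (fun s : ℝ => Complex.exp (ρ * s - ((z * Real.exp s : ℝ) : ℂ)) *
        besselIntegral l s), integral_exp_mul_besselIntegral hρ ν hz.le,
    integral_exp_mul_besselIntegral hρ l hz.le, ← mehlerIntegral]
  ring

theorem mehler_fourfold_integral_of_le (κ ν l : ℝ) {z : ℝ} (hz : z ≤ 1) :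
    ∫ x : ℝ × (ℝ × ℝ), Complex.exp (Complex.I * κ * x.1) *
      mehlerKernel ρ z x.1 * ((Complex.exp (ρ * x.2.1 - ((z * Real.exp x.2.1 : ℝ) : ℂ)) *
        besselIntegral ν x.2.1) * (Complex.exp (ρ * x.2.2 -
        ((z * Real.exp x.2.2 : ℝ) : ℂ)) * besselIntegral l x.2.2)) ∂volume.prod (volume.prod volume) =
    0 := by
  refine integral_eq_zero_of_ae (ae_of_all _ fun x => ?_)
  simp [mehlerKernel_eq_zero (hz.trans (Real.one_le_cosh x.1))]

theorem integrableOn_mehler_mul_conical (hρ : 0 < ρ.re) (κ ν l : ℝ) :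
    IntegrableOn (fun z => mehlerIntegral ρ κ z * (conicalIntegral ρ ν z * conicalIntegral ρ l z))
      (Ioi 1) := by
  have h := (integrable_mehler_fourfold hρ κ ν l).integral_prod_right.integrableOn (s := Ioi 1)
  have h2 : IntegrableOn (fun z => Complex.Gamma ρ ^ 2 *
      (mehlerIntegral ρ κ z * (conicalIntegral ρ ν z * conicalIntegral ρ l z))) (Ioi 1) :=
    h.congr_fun (fun z hz => mehler_fourfold_integral hρ κ ν l hz) measurableSet_Ioi
  exact (integrable_const_mul_iff
    (IsUnit.mk0 _ (pow_ne_zero 2 (Complex.Gamma_ne_zero_of_re_pos hρ))) _).1 h2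

/-- Fubini for the fourfold integrand: the inner `z`-integral produces the threefold integrand, and
the inner threefold integral produces the product of special functions. The region `z ≤ 1`
contributes nothing because `cosh t ≥ 1`. -/
theorem integral_mehler_mul_conical (hρ : 0 < ρ.re) (κ ν l : ℝ) :
    (2 : ℂ) ^ (ρ - 1) * Complex.Gamma ρ ^ 2 *
      ∫ z in Ioi (1 : ℝ), mehlerIntegral ρ κ z * (conicalIntegral ρ ν z * conicalIntegral ρ l z) =
    (∫ s : ℝ, Complex.exp ((ρ + Complex.I * κ) * s) * (besselIntegral ν s * besselIntegral l s)) *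
    ∫ s : ℝ, Complex.exp ((ρ - Complex.I * κ) * s) *
      (besselIntegral ν s * besselIntegral l s) := by
  rw [← (integrable_threefold_and_integral hρ κ ν l).2, mul_assoc, mul_assoc]
  congr 1
  have hF := integrable_mehler_fourfold hρ κ ν l
  rw [← integral_const_mul, ← integral_const_mul]
  simp_rw [← mehler_fourfold_section hρ]
  have h1 := (integral_prod _ hF).symm.trans (integral_prod_symm _ hF)
  simp only at h1
  rw [h1, ← integral_indicator measurableSet_Ioi]
  refine integral_congr_ae (ae_of_all _ fun z => ?_)
  simp only [indicator_apply, mem_Ioi]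
  split_ifs with hz
  · rw [mehler_fourfold_integral hρ κ ν l hz]
  · rw [mehler_fourfold_integral_of_le κ ν l (not_lt.1 hz)]

end MehlerLaplace

/-! ### Convergence and evaluation for `re d > 1`. -/

section TripleProduct

theorem signs_prod {M : Type*} [CommMonoid M] (f : ℤ → M) : ∏ ε ∈ signs, f ε = f 1 * f (-1) := by
  rw [signs, Finset.prod_pair (by norm_num)]

/-- Three Legendre prefactors and the weight combine to `(u² - 1)^(ρ - 1/2)`, exactly the power that
the Mehler–Dirichlet formula absorbs into the factor with `κ`. -/
theorem tripleIntegrand_eq {d : ℂ} (hd : 1 < d.re) (κ ν l : ℝ) {u : ℝ} (hu : 1 < u) :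
    tripleIntegrand d κ ν l u =
      (Complex.Gamma ((d - 1) / 2) / ((√(2 * Real.pi) : ℝ) ^ 3 *
        (gammaPair ((d - 1) / 2) ν * gammaPair ((d - 1) / 2) l))) *
      (mehlerIntegral ((d - 1) / 2) κ u *
        (conicalIntegral ((d - 1) / 2) ν u * conicalIntegral ((d - 1) / 2) l u)) := by
  set ρ := (d - 1) / 2 with hρd
  have hρ : 0 < ρ.re := by
    rw [hρd]
    simp
    linarith
  have hu2 : 0 < u ^ 2 - 1 := by nlinarith
  have hμ : -(d - 2) / 2 = 1 / 2 - ρ := by rw [hρd]; ring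
  have hw : -(d - 2) / 4 = (1 / 2 - ρ) / 2 := by rw [hρd]; ring
  rw [tripleIntegrand, hμ, hw, legendreP_eq_conicalIntegral hρ κ hu,
    legendreP_eq_conicalIntegral hρ ν hu, legendreP_eq_conicalIntegral hρ l hu]
  have hm := mehlerIntegral_eq hρ κ hu
  have hpow : ((u ^ 2 - 1 : ℝ) : ℂ) ^ ((ρ - 1 / 2) / 2) * ((u ^ 2 - 1 : ℝ) : ℂ) ^ ((ρ - 1 / 2) / 2) *
      ((u ^ 2 - 1 : ℝ) : ℂ) ^ ((ρ - 1 / 2) / 2) * ((u ^ 2 - 1 : ℝ) : ℂ) ^ ((1 / 2 - ρ) / 2) =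
      ((u ^ 2 - 1 : ℝ) : ℂ) ^ (ρ - 1 / 2) := by
    simp only [cpow_ofReal_eq_exp hu2, ← Complex.exp_add]
    ring_nf
  have g1 := gammaPair_ne_zero hρ κ
  have g2 := gammaPair_ne_zero hρ ν
  have g3 := gammaPair_ne_zero hρ l
  have g0 := Complex.Gamma_ne_zero_of_re_pos hρ
  have hpi : ((√(2 * Real.pi) : ℝ) : ℂ) ≠ 0 := by
    exact_mod_cast (Real.sqrt_pos.2 (by positivity)).ne'
  have hm' : mehlerIntegral ρ κ u = Complex.Gamma ρ ^ 2 * (((u ^ 2 - 1 : ℝ) : ℂ) ^ (ρ - 1 / 2) *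
      conicalIntegral ρ κ u) / gammaPair ρ κ := by
    rw [← hm, mul_div_cancel_left₀ _ g1]
  rw [hm', ← hpow]
  field_simp

theorem integrableOn_tripleIntegrand {d : ℂ} (hd : 1 < d.re) (κ ν l : ℝ) :
    IntegrableOn (tripleIntegrand d κ ν l) (Ioi 1) := by
  have hρ : 0 < ((d - 1) / 2).re := by
    simp
    linarith
  refine IntegrableOn.congr_fun ?_ (fun u hu => (tripleIntegrand_eq hd κ ν l hu).symm)
    measurableSet_Ioi
  exact (integrableOn_mehler_mul_conical hρ κ ν l).const_mul _

theorem hInt_eq_gProd {d : ℂ} (hd : 1 < d.re) (κ ν l : ℝ) : hInt d κ ν l = gProd d κ ν l := by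
  rw [hInt, setIntegral_congr_fun measurableSet_Ioi (fun u hu => tripleIntegrand_eq hd κ ν l hu),
    integral_const_mul]
  have hd2 : d / 2 = (d - 1) / 2 + 1 / 2 := by ring
  have hd4 : (d - 1) / 4 = ((d - 1) / 2) / 2 := by ring
  rw [gProd, hd2, hd4]
  have hρ : 0 < ((d - 1) / 2).re := by
    simp
    linarith
  generalize (d - 1) / 2 = ρ at hρ
  have h := integral_mehler_mul_conical hρ κ ν l
  rw [integral_exp_mul_besselIntegral_mul (by simpa), integral_exp_mul_besselIntegral_mul (by simpa)]
    at h
  simp only [signs_prod]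
  push_cast
  have g0 := Complex.Gamma_ne_zero_of_re_pos hρ
  have g1 := gammaPair_ne_zero hρ κ
  have g2 := gammaPair_ne_zero hρ ν
  have g3 := gammaPair_ne_zero hρ l
  -- The four pairs at `(ρ ± iκ)/2` with frequencies `(ν ± l)/2` run through all eight sign choices.
  have hprod : gammaPair ((ρ + Complex.I * κ) / 2) ((ν - l) / 2) *
      gammaPair ((ρ + Complex.I * κ) / 2) ((ν + l) / 2) *
      (gammaPair ((ρ - Complex.I * κ) / 2) ((ν - l) / 2) *
      gammaPair ((ρ - Complex.I * κ) / 2) ((ν + l) / 2)) =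
      ((Complex.Gamma (ρ / 2 + (Complex.I * 1 * κ + Complex.I * 1 * ν + Complex.I * 1 * l) / 2) *
        Complex.Gamma (ρ / 2 + (Complex.I * 1 * κ + Complex.I * 1 * ν + Complex.I * -1 * l) / 2)) *
      (Complex.Gamma (ρ / 2 + (Complex.I * 1 * κ + Complex.I * -1 * ν + Complex.I * 1 * l) / 2) *
        Complex.Gamma (ρ / 2 + (Complex.I * 1 * κ + Complex.I * -1 * ν + Complex.I * -1 * l) / 2))) *
      ((Complex.Gamma (ρ / 2 + (Complex.I * -1 * κ + Complex.I * 1 * ν + Complex.I * 1 * l) / 2) *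
        Complex.Gamma (ρ / 2 + (Complex.I * -1 * κ + Complex.I * 1 * ν + Complex.I * -1 * l) / 2)) *
      (Complex.Gamma (ρ / 2 + (Complex.I * -1 * κ + Complex.I * -1 * ν + Complex.I * 1 * l) / 2) *
        Complex.Gamma (ρ / 2 +
          (Complex.I * -1 * κ + Complex.I * -1 * ν + Complex.I * -1 * l) / 2))) := by
    simp only [gammaPair]
    push_cast
    ring_nf
  rw [← hprod]
  have hpair : ∀ x : ℝ, Complex.Gamma (ρ + Complex.I * 1 * x) *
      Complex.Gamma (ρ + Complex.I * -1 * x) = gammaPair ρ x := fun x => by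
    rw [gammaPair]
    ring_nf
  rw [hpair, hpair, hpair]
  have hk : gammaPair ρ κ = Complex.Gamma (ρ + Complex.I * κ) * Complex.Gamma (ρ - Complex.I * κ) :=
    rfl
  have k1 : Complex.Gamma (ρ + Complex.I * κ) ≠ 0 := Complex.Gamma_ne_zero_of_re_pos (by simpa)
  have k2 : Complex.Gamma (ρ - Complex.I * κ) ≠ 0 := Complex.Gamma_ne_zero_of_re_pos (by simpa)
  -- Powers of `2` and `π` are written as exponentials of `log 2` and `log π`, which makes comparing
  -- the constants a linear identity between exponents (`hexp`).
  have hpi : ((√(2 * Real.pi) : ℝ) : ℂ) = Complex.exp (Real.log 2 / 2 + Real.log Real.pi / 2) := by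
    rw [Real.sqrt_eq_rpow, Complex.ofReal_cpow (by positivity), cpow_ofReal_eq_exp (by positivity),
      Real.log_mul two_ne_zero Real.pi_pos.ne']
    push_cast
    ring_nf
  have hpi4 : (4 * (Real.pi : ℂ)) ^ (3 / 2 : ℂ) =
      Complex.exp (3 * Real.log 2 + 3 / 2 * Real.log Real.pi) := by
    rw [show 4 * (Real.pi : ℂ) = ((2 ^ 2 * Real.pi : ℝ) : ℂ) by push_cast; ring,
      cpow_ofReal_eq_exp (by positivity), Real.log_mul (by norm_num) Real.pi_pos.ne', Real.log_pow]
    push_cast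
    ring_nf
  have h2 : ∀ s : ℂ, (2 : ℂ) ^ s = Complex.exp (Real.log 2 * s) := fun s => by
    rw [← Complex.ofReal_ofNat, cpow_ofReal_eq_exp two_pos]
  rw [hpi, hpi4, hk]
  rw [hk] at g1
  simp only [h2] at h ⊢
  rw [← Complex.exp_nat_mul]
  set E := ∫ z in Ioi (1 : ℝ), mehlerIntegral ρ κ z * (conicalIntegral ρ ν z * conicalIntegral ρ l z)
  have hE : E = Complex.exp (Real.log 2 * (ρ + Complex.I * κ - 1)) *
      Complex.exp (Real.log 2 * (ρ - Complex.I * κ - 1)) *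
      (gammaPair ((ρ + Complex.I * κ) / 2) ((ν - l) / 2) *
      gammaPair ((ρ + Complex.I * κ) / 2) ((ν + l) / 2) *
      (gammaPair ((ρ - Complex.I * κ) / 2) ((ν - l) / 2) *
      gammaPair ((ρ - Complex.I * κ) / 2) ((ν + l) / 2))) /
      (Complex.Gamma (ρ + Complex.I * κ) * Complex.Gamma (ρ - Complex.I * κ) *
        (Complex.exp (Real.log 2 * (ρ - 1)) * Complex.Gamma ρ ^ 2)) := by
    rw [eq_div_iff (mul_ne_zero g1 (mul_ne_zero (Complex.exp_ne_zero _) (pow_ne_zero 2 g0))),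
      mul_left_comm E, mul_comm E, h]
    field_simp
  rw [hE, ← Complex.exp_add]
  have hexp : Complex.exp (Real.log 2 * (ρ + Complex.I * κ - 1) +
      Real.log 2 * (ρ - Complex.I * κ - 1)) *
      Complex.exp (3 * Real.log 2 + 3 / 2 * Real.log Real.pi) =
      Complex.exp (Real.log 2 * (ρ + 1 / 2)) * (Complex.exp (Real.log 2 * (ρ - 1)) *
      Complex.exp ((3 : ℕ) * (Real.log 2 / 2 + Real.log Real.pi / 2))) := by
    rw [← Complex.exp_add, ← Complex.exp_add, ← Complex.exp_add]
    congr 1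
    push_cast
    ring
  have n1 := Complex.exp_ne_zero (3 * Real.log 2 + 3 / 2 * Real.log Real.pi)
  have n2 := Complex.exp_ne_zero (Real.log 2 * (ρ - 1))
  have n3 := Complex.exp_ne_zero ((3 : ℕ) * (Real.log 2 / 2 + Real.log Real.pi / 2))
  generalize Complex.exp (Real.log 2 * (ρ + Complex.I * κ - 1) +
      Real.log 2 * (ρ - Complex.I * κ - 1)) = e1 at *
  generalize Complex.exp (3 * Real.log 2 + 3 / 2 * Real.log Real.pi) = e2 at *
  generalize Complex.exp (Real.log 2 * (ρ - 1)) = e3 at *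
  generalize Complex.exp ((3 : ℕ) * (Real.log 2 / 2 + Real.log Real.pi / 2)) = e4 at *
  generalize Complex.exp (Real.log 2 * (ρ + 1 / 2)) = e5 at *
  generalize gammaPair ((ρ + Complex.I * κ) / 2) ((ν - l) / 2) *
      gammaPair ((ρ + Complex.I * κ) / 2) ((ν + l) / 2) *
      (gammaPair ((ρ - Complex.I * κ) / 2) ((ν - l) / 2) *
      gammaPair ((ρ - Complex.I * κ) / 2) ((ν + l) / 2)) = G at *
  generalize Complex.Gamma (ρ + Complex.I * κ) = k at *
  generalize Complex.Gamma (ρ - Complex.I * κ) = k' at *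
  generalize gammaPair ρ ν = p at *
  generalize gammaPair ρ l = q at *
  generalize Complex.Gamma ρ = g at *
  field_simp
  linear_combination G * hexp

end TripleProduct

/-! ### Sequences with consecutive ratios `1 + O(n⁻²)`. -/

section SlowlyVaryingSequences

/-- By `1 + x ≤ e^x` and `K/(n(n+1)) = K/n - K/(n+1)`, the product of the ratios telescopes; the
induction carries the sharper factor `e^{K/N - K/n}`. -/
theorem le_mul_exp_of_succ_le {v : ℕ → ℝ} {N : ℕ} {K : ℝ} (hN : 1 ≤ N) (hK : 0 ≤ K)
    (hv : ∀ n, 0 ≤ v n)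
    (h : ∀ n, N ≤ n → v (n + 1) ≤ (1 + K / (n * (n + 1))) * v n) {n : ℕ} (hn : N ≤ n) :
    v n ≤ Real.exp (K / N) * v N := by
  have key : v n ≤ Real.exp (K / N - K / n) * v N := by
    induction n, hn using Nat.le_induction with
    | base => simp
    | succ n hn ih =>
      have hn0 : (0 : ℝ) < n := by exact_mod_cast (by omega : 0 < n)
      have h1 : 1 + K / (n * (n + 1)) ≤ Real.exp (K / n - K / ((n + 1 : ℕ) : ℝ)) := by
        refine le_trans (le_of_eq ?_) (Real.add_one_le_exp _)
        push_cast
        field_simp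
        ring
      calc v (n + 1) ≤ (1 + K / (n * (n + 1))) * v n := h n hn
        _ ≤ Real.exp (K / n - K / ((n + 1 : ℕ) : ℝ)) * (Real.exp (K / N - K / n) * v N) :=
          mul_le_mul h1 ih (hv n) (Real.exp_pos _).le
        _ = _ := by
          rw [← mul_assoc, ← Real.exp_add]
          congr 2
          ring
  refine key.trans (mul_le_mul_of_nonneg_right (Real.exp_le_exp.2 ?_) (hv N))
  have : 0 ≤ K / (n : ℝ) := by positivity
  linarith

/-- A sequence whose consecutive ratios are `1 + O(n⁻²)` has a nonzero limit, which is approached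
at the rate `O(n⁻¹)`. -/
theorem exists_ne_zero_norm_sub_le {u : ℕ → ℂ} {N : ℕ} {K : ℝ} (hN : 1 ≤ N) (hK : 0 ≤ K)
    (hu : u N ≠ 0) (h : ∀ n, N ≤ n → ‖u (n + 1) - u n‖ ≤ K / (n * (n + 1)) * ‖u n‖)
    (hKN : 2 * K ≤ N) : ∃ q : ℂ, q ≠ 0 ∧ ∃ C : ℝ, ∀ n, N ≤ n → ‖u n - q‖ ≤ C / n := by
  have hpos : ∀ n, N ≤ n → (0 : ℝ) < n := fun n hn => by exact_mod_cast (by omega : 0 < n)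
  have hup : ∀ n, N ≤ n → ‖u n‖ ≤ Real.exp (K / N) * ‖u N‖ := fun n hn =>
    le_mul_exp_of_succ_le (v := fun n => ‖u n‖) hN hK (fun n => norm_nonneg _) (fun m hm => by
      have := norm_le_norm_add_norm_sub' (u (m + 1)) (u m)
      have := h m hm
      nlinarith) hn
  have hδ : ∀ n, N ≤ n → K / (n * (n + 1)) ≤ 1 / 2 := fun n hn => by
    have hn0 := hpos n hn
    have hnN : (N : ℝ) ≤ n := by exact_mod_cast hn
    rw [div_le_div_iff₀ (by positivity) two_pos]
    nlinarith
  have hune : ∀ n, N ≤ n → u n ≠ 0 := fun n hn => by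
    induction n, hn using Nat.le_induction with
    | base => exact hu
    | succ n hn ih =>
      intro h0
      have h1 := h n hn
      rw [h0, zero_sub, norm_neg] at h1
      have h2 := norm_pos_iff.2 ih
      have := hδ n hn
      nlinarith
  -- The reciprocals satisfy the same growth bound with `2K`, because `1/(1 - δ) ≤ 1 + 2δ` for `0 ≤
  -- δ ≤ 1/2`. This keeps the limit away from zero.
  have hdn : ∀ n, N ≤ n → ‖u n‖⁻¹ ≤ Real.exp (2 * K / N) * ‖u N‖⁻¹ := fun n hn =>
    le_mul_exp_of_succ_le (v := fun n => ‖u n‖⁻¹) hN (by positivity)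
      (fun n => inv_nonneg.2 (norm_nonneg _)) (fun m hm => by
      have h1 := norm_pos_iff.2 (hune m hm)
      have h2 := norm_pos_iff.2 (hune (m + 1) (by omega))
      have h3 := norm_sub_norm_le (u m) (u (m + 1))
      rw [norm_sub_rev] at h3
      have h4 := h m hm
      have h5 := hδ m hm
      have hm0 := hpos m hm
      rw [← div_eq_mul_inv, inv_eq_one_div, div_le_div_iff₀ h2 h1, one_mul, mul_div_assoc]
      have h6 : 0 ≤ K / (m * (m + 1)) := by positivity
      generalize K / ((m : ℝ) * (m + 1)) = δ at *
      have h7 : (1 - δ) * ‖u m‖ ≤ ‖u (m + 1)‖ := by linarith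
      have h8 : (1 + 2 * δ) * ((1 - δ) * ‖u m‖) ≤ (1 + 2 * δ) * ‖u (m + 1)‖ :=
        mul_le_mul_of_nonneg_left h7 (by positivity)
      have h9 : 0 ≤ δ * (1 - 2 * δ) * ‖u m‖ :=
        mul_nonneg (mul_nonneg h6 (by linarith)) h1.le
      nlinarith) hn
  set C := K * (Real.exp (K / N) * ‖u N‖) with hC
  have hC0 : 0 ≤ C := by positivity
  have htel : ∀ n, N ≤ n → ∀ m, n ≤ m → ‖u m - u n‖ ≤ C / n - C / m := fun n hn m hm => by
    induction m, hm using Nat.le_induction with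
    | base => simp
    | succ m hm ih =>
      have hm0 := hpos m (hn.trans hm)
      have h1 := norm_sub_le_norm_sub_add_norm_sub (u (m + 1)) (u m) (u n)
      have h2 : ‖u (m + 1) - u m‖ ≤ C / m - C / ((m + 1 : ℕ) : ℝ) := by
        refine (h m (hn.trans hm)).trans ?_
        refine (mul_le_mul_of_nonneg_left (hup m (hn.trans hm)) (by positivity)).trans_eq ?_
        rw [hC]
        push_cast
        field_simp
        ring
      linarith
  have hcauchy : CauchySeq fun n => u (n + N) := by
    refine cauchySeq_of_le_tendsto_0 (fun n : ℕ => 2 * (C / ((n + N : ℕ) : ℝ))) ?_ ?_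
    · intro n m k hn hm
      rw [dist_eq_norm]
      have h1 := htel (k + N) (by omega) (n + N) (by omega)
      have h2 := htel (k + N) (by omega) (m + N) (by omega)
      have h3 : 0 ≤ C / ((n + N : ℕ) : ℝ) := by positivity
      have h4 : 0 ≤ C / ((m + N : ℕ) : ℝ) := by positivity
      have h5 := norm_sub_le_norm_sub_add_norm_sub (u (n + N)) (u (k + N)) (u (m + N))
      rw [norm_sub_rev (u (k + N))] at h5
      linarith
    · have : Tendsto (fun n : ℕ => ((n + N : ℕ) : ℝ)) atTop atTop :=
        tendsto_natCast_atTop_atTop.comp (tendsto_add_atTop_nat N)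
      simpa using (tendsto_const_nhds.div_atTop this).const_mul 2
  obtain ⟨q, hq⟩ := cauchySeq_tendsto_of_complete hcauchy
  have hq' : Tendsto u atTop (𝓝 q) := (tendsto_add_atTop_iff_nat N).1 hq
  refine ⟨q, ?_, C, fun n hn => ?_⟩
  · have hb : Real.exp (2 * K / N) * ‖u N‖⁻¹ > 0 := by
      have := norm_pos_iff.2 hu
      positivity
    have hlow : (Real.exp (2 * K / N) * ‖u N‖⁻¹)⁻¹ ≤ ‖q‖ := by
      refine ge_of_tendsto hq'.norm ((eventually_ge_atTop N).mono fun n hn => ?_)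
      rw [inv_le_comm₀ hb (norm_pos_iff.2 (hune n hn))]
      exact hdn n hn
    exact norm_pos_iff.1 (lt_of_lt_of_le (inv_pos.2 hb) hlow)
  · have h1 : Tendsto (fun m => ‖u m - u n‖) atTop (𝓝 ‖q - u n‖) := (hq'.sub_const _).norm
    rw [norm_sub_rev]
    refine le_of_tendsto h1 ((eventually_ge_atTop n).mono fun m hm => ?_)
    have h3 : 0 ≤ C / (m : ℝ) := by positivity
    exact (htel n hn m hm).trans (by linarith)

end SlowlyVaryingSequences

/-! ### Hypergeometric coefficients when `c - a - b` is imaginary. -/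

section HypergeometricAtOne

/-- For imaginary `s` the norm is `√(n² + |s|²)`, which differs from `n` by `O(1/n)`; hence the
norms `n ‖e n‖` of the comparison sequence have ratios `1 + O(n⁻²)`. -/
theorem norm_natCast_sub_le {s : ℂ} (hs : s.re = 0) {n : ℕ} (hn : 1 ≤ n) :
    ‖(n : ℂ) - s‖ ≤ n + ‖s‖ ^ 2 / (n + 1) := by
  have hn1 : (1 : ℝ) ≤ n := by exact_mod_cast hn
  refine abs_le_of_sq_le_sq' ?_ (by positivity) |>.2
  rw [Complex.sq_norm, Complex.sq_norm, Complex.normSq_apply, Complex.normSq_apply]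
  simp only [Complex.sub_re, Complex.sub_im, Complex.natCast_re, Complex.natCast_im, hs]
  have h1 : s.im * s.im ≤ 2 * (n * (s.im * s.im / (n + 1))) := by
    rw [← mul_div_assoc, ← mul_div_assoc, le_div_iff₀ (by positivity)]
    nlinarith [mul_self_nonneg s.im]
  have h2 : 0 ≤ (s.im * s.im / ((n : ℝ) + 1)) ^ 2 := sq_nonneg _
  simp only [mul_zero, zero_add, sub_zero, zero_sub, neg_mul_neg]
  nlinarith

/-- Comparison of hypergeometric coefficients with a sequence whose ratios have the same expansion
up to `O(n⁻²)`. -/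
theorem exists_summable_hgf_coeff_sub {a b c s : ℂ} (hs : s.re = 0) (habc : a + b = c - s)
    (ha : ∀ n : ℕ, (ascPochhammer ℂ n).eval a ≠ 0) (hb : ∀ n : ℕ, (ascPochhammer ℂ n).eval b ≠ 0)
    {e : ℕ → ℂ} (he1 : e 1 ≠ 0) (he : ∀ n, 1 ≤ n → e (n + 1) = e n * (n - s) / (n + 1)) :
    ∃ q : ℂ, q ≠ 0 ∧ Summable fun n : ℕ => ‖(ascPochhammer ℂ n).eval a *
      (ascPochhammer ℂ n).eval b / ((n.factorial : ℂ) * Complex.Gamma (c + n)) - q * e n‖ := by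
  set f : ℕ → ℂ := fun n => (ascPochhammer ℂ n).eval a * (ascPochhammer ℂ n).eval b /
    ((n.factorial : ℂ) * Complex.Gamma (c + n)) with hf
  have hns : ∀ n : ℕ, 1 ≤ n → (n : ℝ) ≤ ‖(n : ℂ) - s‖ := fun n _ => by
    have := Complex.re_le_norm ((n : ℂ) - s)
    simpa [hs] using this
  have hns0 : ∀ n : ℕ, 1 ≤ n → (n : ℂ) - s ≠ 0 := fun n hn => by
    have : (1 : ℝ) ≤ n := by exact_mod_cast hn
    exact norm_pos_iff.1 (by linarith [hns n hn])
  have hene : ∀ n, 1 ≤ n → e n ≠ 0 := fun n hn => by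
    induction n, hn using Nat.le_induction with
    | base => exact he1
    | succ n hn ih =>
      rw [he n hn]
      exact div_ne_zero (mul_ne_zero ih (hns0 n hn)) (by exact_mod_cast n.succ_ne_zero)
  have hebd : ∀ n, 1 ≤ n → ‖e n‖ ≤ Real.exp (‖s‖ ^ 2) * ‖e 1‖ / n := fun n hn => by
    have hn0 : (0 : ℝ) < n := by exact_mod_cast hn
    rw [le_div_iff₀ hn0]
    have := le_mul_exp_of_succ_le (v := fun n : ℕ => ‖e n‖ * n) (N := 1) (K := ‖s‖ ^ 2) le_rfl
      (by positivity) (fun n => by positivity) (fun m hm => by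
        have hm0 : (0 : ℝ) < m := by exact_mod_cast hm
        have h1 := norm_natCast_sub_le hs hm
        have h2 : ‖(m : ℂ) + 1‖ = m + 1 := by
          rw [← Nat.cast_succ, Complex.norm_natCast, Nat.cast_succ]
        rw [he m hm, norm_div, norm_mul, h2]
        push_cast
        rw [div_mul_cancel₀ _ (by positivity)]
        calc ‖e m‖ * ‖(m : ℂ) - s‖ ≤ ‖e m‖ * (m + ‖s‖ ^ 2 / (m + 1)) := by gcongr
          _ = _ := by field_simp) hn
    simpa using this
  -- Beyond this `N` one has `‖c + n‖ ≥ n/2`. The ratio bound then holds with `K = 4 ‖a b + c s‖`,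
  -- since `2/n² ≤ 4/(n(n+1))`, and `2K ≤ N` as required for the limit.
  obtain ⟨N, hN⟩ := exists_nat_ge (2 * ‖c‖ + 2 * (4 * ‖a * b + c * s‖) + 1)
  have hK0 : 0 ≤ 4 * ‖a * b + c * s‖ := by positivity
  have hc0 : 0 ≤ ‖c‖ := norm_nonneg _
  have hN1 : 1 ≤ N := by
    have : (1 : ℝ) ≤ N := by linarith
    exact_mod_cast this
  have hcn : ∀ n : ℕ, N ≤ n → (n : ℝ) / 2 ≤ ‖c + n‖ := fun n hn => by
    have h1 : (N : ℝ) ≤ n := by exact_mod_cast hn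
    have h2 := norm_sub_le_norm_add (n : ℂ) c
    rw [Complex.norm_natCast, add_comm (n : ℂ)] at h2
    linarith
  have hcn0 : ∀ n : ℕ, N ≤ n → c + n ≠ 0 := fun n hn => by
    have : (1 : ℝ) ≤ n := by exact_mod_cast hN1.trans hn
    exact norm_pos_iff.1 (by linarith [hcn n hn])
  have hG : ∀ n : ℕ, N ≤ n → Complex.Gamma (c + n) ≠ 0 := fun n hn => by
    refine Complex.Gamma_ne_zero fun m hm => ?_
    have := hcn0 (n + m) (by omega)
    push_cast at this
    exact this (by rw [← add_assoc, hm]; ring)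
  have hfac : ∀ n : ℕ, (n.factorial : ℂ) ≠ 0 := fun n => by exact_mod_cast n.factorial_ne_zero
  -- The relation `a + b = c - s` makes `(a + n)(b + n) - (c + n)(n - s)` the constant `a b + c s`.
  have hratio : ∀ n : ℕ, N ≤ n → f (n + 1) / e (n + 1) - f n / e n =
      (a * b + c * s) / ((c + n) * (n - s)) * (f n / e n) := fun n hn => by
    have hn1 := hN1.trans hn
    have e1 := hene n hn1
    have e2 := hns0 n hn1
    have e3 := hcn0 n hn
    have e4 := hG n hn
    have e5 : ((n : ℂ) + 1) ≠ 0 := by exact_mod_cast n.succ_ne_zero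
    have e6 := hfac n
    have hGs : Complex.Gamma (c + ((n + 1 : ℕ) : ℂ)) = (c + n) * Complex.Gamma (c + n) := by
      rw [← Complex.Gamma_add_one _ e3]
      push_cast
      ring_nf
    simp only [hf]
    rw [hGs, he n hn1, ascPochhammer_succ_eval, ascPochhammer_succ_eval, Nat.factorial_succ]
    push_cast
    field_simp
    have hc : c = a + b + s := by rw [habc]; ring
    rw [hc]
    ring
  obtain ⟨q, hq, C, hC⟩ := exists_ne_zero_norm_sub_le (u := fun n => f n / e n) hN1 hK0
    (div_ne_zero (div_ne_zero (mul_ne_zero (ha N) (hb N)) (mul_ne_zero (hfac N) (hG N le_rfl)))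
      (hene N hN1)) (fun n hn => by
      have hn1 : (1 : ℝ) ≤ n := by exact_mod_cast hN1.trans hn
      have h1 := hcn n hn
      have h2 := hns n (hN1.trans hn)
      rw [hratio n hn, norm_mul]
      refine mul_le_mul_of_nonneg_right ?_ (norm_nonneg _)
      have p : 0 < ‖c + n‖ * ‖(n : ℂ) - s‖ := mul_pos (by linarith) (by linarith)
      rw [norm_div, norm_mul, div_le_div_iff₀ p (by positivity)]
      have h3 : (n : ℝ) / 2 * n ≤ ‖c + n‖ * ‖(n : ℂ) - s‖ := by gcongr
      have h4 : (n : ℝ) * (n + 1) ≤ 4 * (‖c + n‖ * ‖(n : ℂ) - s‖) := by nlinarith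
      nlinarith [norm_nonneg (a * b + c * s)]) (by linarith)
  refine ⟨q, hq, ?_⟩
  -- `e n = O(1/n)` and `f n / e n - q = O(1/n)`, so the difference is `O(n⁻²)`.
  refine Summable.of_norm_bounded_eventually_nat (g := fun n : ℕ =>
    Real.exp (‖s‖ ^ 2) * ‖e 1‖ * C * (1 / (n : ℝ) ^ 2))
    ((Real.summable_one_div_nat_pow.2 one_lt_two).mul_left _) ?_
  filter_upwards [eventually_ge_atTop N] with n hn
  have hn1 := hN1.trans hn
  have hn0 : (0 : ℝ) < n := by exact_mod_cast hn1
  have h1 : f n - q * e n = e n * (f n / e n - q) := by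
    have := hene n hn1
    field_simp
  rw [norm_norm, h1, norm_mul]
  calc ‖e n‖ * ‖f n / e n - q‖ ≤ (Real.exp (‖s‖ ^ 2) * ‖e 1‖ / n) * (C / n) :=
        mul_le_mul (hebd n hn1) (hC n hn) (norm_nonneg _) (by positivity)
    _ = _ := by field_simp

/-- The Chu–Vandermonde summation in regularized form. -/
theorem sum_neg_one_pow_mul_choose_mul_ascPochhammer (m : ℕ) (a c : ℂ) :
    ∑ n ∈ Finset.range (m + 1), (-1) ^ n * (m.choose n : ℂ) *
      ((ascPochhammer ℂ n).eval a / Complex.Gamma (c + n)) =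
      (ascPochhammer ℂ m).eval (c - a) / Complex.Gamma (c + m) := by
  induction m generalizing a c with
  | zero => simp
  | succ m ih =>
    have h1 : ∀ n : ℕ, (ascPochhammer ℂ (n + 1)).eval a / Complex.Gamma (c + (n + 1 : ℕ)) =
        a * ((ascPochhammer ℂ n).eval (a + 1) / Complex.Gamma (c + 1 + n)) := fun n => by
      rw [ascPochhammer_succ_left]
      simp only [Polynomial.eval_mul, Polynomial.eval_X, Polynomial.eval_comp, Polynomial.eval_add,
        Polynomial.eval_one]
      push_cast
      ring_nf
    -- Pascal's rule splits the sum into the cases `(a, c)` and `(a + 1, c + 1)` of the induction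
    -- hypothesis.
    have h2 : ∑ n ∈ Finset.range (m + 1 + 1), (-1) ^ n * ((m + 1).choose n : ℂ) *
        ((ascPochhammer ℂ n).eval a / Complex.Gamma (c + n)) =
        ∑ n ∈ Finset.range (m + 1), (-1) ^ n * (m.choose n : ℂ) *
          ((ascPochhammer ℂ n).eval a / Complex.Gamma (c + n)) -
        a * ∑ n ∈ Finset.range (m + 1), (-1) ^ n * (m.choose n : ℂ) *
          ((ascPochhammer ℂ n).eval (a + 1) / Complex.Gamma (c + 1 + n)) := by
      have h3 : ∑ n ∈ Finset.range (m + 1), (-1) ^ n * (m.choose n : ℂ) *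
          ((ascPochhammer ℂ n).eval a / Complex.Gamma (c + n)) =
          ∑ n ∈ Finset.range (m + 1 + 1), (-1) ^ n * (m.choose n : ℂ) *
          ((ascPochhammer ℂ n).eval a / Complex.Gamma (c + n)) := by
        rw [Finset.sum_range_succ _ (m + 1), Nat.choose_succ_self]
        simp
      rw [h3, Finset.sum_range_succ', Finset.sum_range_succ' _ (m + 1), Finset.mul_sum,
        add_sub_right_comm, ← Finset.sum_sub_distrib]
      congr 1
      · refine Finset.sum_congr rfl fun n _ => ?_
        rw [h1, Nat.choose_succ_succ]
        push_cast
        ring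
      · simp
    rw [h2, ih, ih, ascPochhammer_succ_eval, show c + 1 - (a + 1) = c - a by ring,
      show c + 1 + (m : ℂ) = c + m + 1 by ring,
      show c + ((m + 1 : ℕ) : ℂ) = c + m + 1 by push_cast; ring, div_eq_mul_one_div _ (Complex.Gamma
      (c + m)), one_div, Complex.one_div_Gamma_eq_self_mul_one_div_Gamma_add_one]
    ring

end HypergeometricAtOne

/-! ### The hypergeometric function at `1 - e^{-τ}` as `τ → ∞`. -/

section BehaviourAtOne

theorem tendsto_one_sub_exp_neg_atTop :
    Tendsto (fun τ : ℝ => ((1 - Real.exp (-τ) : ℝ) : ℂ)) atTop (𝓝 1) := by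
  have h : Tendsto (fun τ : ℝ => 1 - Real.exp (-τ)) atTop (𝓝 (1 - 0)) :=
    tendsto_const_nhds.sub (Real.tendsto_exp_neg_atTop_nhds_zero)
  rw [sub_zero] at h
  exact_mod_cast (Complex.continuous_ofReal.tendsto 1).comp h

theorem norm_one_sub_exp_neg_lt_one {τ : ℝ} (hτ : 0 < τ) :
    ‖((1 - Real.exp (-τ) : ℝ) : ℂ)‖ < 1 := by
  have h1 : Real.exp (-τ) < 1 := by simpa using hτ
  have h2 := Real.exp_pos (-τ)
  rw [Complex.norm_real, Real.norm_eq_abs, abs_lt]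
  constructor <;> linarith

/-- The limit at `1` of a power series with absolutely summable coefficients. -/
theorem tendsto_tsum_mul_pow_one_sub_exp_neg {f : ℕ → ℂ} (hf : Summable fun n => ‖f n‖) :
    Tendsto (fun τ : ℝ => ∑' n, f n * ((1 - Real.exp (-τ) : ℝ) : ℂ) ^ n) atTop
      (𝓝 (∑' n, f n)) := by
  refine tendsto_tsum_of_dominated_convergence hf (fun n => ?_) ?_
  · simpa using (tendsto_one_sub_exp_neg_atTop.pow n).const_mul (f n)
  · filter_upwards [eventually_gt_atTop 0] with τ hτ n
    rw [norm_mul, norm_pow]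
    exact mul_le_of_le_one_right (norm_nonneg _)
      (pow_le_one₀ (norm_nonneg _) (norm_one_sub_exp_neg_lt_one hτ).le)

theorem eventually_norm_sub_le_of_tendsto {g : ℝ → ℂ} {r : ℝ → ℂ}
    (h : Tendsto (fun τ => g τ - r τ) atTop (𝓝 0)) {δ : ℝ} (hδ : 0 < δ) :
    ∀ᶠ τ in atTop, ‖r τ‖ - δ ≤ ‖g τ‖ := by
  filter_upwards [(Metric.tendsto_nhds.1 h) δ hδ] with τ hτ
  rw [dist_zero_right] at hτ
  have := norm_sub_norm_le (r τ) (g τ)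
  rw [norm_sub_rev] at this
  linarith

theorem ascPochhammer_eval_ne_zero {a : ℂ} (h : ∀ k : ℕ, a ≠ -k) (n : ℕ) :
    (ascPochhammer ℂ n).eval a ≠ 0 := by
  intro h0
  obtain ⟨k, -, hk⟩ := (ascPochhammer_eval_eq_zero_iff n a).1 h0
  exact h k (by rw [hk]; ring)

theorem ascPochhammer_eval_neg_natCast_div_factorial (m n : ℕ) :
    (ascPochhammer ℂ n).eval (-(m : ℂ)) / (n.factorial : ℂ) = (-1) ^ n * (m.choose n : ℂ) := by
  rw [ascPochhammer_eval_neg_eq_descPochhammer, descPochhammer_eval_eq_descFactorial,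
    Nat.descFactorial_eq_factorial_mul_choose]
  have : (n.factorial : ℂ) ≠ 0 := by exact_mod_cast n.factorial_ne_zero
  push_cast
  field_simp

theorem tendsto_regularizedGaussHGFun_neg_natCast (a c : ℂ) (m : ℕ) :
    Tendsto (fun τ : ℝ => Complex.regularizedGaussHGFun a (-(m : ℂ)) c
      ((1 - Real.exp (-τ) : ℝ) : ℂ)) atTop
      (𝓝 ((ascPochhammer ℂ m).eval (c - a) / Complex.Gamma (c + m))) := by
  set f : ℕ → ℂ := fun n => (-1) ^ n * (m.choose n : ℂ) *
    ((ascPochhammer ℂ n).eval a / Complex.Gamma (c + n)) with hf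
  have hf0 : ∀ n, n ∉ Finset.range (m + 1) → f n = 0 := fun n hn => by
    have : m.choose n = 0 := Nat.choose_eq_zero_of_lt (by simpa using hn)
    simp [hf, this]
  have h := tendsto_tsum_mul_pow_one_sub_exp_neg (f := f)
    (summable_of_ne_finset_zero (s := Finset.range (m + 1)) fun n hn => by simp [hf0 n hn])
  rw [tsum_eq_sum (s := Finset.range (m + 1)) hf0,
    sum_neg_one_pow_mul_choose_mul_ascPochhammer] at h
  refine h.congr' ?_
  filter_upwards [eventually_gt_atTop 0] with τ hτ
  refine ((hasSum_regularizedGaussHGFun a (-(m : ℂ)) c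
    (norm_one_sub_exp_neg_lt_one hτ)).of_forall_eq fun n => ?_).tsum_eq
  simp only [hf]
  rw [← ascPochhammer_eval_neg_natCast_div_factorial]
  ring

/-- The difference of a hypergeometric function and a comparison series converges at `1`. -/
theorem exists_tendsto_regularizedGaussHGFun_sub {a b c s : ℂ} (hs : s.re = 0)
    (habc : a + b = c - s) (ha : ∀ k : ℕ, a ≠ -k) (hb : ∀ k : ℕ, b ≠ -k) {e : ℕ → ℂ} {E : ℂ → ℂ}
    (he1 : e 1 ≠ 0) (he : ∀ n, 1 ≤ n → e (n + 1) = e n * (n - s) / (n + 1))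
    (hE : ∀ x : ℂ, ‖x‖ < 1 → HasSum (fun n => e n * x ^ n) (E x)) :
    ∃ q A : ℂ, q ≠ 0 ∧ Tendsto (fun τ : ℝ =>
      Complex.regularizedGaussHGFun a b c ((1 - Real.exp (-τ) : ℝ) : ℂ) -
        q * E ((1 - Real.exp (-τ) : ℝ) : ℂ)) atTop (𝓝 A) := by
  obtain ⟨q, hq, hsum⟩ := exists_summable_hgf_coeff_sub hs habc (ascPochhammer_eval_ne_zero ha)
    (ascPochhammer_eval_ne_zero hb) he1 he
  refine ⟨q, _, hq, (tendsto_tsum_mul_pow_one_sub_exp_neg hsum).congr' ?_⟩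
  filter_upwards [eventually_gt_atTop 0] with τ hτ
  have hx := norm_one_sub_exp_neg_lt_one hτ
  refine (((hasSum_regularizedGaussHGFun a b c hx).sub
    ((hE _ hx).mul_left q)).of_forall_eq fun n => ?_).tsum_eq
  ring

/-- At `1` the hypergeometric function of a Legendre function of order `1/2 - ρ` and degree
`-1/2 + iκ` is bounded from below by an oscillating term that does not vanish identically. -/
theorem exists_norm_le_norm_regularizedGaussHGFun (ρ : ℂ) (κ : ℝ) :
    ∃ A B : ℂ, ∃ ω : ℝ, ((A ≠ 0 ∧ B = 0) ∨ (B ≠ 0 ∧ ω ≠ 0)) ∧ ∀ δ : ℝ, 0 < δ →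
      ∀ᶠ τ : ℝ in atTop, ‖A + B * Complex.exp (Complex.I * ω * τ)‖ - δ ≤
        ‖Complex.regularizedGaussHGFun (1 / 2 - Complex.I * κ) (ρ - Complex.I * κ) (ρ + 1 / 2)
          ((1 - Real.exp (-τ) : ℝ) : ℂ)‖ := by
  have ha : ∀ k : ℕ, (1 / 2 - Complex.I * κ : ℂ) ≠ -k := fun k h => by
    have h1 := congrArg Complex.re h
    simp at h1
    have : (0 : ℝ) ≤ k := k.cast_nonneg
    linarith
  -- If the series terminates, Chu–Vandermonde gives the limit `(ρ + iκ)_m / Γ(ρ + 1/2 + m)`. It is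
  -- finite and nonzero because `re ρ = -m`.
  by_cases hb : ∃ m : ℕ, ρ - Complex.I * κ = -m
  · obtain ⟨m, hm⟩ := hb
    have h := tendsto_regularizedGaussHGFun_neg_natCast (1 / 2 - Complex.I * κ) (ρ + 1 / 2) m
    rw [← hm] at h
    refine ⟨(ascPochhammer ℂ m).eval (ρ + 1 / 2 - (1 / 2 - Complex.I * κ)) /
      Complex.Gamma (ρ + 1 / 2 + m), 0, 0, Or.inl ⟨div_ne_zero ?_ ?_, rfl⟩, fun δ hδ => ?_⟩
    · intro h0
      obtain ⟨k, hk, hk'⟩ := (ascPochhammer_eval_eq_zero_iff m _).1 h0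
      have hr := congrArg Complex.re hk'
      have hr' := congrArg Complex.re hm
      simp at hr hr'
      have : (k : ℝ) < m := by exact_mod_cast hk
      linarith
    · refine Complex.Gamma_ne_zero_of_re_pos ?_
      have hr' := congrArg Complex.re hm
      simp at hr' ⊢
      linarith
    · refine eventually_norm_sub_le_of_tendsto ?_ hδ
      simpa using h.sub_const ((ascPochhammer ℂ m).eval (ρ + 1 / 2 - (1 / 2 - Complex.I * κ)) /
        Complex.Gamma (ρ + 1 / 2 + m))
  · push Not at hb
    have hx : ∀ τ : ℝ, 1 - ((1 - Real.exp (-τ) : ℝ) : ℂ) = ((Real.exp (-τ) : ℝ) : ℂ) := fun τ => by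
      push_cast; ring
    by_cases hκ : κ = 0
    -- For `κ = 0` the comparison series is `-log (1 - x) = τ`, with `1 / 0 = 0` as its constant
    -- coefficient. The function grows linearly in `τ`, so the constant `1` serves as lower bound.
    · obtain ⟨q, A, hq, hA⟩ := exists_tendsto_regularizedGaussHGFun_sub (s := 0)
        (c := ρ + 1 / 2) (by simp) (by rw [hκ]; push_cast; ring) ha hb
        (e := fun n => (1 : ℂ) / n) (E := fun x => -Complex.log (1 - x)) (by simp)
        (fun n hn => by
          have : (n : ℂ) ≠ 0 := by exact_mod_cast (by omega : n ≠ 0)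
          push_cast
          field_simp
          ring) (fun x hx => (Complex.hasSum_taylorSeries_neg_log hx).of_forall_eq fun n => by ring)
      refine ⟨1, 0, 0, Or.inl ⟨one_ne_zero, rfl⟩, fun δ hδ => ?_⟩
      have hqn := norm_pos_iff.2 hq
      filter_upwards [(Metric.tendsto_nhds.1 hA) 1 one_pos, eventually_gt_atTop 0,
        eventually_ge_atTop ((‖A‖ + 2) / ‖q‖)] with τ h1 h2 h3
      rw [hx, ← Complex.ofReal_log (Real.exp_pos _).le, Real.log_exp] at h1
      set F := Complex.regularizedGaussHGFun (1 / 2 - Complex.I * κ) (ρ - Complex.I * κ)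
        (ρ + 1 / 2) ((1 - Real.exp (-τ) : ℝ) : ℂ)
      rw [dist_eq_norm] at h1
      have h4 : q * (τ : ℂ) = F - (F - q * -((-τ : ℝ) : ℂ) - A) - A := by push_cast; ring
      have h5 : ‖q‖ * τ ≤ ‖F‖ + 1 + ‖A‖ := by
        calc ‖q‖ * τ = ‖q * (τ : ℂ)‖ := by
              rw [norm_mul, Complex.norm_real, Real.norm_of_nonneg h2.le]
          _ ≤ ‖F‖ + ‖F - q * -((-τ : ℝ) : ℂ) - A‖ + ‖A‖ := by
              rw [h4]
              exact (norm_sub_le _ _).trans (add_le_add_left (norm_sub_le _ _) _)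
          _ ≤ _ := by linarith
      rw [div_le_iff₀ hqn] at h3
      simp only [zero_mul, add_zero, norm_one]
      nlinarith
    -- For `κ ≠ 0` the comparison function is `(1 - x)^(2iκ) = e^{-2iκτ}`, whence `ω = -2κ`.
    · obtain ⟨q, A, hq, hA⟩ := exists_tendsto_regularizedGaussHGFun_sub
        (s := 2 * Complex.I * κ) (c := ρ + 1 / 2) (by simp) (by ring) ha hb
        (e := fun n => (ascPochhammer ℂ n).eval (-(2 * Complex.I * κ)) / (n.factorial : ℂ))
        (E := fun x => (1 - x) ^ (-(-(2 * Complex.I * κ)))) (by simp [hκ])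
        (fun n hn => by
          have : (n.factorial : ℂ) ≠ 0 := by exact_mod_cast n.factorial_ne_zero
          have h1 : ((n : ℂ) + 1) ≠ 0 := by exact_mod_cast n.succ_ne_zero
          simp only [ascPochhammer_succ_eval, Nat.factorial_succ]
          push_cast
          field_simp
          ring) (fun x hx => hasSum_one_sub_cpow_neg _ hx)
      refine ⟨A, q, -2 * κ, Or.inr ⟨hq, by simpa using hκ⟩, fun δ hδ => ?_⟩
      refine eventually_norm_sub_le_of_tendsto ?_ hδ
      have h := hA.sub_const A
      rw [sub_self] at h
      refine h.congr fun τ => ?_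
      rw [hx, Complex.cpow_def_of_ne_zero (by exact_mod_cast (Real.exp_pos _).ne'),
        ← Complex.ofReal_log (Real.exp_pos _).le, Real.log_exp]
      have h1 : (((-τ : ℝ) : ℂ) * -(-(2 * Complex.I * κ))) =
          Complex.I * ((-2 * κ : ℝ) : ℂ) * τ := by
        push_cast; ring
      rw [h1]
      ring

end BehaviourAtOne

/-! ### Products of oscillating terms are not integrable. -/

section Oscillation

variable {ι : Type*} [Fintype ι]

/-- A nonconstant factor has nonzero derivative everywhere, hence no zero in some punctured
neighbourhood of `1/2`; finitely many such neighbourhoods meet. -/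
theorem exists_forall_affine_exp_ne_zero {A B z : ι → ℂ} {ω : ι → ℝ}
    (hAB : ∀ j, (A j ≠ 0 ∧ B j = 0) ∨ (B j ≠ 0 ∧ ω j ≠ 0)) (hz : ∀ j, z j ≠ 0) :
    ∃ s ∈ Icc (0 : ℝ) 1, ∀ j, A j + B j * z j * Complex.exp (Complex.I * ω j * s) ≠ 0 := by
  have h1 : ∀ j, ∀ᶠ s : ℝ in 𝓝[≠] (1 / 2 : ℝ),
      A j + B j * z j * Complex.exp (Complex.I * ω j * s) ≠ 0 := fun j => by
    rcases hAB j with h | h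
    · simp [h.1, h.2]
    · have hd : HasDerivAt (fun s : ℝ => A j + B j * z j * Complex.exp (Complex.I * ω j * s))
          (B j * z j * (Complex.exp (Complex.I * ω j * (1 / 2 : ℝ)) * (Complex.I * ω j * 1)))
          (1 / 2 : ℝ) :=
        ((((Complex.ofRealCLM.hasDerivAt).const_mul (Complex.I * ω j : ℂ)).cexp).const_mul
          (B j * z j)).const_add (A j)
      refine hd.eventually_ne (mul_ne_zero (mul_ne_zero h.1 (hz j))
        (mul_ne_zero (Complex.exp_ne_zero _) (mul_ne_zero (mul_ne_zero Complex.I_ne_zero ?_)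
          one_ne_zero)))
      exact_mod_cast h.2
  have h2 : ∀ᶠ s : ℝ in 𝓝[≠] (1 / 2 : ℝ), s ∈ Icc (0 : ℝ) 1 :=
    nhdsWithin_le_nhds (Icc_mem_nhds (by norm_num) (by norm_num))
  obtain ⟨s, hs1, hs2⟩ := (h2.and (eventually_all.2 h1)).exists
  exact ⟨s, hs1, hs2⟩

/-- The integral is continuous in `(δ, z)` and positive for `δ = 0` on the compact torus `|z_j| =
1`, so it stays positive on the torus for some `δ > 0` and attains a positive minimum. The phases
`z_j` make the bound uniform over all unit intervals. -/
theorem exists_pos_le_integral_prod_max {A B : ι → ℂ} {ω : ι → ℝ}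
    (hAB : ∀ j, (A j ≠ 0 ∧ B j = 0) ∨ (B j ≠ 0 ∧ ω j ≠ 0)) :
    ∃ δ : ℝ, 0 < δ ∧ ∃ m : ℝ, 0 < m ∧ ∀ z : ι → ℂ, (∀ j, ‖z j‖ = 1) →
      m ≤ ∫ s in (0 : ℝ)..1,
        ∏ j, max (‖A j + B j * z j * Complex.exp (Complex.I * ω j * s)‖ - δ) 0 := by
  set J : ℝ → (ι → ℂ) → ℝ := fun δ z => ∫ s in (0 : ℝ)..1,
    ∏ j, max (‖A j + B j * z j * Complex.exp (Complex.I * ω j * s)‖ - δ) 0 with hJ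
  have hcont : Continuous (Function.uncurry J) := by
    refine intervalIntegral.continuous_parametric_intervalIntegral_of_continuous'
      (f := fun (p : ℝ × (ι → ℂ)) (s : ℝ) =>
        ∏ j, max (‖A j + B j * p.2 j * Complex.exp (Complex.I * ω j * s)‖ - p.1) 0) ?_ 0 1
    unfold Function.uncurry
    fun_prop
  set S : Set (ι → ℂ) := Set.univ.pi fun _ => Metric.sphere (0 : ℂ) 1 with hS
  have hSc : IsCompact S := isCompact_univ_pi fun _ => isCompact_sphere _ _
  have hpos : ∀ z ∈ S, 0 < J 0 z := fun z hz => by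
    have hz0 : ∀ j, z j ≠ 0 := fun j h0 => by simpa [h0] using hz j (mem_univ _)
    obtain ⟨s, hs, hs'⟩ := exists_forall_affine_exp_ne_zero hAB hz0
    refine intervalIntegral.integral_pos one_pos (by fun_prop)
      (fun _ _ => Finset.prod_nonneg fun _ _ => le_max_right _ _) ⟨s, hs, ?_⟩
    refine Finset.prod_pos fun j _ => lt_max_of_lt_left ?_
    simpa using hs' j
  have hev : ∀ᶠ δ in 𝓝 (0 : ℝ), ∀ z ∈ S, 0 < J δ z := by
    refine hSc.eventually_forall_of_forall_eventually fun z hz => ?_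
    exact (hcont.tendsto (0, z)).eventually (lt_mem_nhds (hpos z hz))
  obtain ⟨δ, hδ, hδS⟩ := ((eventually_mem_nhdsWithin : ∀ᶠ δ in 𝓝[>] (0 : ℝ), δ ∈ Ioi 0).and
    (nhdsWithin_le_nhds hev : ∀ᶠ δ in 𝓝[>] (0 : ℝ), ∀ z ∈ S, 0 < J δ z)).exists
  have hSne : S.Nonempty := ⟨fun _ => 1, fun _ _ => by simp⟩
  obtain ⟨z₀, hz₀, hmin⟩ := hSc.exists_isMinOn hSne
    (hcont.comp (Continuous.prodMk_right δ)).continuousOn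
  refine ⟨δ, hδ, J δ z₀, hδS z₀ hz₀, fun z hz => ?_⟩
  exact hmin (show z ∈ S from fun j _ => by simpa using hz j)

/-- A function that dominates a product of oscillating terms, none of which vanishes identically,
is not integrable at infinity. -/
theorem not_integrableOn_of_prod_le {A B : ι → ℂ} {ω : ι → ℝ}
    (hAB : ∀ j, (A j ≠ 0 ∧ B j = 0) ∨ (B j ≠ 0 ∧ ω j ≠ 0)) {f : ι → ℝ → ℝ}
    (hf0 : ∀ j τ, 0 ≤ f j τ) (hf : ∀ j, ∀ δ : ℝ, 0 < δ → ∀ᶠ τ : ℝ in atTop,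
      ‖A j + B j * Complex.exp (Complex.I * ω j * τ)‖ - δ ≤ f j τ)
    {G : ℝ → ℝ} (hG : ∀ᶠ τ in atTop, ∏ j, f j τ ≤ G τ) : ¬ IntegrableOn G (Ioi 0) := by
  intro hint
  obtain ⟨δ, hδ, m, hm, hmz⟩ := exists_pos_le_integral_prod_max hAB
  -- An integrable function has integrals over `[T, T + 1]` tending to `0`; with `z_j = e^{iω_j T}`
  -- the uniform bound `m` contradicts this.
  have hlim : Tendsto (fun T : ℝ => ∫ τ in T..T + 1, G τ) atTop (𝓝 0) := by
    have h1 := intervalIntegral_tendsto_integral_Ioi 0 hint tendsto_id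
    have h2 := intervalIntegral_tendsto_integral_Ioi 0 hint
      (tendsto_atTop_add_const_right atTop (1 : ℝ) tendsto_id)
    have h3 := h2.sub h1
    rw [sub_self] at h3
    refine h3.congr' ?_
    filter_upwards [eventually_ge_atTop 0] with T hT
    have hii : ∀ x y : ℝ, 0 ≤ x → 0 ≤ y → IntervalIntegrable G volume x y := fun x y hx hy => by
      rw [intervalIntegrable_iff]
      exact hint.mono_set fun t ht => lt_of_le_of_lt (le_min hx hy) ht.1
    exact intervalIntegral.integral_interval_sub_left (hii _ _ le_rfl (by simp; linarith))
      (hii _ _ le_rfl hT)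
  obtain ⟨T₀, hT₀⟩ := eventually_atTop.1 (hG.and (eventually_all.2 fun j => hf j δ hδ))
  obtain ⟨T, hT, hTm⟩ := ((eventually_ge_atTop (max T₀ 0)).and
    (hlim.eventually (gt_mem_nhds hm))).exists
  have h0T : 0 ≤ T := (le_max_right _ _).trans hT
  refine hTm.not_ge ((hmz (fun j => Complex.exp (Complex.I * ω j * T)) fun j => ?_).trans ?_)
  · rw [Complex.norm_exp]
    simp
  have hshift : ∫ τ in T..T + 1, G τ = ∫ s in (0 : ℝ)..1, G (s + T) := by
    rw [intervalIntegral.integral_comp_add_right, zero_add, add_comm]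
  rw [hshift]
  refine intervalIntegral.integral_mono_on zero_le_one
    (Continuous.intervalIntegrable (by fun_prop) _ _) ?_ fun s hs => ?_
  · have : IntervalIntegrable G volume (0 + T) (1 + T) := by
      rw [intervalIntegrable_iff]
      exact hint.mono_set fun t ht => lt_of_le_of_lt (le_min (by linarith) (by linarith)) ht.1
    simpa using this.comp_add_right T
  · obtain ⟨h1, h2⟩ := hT₀ (s + T) (by linarith [(le_max_left T₀ 0).trans hT, hs.1])
    refine le_trans (Finset.prod_le_prod (fun _ _ => le_max_right _ _) fun j _ => ?_) h1
    refine max_le ?_ (hf0 j _)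
    refine le_trans (le_of_eq ?_) (h2 j)
    rw [mul_assoc (B j), ← Complex.exp_add]
    push_cast
    ring_nf

end Oscillation

/-! ### Divergence for `re d ≤ 1`. -/

section Divergence

/-- For `u = 2e^τ - 1` one has `(u - 1)/(u + 1) = 1 - e^{-τ}` and `(u + 1)/2 = e^τ`. -/
theorem norm_legendreP_two_mul_exp_sub_one (d : ℂ) (κ : ℝ) {τ : ℝ} (hτ : 0 < τ) :
    ‖legendreP (-(d - 2) / 2) (-1 / 2 + Complex.I * κ) (2 * Real.exp τ - 1)‖ =
      (1 - Real.exp (-τ))⁻¹ ^ ((2 - d.re) / 4) * Real.exp (-τ / 2) *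
        ‖Complex.regularizedGaussHGFun (1 / 2 - Complex.I * κ) ((d - 1) / 2 - Complex.I * κ)
          ((d - 1) / 2 + 1 / 2) ((1 - Real.exp (-τ) : ℝ) : ℂ)‖ := by
  have h0 := Real.exp_pos τ
  have h1 : 1 < Real.exp τ := by simpa using hτ
  have hx : 0 < 1 - Real.exp (-τ) := by simpa using hτ
  have e1 : (2 * Real.exp τ - 1 - 1) / (2 * Real.exp τ - 1 + 1) = 1 - Real.exp (-τ) := by
    rw [Real.exp_neg]
    field_simp
    ring
  have e2 : (2 * Real.exp τ - 1 + 1) / (2 * Real.exp τ - 1 - 1) = (1 - Real.exp (-τ))⁻¹ := by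
    rw [← e1, inv_div]
  have e3 : (2 * Real.exp τ - 1 + 1) / 2 = Real.exp τ := by ring
  have r1 : (-(d - 2) / 2 / 2).re = (2 - d.re) / 4 := by
    rw [show -(d - 2) / 2 / 2 = (2 - d) / (4 : ℝ) by push_cast; ring, Complex.div_ofReal_re]
    simp
  have r2 : (-1 / 2 + Complex.I * κ).re = -1 / 2 := by simp
  unfold legendreP
  rw [e1, e2, e3, norm_mul, norm_mul, Complex.norm_cpow_eq_rpow_re_of_pos (inv_pos.2 hx),
    Complex.norm_cpow_eq_rpow_re_of_pos h0, ← Real.exp_mul, r1, r2]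
  ring_nf

/-- The Jacobian gives `e^τ`, the Legendre functions `e^{-3τ/2}`, and the weight at least `e^{τ/2}`
once `(2 - re d)/4 ≥ 1/4`: the exponentials balance exactly at `re d = 1`. The powers of `1 -
e^{-τ}` together only help. -/
theorem prod_norm_le_norm_two_mul_exp_mul_tripleIntegrand {d : ℂ} (hd : d.re ≤ 1) (κ ν lam : ℝ)
    {τ : ℝ} (hτ : 0 < τ) :
    ∏ j, ‖Complex.regularizedGaussHGFun (1 / 2 - Complex.I * (![κ, ν, lam] j : ℝ))
      ((d - 1) / 2 - Complex.I * (![κ, ν, lam] j : ℝ)) ((d - 1) / 2 + 1 / 2)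
      ((1 - Real.exp (-τ) : ℝ) : ℂ)‖ ≤
      ‖|2 * Real.exp τ| • tripleIntegrand d κ ν lam (2 * Real.exp τ - 1)‖ := by
  have h0 := Real.exp_pos τ
  have hx : 0 < 1 - Real.exp (-τ) := by simpa using hτ
  have hx1 : 1 - Real.exp (-τ) ≤ 1 := by linarith [Real.exp_pos (-τ)]
  have hq : (2 * Real.exp τ - 1) ^ 2 - 1 = 4 * Real.exp (2 * τ) * (1 - Real.exp (-τ)) := by
    rw [two_mul τ, Real.exp_add, Real.exp_neg]
    field_simp
    ring
  have hp : (-(d - 2) / 4).re = (2 - d.re) / 4 := by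
    simp
  rw [Fin.prod_univ_three, norm_smul, Real.norm_eq_abs, abs_abs, abs_of_pos (by positivity)]
  unfold tripleIntegrand
  rw [norm_mul, norm_mul, norm_mul, norm_legendreP_two_mul_exp_sub_one d κ hτ,
    norm_legendreP_two_mul_exp_sub_one d ν hτ, norm_legendreP_two_mul_exp_sub_one d lam hτ, hq,
    Complex.norm_cpow_eq_rpow_re_of_pos (by positivity), hp]
  simp only [Matrix.cons_val_zero, Matrix.cons_val_one, Matrix.cons_val]
  set F₁ := ‖Complex.regularizedGaussHGFun (1 / 2 - Complex.I * κ) ((d - 1) / 2 - Complex.I * κ)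
    ((d - 1) / 2 + 1 / 2) ((1 - Real.exp (-τ) : ℝ) : ℂ)‖
  set F₂ := ‖Complex.regularizedGaussHGFun (1 / 2 - Complex.I * ν) ((d - 1) / 2 - Complex.I * ν)
    ((d - 1) / 2 + 1 / 2) ((1 - Real.exp (-τ) : ℝ) : ℂ)‖
  set F₃ := ‖Complex.regularizedGaussHGFun (1 / 2 - Complex.I * lam) ((d - 1) / 2 - Complex.I * lam)
    ((d - 1) / 2 + 1 / 2) ((1 - Real.exp (-τ) : ℝ) : ℂ)‖
  set x := 1 - Real.exp (-τ)
  set p := (2 - d.re) / 4 with hpd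
  have hp4 : 1 / 4 ≤ p := by rw [hpd]; linarith
  have hw : Real.exp (τ / 2) ≤ x⁻¹ ^ p * x⁻¹ ^ p * x⁻¹ ^ p * (4 * Real.exp (2 * τ) * x) ^ p := by
    have hxi : 0 < x⁻¹ := inv_pos.2 hx
    rw [← Real.mul_rpow hxi.le hxi.le, ← Real.mul_rpow (by positivity) hxi.le,
      ← Real.mul_rpow (by positivity) (by positivity)]
    have h1 : 1 ≤ x⁻¹ := (one_le_inv₀ hx).2 hx1
    have h2 : Real.exp (2 * τ) ≤ x⁻¹ * x⁻¹ * x⁻¹ * (4 * Real.exp (2 * τ) * x) := by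
      have h3 : x⁻¹ * x⁻¹ * x⁻¹ * (4 * Real.exp (2 * τ) * x) =
          x⁻¹ * x⁻¹ * 4 * Real.exp (2 * τ) := by
        field_simp
      rw [h3]
      exact le_mul_of_one_le_left (Real.exp_pos _).le (by nlinarith)
    have h4 : 1 ≤ Real.exp (2 * τ) := by simpa using hτ.le
    calc Real.exp (τ / 2) = Real.exp (2 * τ) ^ (1 / 4 : ℝ) := by
          rw [← Real.exp_mul]; ring_nf
      _ ≤ Real.exp (2 * τ) ^ p := Real.rpow_le_rpow_of_exponent_le h4 hp4
      _ ≤ _ := Real.rpow_le_rpow (Real.exp_pos _).le h2 (by linarith)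
  have he : Real.exp τ * Real.exp (-τ / 2) ^ 3 * Real.exp (τ / 2) = 1 := by
    rw [← Real.exp_nat_mul, ← Real.exp_add, ← Real.exp_add, Real.exp_eq_one_iff]
    push_cast
    ring
  calc F₁ * F₂ * F₃ ≤ 2 * (Real.exp τ * Real.exp (-τ / 2) ^ 3 * Real.exp (τ / 2)) *
        (F₁ * F₂ * F₃) := by
        rw [he]
        exact le_mul_of_one_le_left (by positivity) (by norm_num)
    _ ≤ 2 * (Real.exp τ * Real.exp (-τ / 2) ^ 3 *
        (x⁻¹ ^ p * x⁻¹ ^ p * x⁻¹ ^ p * (4 * Real.exp (2 * τ) * x) ^ p)) * (F₁ * F₂ * F₃) := by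
        gcongr
    _ = _ := by ring

/-- The triple integral of Legendre functions does not converge absolutely for `re d ≤ 1`. -/
theorem one_lt_re_of_integrableOn_tripleIntegrand {d : ℂ} {κ ν lam : ℝ}
    (h : IntegrableOn (tripleIntegrand d κ ν lam) (Ioi 1)) : 1 < d.re := by
  by_contra hd
  push Not at hd
  have hint : IntegrableOn (fun τ : ℝ =>
      ‖|2 * Real.exp τ| • tripleIntegrand d κ ν lam (2 * Real.exp τ - 1)‖) (Ioi 0) := by
    refine Integrable.norm ?_
    refine (integrableOn_image_iff_integrableOn_abs_deriv_smul measurableSet_Ioi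
      (f := fun τ : ℝ => 2 * Real.exp τ - 1) (f' := fun τ => 2 * Real.exp τ) (fun τ _ => ?_)
      (fun τ _ τ' _ hττ => ?_) _).1 (h.mono_set ?_)
    · exact (((Real.hasDerivAt_exp τ).const_mul 2).sub_const 1).hasDerivWithinAt
    · simpa using hττ
    · rintro _ ⟨τ, hτ, rfl⟩
      have : 1 < Real.exp τ := by simpa using hτ
      simp only [mem_Ioi]
      linarith
  choose A B ω hAB hle using fun j : Fin 3 =>
    exists_norm_le_norm_regularizedGaussHGFun ((d - 1) / 2) (![κ, ν, lam] j)
  refine not_integrableOn_of_prod_le hAB (fun j τ => norm_nonneg _) hle ?_ hint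
  filter_upwards [eventually_gt_atTop 0] with τ hτ
  exact prod_norm_le_norm_two_mul_exp_mul_tripleIntegrand hd κ ν lam hτ

end Divergence

theorem mainTheorem7 (κ ν lam : ℝ) :
    (∀ d : ℂ, 1 < d.re →
      MeasureTheory.IntegrableOn (tripleIntegrand d κ ν lam) (Set.Ioi (1 : ℝ))) ∧
    (∀ d : ℂ, MeasureTheory.IntegrableOn (tripleIntegrand d κ ν lam) (Set.Ioi (1 : ℝ)) →
      hInt d κ ν lam = gProd d κ ν lam) := by
  refine ⟨fun d hd => integrableOn_tripleIntegrand hd κ ν lam, fun d h => ?_⟩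
  -- Absolute convergence already forces `re d > 1`, where the evaluation applies.
  exact hInt_eq_gProd (one_lt_re_of_integrableOn_tripleIntegrand h) κ ν lam
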